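/- Let $X=(X_1,\dots,X_m)$ be an $m$-tuple of smooth vector fields $X_i=\sum_{j=1}^n a_{ij}\partial_{x_j}$ on $\mathbb R^n$, linearly independent at every point, and let $\Omega\subset\mathbb R^n$ be open. For $\varphi\in C^1_c(\Omega;\mathbb R^m)$ put $\operatorname{div}_X\varphi:=\sum_{i=1}^m\sum_{j=1}^n\partial_{x_j}(a_{ij}\varphi_i)$. A function $u\in L^1_{loc}(\Omega)$ belongs to $BV_{H,loc}(\Omega)$ if there is an $\mathbb R^m$-valued Radon measure $D_Hu$ on $\Omega$ with $\int_\Omega\varphi\cdot dD_Hu=-\int_\Omega u\,\operatorname{div}_X\varphi\,d\mathscr L^n$ for all $\varphi\in C^1_c(\Omega;\mathbb R^m)$; $u\in BV_H(\Omega)$ if moreover $u\in L^1(\Omega)$ and $|D_Hu|(\Omega)<\infty$. On $\mathbb R^n\times\mathbb R$ consider the family $\widetilde X=((X_1,0),\dots,(X_m,0),\partial_t)$, and write $D_{\widetilde H}$ for the corresponding derivative. Let $\pi(x,t)=x$. Let $u\in BV_H(\Omega)$, with subgraph $E_u=\{(x,t)\in\Omega\times\mathbb R:t<u(x)\}$.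 Write $D_Hu=\sigma_u|D_Hu|$ with $|\sigma_u|=1$ $|D_Hu|$-a.e., and $D_Hu=D_H^au+D_H^su$, where $D^a_Hu=Xu\,\mathscr L^n$ is absolutely continuous and $D^s_Hu$ is singular with respect to $\mathscr L^n$. Then $\chi_{E_u}\in BV_{\widetilde H,loc}(\Omega\times\mathbb R)$. Moreover, write $D_{\widetilde H}\chi_{E_u}=\nu_{E_u}|D_{\widetilde H}\chi_{E_u}|$ with $\nu_{E_u}$ Borel and $|\nu_{E_u}|=1$ $|D_{\widetilde H}\chi_{E_u}|$-a.e., and let $$S=\{(x,t)\in\Omega\times\mathbb R:(\nu_{E_u})_{m+1}(x,t)=0\},\qquad T=\{(x,t)\in\Omega\times\mathbb R:(\nu_{E_u})_{m+1}(x,t)\ne0\}.$$ Then $$\nu_{E_u}(x,t)=(\sigma_u(x),0)\quad\text{for }|D_{\widetilde H}\chi_{E_u}|\text{-a.e. }(x,t)\in S,$$ $$\nu_{E_u}(x,t)=\frac{(Xu(x),-1)}{\sqrt{1+|Xu(x)|^2}}\quad\text{for }|D_{\widetilde H}\chi_{E_u}|\text{-a.e. }(x,t)\in T,$$ $$\pi_\#(D_{\widetilde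 H}\chi_{E_u}\llcorner S)=(D_H^su,0),\qquad \pi_\#(D_{\widetilde H}\chi_{E_u}\llcorner T)=(D_H^au,-\mathscr L^n)$$ as $\mathbb R^{m+1}$-valued Radon measures on $\Omega$; in particular, $|D_{\widetilde H}\chi_{E_u}|(\pi^{-1}(B))<\infty$ for every Borel set $B$ contained in a compact subset of $\Omega$. -/

import Mathlib

open MeasureTheory Set Filter Topology
open scoped ENNReal ContDiff

/-- Borel sets that are relatively compact in `U`, i.e. contained in a compact subset of `U`. -/
def IsRelCompactBorel {E : Type*} [TopologicalSpace E] [MeasurableSpace E] (U B : Set E) : Prop :=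
  MeasurableSet B ∧ ∃ K, IsCompact K ∧ K ⊆ U ∧ B ⊆ K

/-- A `V`-valued Radon measure on `U`: a `V`-valued set function on the relatively compact Borel
subsets of `U`, countably additive on the Borel subsets of each compact `K ⊆ U`.
(The values of `toFun` on all other sets are irrelevant.) -/
structure RadonVectorMeasure {E : Type*} [TopologicalSpace E] [MeasurableSpace E]
    (U : Set E) (V : Type*) [NormedAddCommGroup V] where
  toFun : Set E → V
  hasSum_iUnion' : ∀ K : Set E, IsCompact K → K ⊆ U → ∀ B : ℕ → Set E,
    (∀ i, MeasurableSet (B i)) → (∀ i, B i ⊆ K) → Pairwise (fun i j => Disjoint (B i) (B j)) →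
      HasSum (fun i => toFun (B i)) (toFun (⋃ i, B i))

namespace RadonVectorMeasure

section Basic

variable {E : Type*} [TopologicalSpace E] [MeasurableSpace E] {U : Set E}
  {V : Type*} [NormedAddCommGroup V]

instance : CoeFun (RadonVectorMeasure U V) (fun _ => Set E → V) := ⟨RadonVectorMeasure.toFun⟩

theorem apply_empty (μ : RadonVectorMeasure U V) : μ ∅ = 0 := by
  have h := μ.hasSum_iUnion' ∅ isCompact_empty (empty_subset U) (fun _ => ∅)
    (fun _ => MeasurableSet.empty) (fun _ => Subset.rfl)
    (fun _ _ _ => disjoint_bot_left)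
  exact tendsto_nhds_unique tendsto_const_nhds h.summable.tendsto_atTop_zero

instance : Zero (RadonVectorMeasure U V) :=
  ⟨⟨fun _ => 0, fun _ _ _ _ _ _ _ => hasSum_zero⟩⟩

instance : Neg (RadonVectorMeasure U V) :=
  ⟨fun μ => ⟨fun B => -μ B, fun K hK hKU B hB hBK hd =>
    (μ.hasSum_iUnion' K hK hKU B hB hBK hd).neg⟩⟩

open Classical in
/-- The restriction `μ ⌞ S` to a Borel set `S` (zero if `S` is not Borel). -/
noncomputable def restrict (μ : RadonVectorMeasure U V) (S : Set E) : RadonVectorMeasure U V where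
  toFun B := if MeasurableSet S then μ (B ∩ S) else 0
  hasSum_iUnion' K hK hKU B hB hBK hd := by
    by_cases hS : MeasurableSet S
    · simp only [hS, if_true, iUnion_inter]
      exact μ.hasSum_iUnion' K hK hKU (fun i => B i ∩ S) (fun i => (hB i).inter hS)
        (fun i => inter_subset_left.trans (hBK i))
        (fun i j hij => (hd hij).mono inter_subset_left inter_subset_left)
    · simp only [hS, if_false]
      exact hasSum_zero

/-- A positive Radon measure, seen as a real-valued Radon measure on `U`. -/
noncomputable def ofMeasure (U : Set E) (ρ : Measure E) [IsFiniteMeasureOnCompacts ρ] :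
    RadonVectorMeasure U ℝ where
  toFun B := ρ.real B
  hasSum_iUnion' K hK hKU B hB hBK hd := by
    have hfin : ∑' i, ρ (B i) ≠ ⊤ := by
      rw [← measure_iUnion hd hB]
      exact ((measure_mono (iUnion_subset hBK)).trans_lt hK.measure_lt_top).ne
    have h := ENNReal.hasSum_toReal hfin
    simp only [Measure.real]
    rwa [measure_iUnion hd hB,
      ENNReal.tsum_toReal_eq fun i => ((measure_mono (hBK i)).trans_lt hK.measure_lt_top).ne]

/-- The largest size of `μ` on the traces of `B` on the compact subsets of `U`. -/
noncomputable def compactSup (μ : RadonVectorMeasure U V) (B : Set E) : ℝ≥0∞ :=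
  ⨆ K : {K : Set E // IsCompact K ∧ K ⊆ U}, ‖μ (B ∩ K)‖ₑ

theorem compactSup_empty (μ : RadonVectorMeasure U V) : μ.compactSup ∅ = 0 := by
  simp [compactSup, apply_empty]

end Basic

section Variation

variable {E : Type*} [TopologicalSpace E] [T2Space E] [MeasurableSpace E] [BorelSpace E]
  {U : Set E} {V : Type*} [NormedAddCommGroup V]

/-- The finite vector measure `B ↦ μ (B ∩ K)`, for a compact set `K ⊆ U`. -/
noncomputable def onCompact (μ : RadonVectorMeasure U V) (K : Set E) (hK : IsCompact K)
    (hKU : K ⊆ U) : VectorMeasure E V := by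
  classical exact
  { measureOf' := fun B => if MeasurableSet B then μ (B ∩ K) else 0
    empty' := by simp [apply_empty]
    not_measurable' := fun B hB => by simp [hB]
    m_iUnion' := fun B hB hd => by
      simp only [hB, MeasurableSet.iUnion hB, if_true, iUnion_inter]
      exact μ.hasSum_iUnion' K hK hKU (fun i => B i ∩ K)
        (fun i => (hB i).inter hK.measurableSet) (fun i => inter_subset_right)
        (fun i j hij => (hd hij).mono inter_subset_left inter_subset_left) }

theorem isSigmaSubadditive_compactSup (μ : RadonVectorMeasure U V) :
    IsSigmaSubadditiveSetFun μ.compactSup := by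
  intro s hs
  refine iSup_le fun K => ?_
  have h := μ.hasSum_iUnion' K.1 K.2.1 K.2.2 (fun i => (s i).1 ∩ K.1)
    (fun i => (s i).2.inter K.2.1.measurableSet) (fun i => inter_subset_right)
    (fun i j hij => (hs hij).mono inter_subset_left inter_subset_left)
  rw [← iUnion_inter] at h
  rw [← h.tsum_eq]
  refine enorm_tsum_le_tsum_enorm.trans (ENNReal.tsum_le_tsum fun i => ?_)
  exact le_iSup (fun K : {K : Set E // IsCompact K ∧ K ⊆ U} => ‖μ ((s i).1 ∩ K)‖ₑ) K

/-- The total variation `|μ|`, a positive Borel measure: `|μ|(B)` is the supremum of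
`∑ ‖μ (B_l ∩ K_l)‖` over the finite Borel partitions `(B_l)` of `B` and compact sets `K_l ⊆ U`,
i.e. the supremum of `∑ ‖μ (C_l)‖` over the finite families of disjoint relatively compact Borel
subsets `C_l` of `U ∩ B`. -/
noncomputable def variation (μ : RadonVectorMeasure U V) : Measure E :=
  preVariation μ.compactSup μ.isSigmaSubadditive_compactSup μ.compactSup_empty

/-- The decomposition into absolutely continuous and singular part with respect to `ρ`:
`μ = μa + μs` with `|μa| ≪ ρ` and `|μs| ⟂ ρ`. -/
structure IsLebesgueDecomposition (μ μa μs : RadonVectorMeasure U V) (ρ : Measure E) : Prop where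
  eq_add : ∀ B, IsRelCompactBorel U B → μ B = μa B + μs B
  absolutelyContinuous : μa.variation ≪ ρ
  mutuallySingular : μs.variation ⟂ₘ ρ

variable [NormedSpace ℝ V]

/-- `μ = f ρ` on `U`, with a locally integrable density `f`. -/
def HasDensity (μ : RadonVectorMeasure U V) (f : E → V) (ρ : Measure E) : Prop :=
  LocallyIntegrableOn f U ρ ∧ ∀ B, IsRelCompactBorel U B → μ B = ∫ x in B, f x ∂ρ

/-- Polar decomposition `μ = σ |μ|`, with `|σ| = 1` almost everywhere. -/
structure IsPolar (μ : RadonVectorMeasure U V) (σ : E → V) : Prop where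
  aestronglyMeasurable : AEStronglyMeasurable σ μ.variation
  norm_eq_one : ∀ᵐ x ∂μ.variation, ‖σ x‖ = 1
  eq_integral : ∀ B, IsRelCompactBorel U B → μ B = ∫ x in B, σ x ∂μ.variation

/-- `π_# μ = lam` as Radon measures on `W`: for every relatively compact Borel `B ⊆ W`, the set
`π⁻¹ B` has finite total variation, and its `μ`-measure, i.e. the limit of `μ (π⁻¹ B ∩ K)` along the
compact sets `K ↑ U`, is `lam B`. -/
def IsPushforward {F : Type*} [TopologicalSpace F] [MeasurableSpace F] {W : Set F}
    (π : E → F) (μ : RadonVectorMeasure U V) (lam : RadonVectorMeasure W V) : Prop :=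
  ∀ B, IsRelCompactBorel W B →
    μ.variation (π ⁻¹' B) < ⊤ ∧
      Tendsto (fun K : {K : Set E // IsCompact K ∧ K ⊆ U} => μ (π ⁻¹' B ∩ K)) atTop (𝓝 (lam B))

end Variation

end RadonVectorMeasure

/-- The vector `(v, t) ∈ ℝᵐ⁺¹`, for `v ∈ ℝᵐ` and `t ∈ ℝ`. -/
noncomputable def euclideanSnoc {m : ℕ} (v : EuclideanSpace ℝ (Fin m)) (t : ℝ) :
    EuclideanSpace ℝ (Fin (m + 1)) :=
  WithLp.toLp 2 (Fin.snoc (α := fun _ => ℝ) (fun i => v i) t)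

/-- The `ℝᵐ⁺¹`-valued measure `(μ, κ)`. -/
noncomputable def RadonVectorMeasure.snoc {E : Type*} [TopologicalSpace E] [MeasurableSpace E]
    {U : Set E} {m : ℕ} (μ : RadonVectorMeasure U (EuclideanSpace ℝ (Fin m)))
    (κ : RadonVectorMeasure U ℝ) : RadonVectorMeasure U (EuclideanSpace ℝ (Fin (m + 1))) where
  toFun B := euclideanSnoc (μ B) (κ B)
  hasSum_iUnion' K hK hKU B hB hBK hd := by
    have h1 := μ.hasSum_iUnion' K hK hKU B hB hBK hd
    have h2 := κ.hasSum_iUnion' K hK hKU B hB hBK hd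
    refine ((EuclideanSpace.equiv (Fin (m + 1)) ℝ).symm.hasSum).2 (Pi.hasSum.2 fun j => ?_)
    refine Fin.lastCases ?_ (fun i => ?_) j
    · simpa [euclideanSnoc] using h2
    · simpa [euclideanSnoc] using h1.mapL (EuclideanSpace.proj (𝕜 := ℝ) i)

section HVariation

variable {E : Type*} [NormedAddCommGroup E] [NormedSpace ℝ E]

/-- `div_X φ = ∑ᵢ ∑ⱼ ∂ⱼ (aᵢⱼ φᵢ)`, i.e. the sum over `i` of the divergences of the vector fields
`φᵢ Xᵢ`, the divergence of a vector field being the trace of its differential. -/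
noncomputable def divX {m : ℕ} (X : Fin m → E → E) (φ : E → EuclideanSpace ℝ (Fin m)) (x : E) : ℝ :=
  ∑ i, LinearMap.trace ℝ E (fderiv ℝ (fun y => φ y i • X i y) x).toLinearMap

variable [MeasureSpace E] [BorelSpace E]

/-- `D = D_H u = (D_{X₁} u, …, D_{X_m} u)` on `U` in the sense of distributions:
`∫ φ · dD = - ∫ u div_X φ` for all `φ ∈ C¹_c(U; ℝᵐ)`. -/
def IsHDerivative {m : ℕ} (X : Fin m → E → E) (U : Set E) (u : E → ℝ)
    (D : RadonVectorMeasure U (EuclideanSpace ℝ (Fin m))) : Prop :=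
  ∀ φ : E → EuclideanSpace ℝ (Fin m), ContDiff ℝ 1 φ →
    ∀ (hc : HasCompactSupport φ) (hs : tsupport φ ⊆ U),
      (D.onCompact (tsupport φ) hc hs).integral φ (innerSL ℝ) = -∫ x in U, u x * divX X φ x

/-- `u ∈ BV_{H,loc}(U)`. -/
def MemBVHLoc {m : ℕ} (X : Fin m → E → E) (U : Set E) (u : E → ℝ) : Prop :=
  LocallyIntegrableOn u U ∧
    ∃ D : RadonVectorMeasure U (EuclideanSpace ℝ (Fin m)), IsHDerivative X U u D

/-- `u ∈ BV_H(U)`. -/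
def MemBVH {m : ℕ} (X : Fin m → E → E) (U : Set E) (u : E → ℝ) : Prop :=
  IntegrableOn u U ∧
    ∃ D : RadonVectorMeasure U (EuclideanSpace ℝ (Fin m)),
      IsHDerivative X U u D ∧ D.variation U < ⊤

end HVariation

/-- The fields `(X₁, 0), …, (X_m, 0), ∂_t` on `E × ℝ`. -/
def extendedFields {E : Type*} [Zero E] {m : ℕ} (X : Fin m → E → E) :
    Fin (m + 1) → E × ℝ → E × ℝ :=
  Fin.snoc (α := fun _ => E × ℝ → E × ℝ) (fun i p => (X i p.1, 0)) (fun _ => (0, 1))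

/-- The subgraph `{(x, t) ∈ Ω × ℝ : t < u x}`. -/
def subgraph {E : Type*} (Ω : Set E) (u : E → ℝ) : Set (E × ℝ) :=
  {p | p.1 ∈ Ω ∧ p.2 < u p.1}

/-! Let Q be the total variation of the derivative of χ_{E_u}, and ν its normal. The vector measure
(D_H u, -ℒⁿ) on Ω has an explicit polar form τM. If N is a Lebesgue null set carrying D_H^s u, then
τ = (σ_u, 0) and M = |D_H u| on N, while off N one has τ = (Xu, -1)/√(1+|Xu|²) and M = √(1+|Xu|²)
ℒⁿ. Everything follows from ν(x,t) = τ(x) for Q-a.e. (x,t) together with π_# Q = M: the last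
component of τ vanishes exactly on N, so S agrees with N × ℝ up to Q-null sets, T with its
complement, and the two push-forwards are the restrictions of τM to N and to its complement.

Both relations come from a rigidity argument with two inputs. The first is π_#(νQ) = τM
(`integral_inner_fst`), obtained by testing with η(t) g(x) and letting η tend to 1. The second is
π_# Q ≤ M (`prod_le`). For compact K they give M(K) = ∫_K |τ|² dM = ∫_{K×ℝ} τ(x)·ν dQ ≤ Q(K×ℝ) ≤
M(K). Equality forces τ·ν = 1, hence ν = τ∘π (`ae_eq`, `prod_eq`).

The second input rests on smoothing. For a C¹ function v, the derivative of the subgraph is (Xv,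
-1)ℒⁿ carried to the graph (`integral_lt_graph_divX`). For mollifications v_k of u, extended by
zero, (Xv_k, -1) is the mollification of τM plus commutators of mollification with the fields.
Friedrichs' lemma (`tendsto_commutator`) makes these vanish in L¹ on compact sets, so the masses of
|(Xv_k, -1)| are asymptotically bounded by M. The subgraphs of v_k converge in L¹; a weak limit of
|(Xv_k, -1)|ℒⁿ, carried to the graphs, therefore dominates Q on compact sets and projects below M.
Weak limits of the positive and negative parts of the components of (Xv_k, -1) produce the
derivative of χ_{E_u} itself, which is the local BV claim. -/

/-! ### Vector measures in Euclidean space: finite variation and densities. -/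

theorem MeasureTheory.VectorMeasure.isFiniteMeasure_variation {Y : Type*} [MeasurableSpace Y]
    {m : ℕ} (μ : VectorMeasure Y (EuclideanSpace ℝ (Fin m))) : IsFiniteMeasure μ.variation := by
  let c : Fin m → SignedMeasure Y := fun i =>
    μ.mapRange (EuclideanSpace.proj (𝕜 := ℝ) i).toLinearMap.toAddMonoidHom
      (EuclideanSpace.proj (𝕜 := ℝ) i).continuous
  -- The components are signed measures, whose total variations are finite, and the Euclidean norm
  -- is at most the sum of the absolute values of the coordinates.
  have hle : μ.variation ≤ ∑ i, (c i).totalVariation := by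
    refine VectorMeasure.variation_le_of_forall_enorm_le fun B hB => ?_
    have h1 : ‖μ B‖ₑ ≤ ∑ i, ‖c i B‖ₑ := by
      have h2 : μ B = ∑ i, EuclideanSpace.single i (μ B i) := by
        ext j
        simp [Pi.single_apply]
      calc ‖μ B‖ₑ = ‖∑ i, EuclideanSpace.single i (μ B i)‖ₑ := by rw [← h2]
        _ ≤ ∑ i, ‖EuclideanSpace.single i (μ B i)‖ₑ := enorm_sum_le _ _
        _ = ∑ i, ‖c i B‖ₑ := by
          refine Finset.sum_congr rfl fun i _ => ?_
          rw [← ofReal_norm, ← ofReal_norm, PiLp.norm_single]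
          rfl
    refine h1.trans ?_
    simp only [Measure.coe_finsetSum, Finset.sum_apply]
    exact Finset.sum_le_sum fun i _ => (c i).enorm_le_totalVariation B
  exact ⟨(hle univ).trans_lt (measure_lt_top _ _)⟩

/-- The two sides agree on simple functions, and bounded simple approximations pass to the limit on
both by dominated convergence. This converts the pairings in `IsHDerivative` into ordinary
integrals. -/
theorem MeasureTheory.Measure.integral_withDensityᵥ_innerSL {Y : Type*} [MeasurableSpace Y]
    {V : Type*} [NormedAddCommGroup V] [InnerProductSpace ℝ V] [CompleteSpace V]
    {P : Measure Y} {h : Y → V}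
    (hh : Integrable h P) {f : Y → V} (hf : StronglyMeasurable f) {C : ℝ} (hC : ∀ x, ‖f x‖ ≤ C) :
    (P.withDensityᵥ h).integral f (innerSL ℝ) = ∫ x, inner ℝ (f x) (h x) ∂P := by
  have hfin : IsFiniteMeasure (P.withDensityᵥ h).variation := by
    rw [Measure.variation_withDensityᵥ hh]
    exact ⟨by simpa [hasFiniteIntegral_iff_enorm] using hh.2⟩
  have hint : ∀ g : Y → V, StronglyMeasurable g → (∃ C, ∀ x, ‖g x‖ ≤ C) →
      Integrable (fun x => inner ℝ (g x) (h x)) P := by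
    rintro g hg ⟨C, hC⟩
    refine Integrable.mono' (g := fun x => C * ‖h x‖) (hh.norm.const_mul C)
      (hg.aestronglyMeasurable.inner hh.1) (Eventually.of_forall fun x => ?_)
    refine (norm_inner_le_norm _ _).trans ?_
    gcongr
    exact hC x
  have hsimple : ∀ g : SimpleFunc Y V,
      (P.withDensityᵥ h).integral g (innerSL ℝ) = ∫ x, inner ℝ (g x) (h x) ∂P := by
    intro g
    induction g using SimpleFunc.induction with
    | const c hs =>
      classical
      rename_i s
      rw [SimpleFunc.coe_piecewise, SimpleFunc.coe_const, SimpleFunc.coe_const,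
        Function.const_zero, Set.piecewise_eq_indicator]
      have e1 : (s.indicator (Function.const Y c)) = s.indicator (fun _ => c) := rfl
      rw [e1, VectorMeasure.integral_indicator_const _ hs, withDensityᵥ_apply hh hs]
      have e2 : (fun x => inner ℝ (s.indicator (fun _ => c) x) (h x))
          = s.indicator (fun x => inner ℝ c (h x)) := by
        ext x
        by_cases hx : x ∈ s <;> simp [hx]
      rw [e2, integral_indicator hs]
      exact (integral_inner hh.integrableOn c).symm
    | add hdisj hf hg =>
      rename_i f g
      rw [SimpleFunc.coe_add, VectorMeasure.integral_add (f.integrable_of_isFiniteMeasure)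
        (g.integrable_of_isFiniteMeasure), hf, hg, ← integral_add]
      · simp [inner_add_left]
      · exact hint _ f.stronglyMeasurable f.exists_forall_norm_le
      · exact hint _ g.stronglyMeasurable g.exists_forall_norm_le
  have hC' : ∀ n x, ‖hf.approxBounded C n x‖ ≤ C := fun n x =>
    hf.norm_approxBounded_le ((norm_nonneg _).trans (hC x)) n x
  have hlim : ∀ x, Tendsto (fun n => hf.approxBounded C n x) atTop (𝓝 (f x)) := fun x =>
    hf.tendsto_approxBounded_of_norm_le (hC x)
  have l1 : Tendsto (fun n => (P.withDensityᵥ h).integral (hf.approxBounded C n) (innerSL ℝ)) atTop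
      (𝓝 ((P.withDensityᵥ h).integral f (innerSL ℝ))) :=
    VectorMeasure.tendsto_integral_of_dominated_convergence (fun _ => C)
    (fun n => (hf.approxBounded C n).stronglyMeasurable.aestronglyMeasurable)
    (integrable_const _) (fun n => Eventually.of_forall (hC' n)) (Eventually.of_forall hlim)
  have l2 : Tendsto (fun n => ∫ x, inner ℝ (hf.approxBounded C n x) (h x) ∂P) atTop
      (𝓝 (∫ x, inner ℝ (f x) (h x) ∂P)) := by
    refine tendsto_integral_of_dominated_convergence (fun x => C * ‖h x‖)
      (fun n => (hf.approxBounded C n).stronglyMeasurable.aestronglyMeasurable.inner hh.1)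
      (hh.norm.const_mul C) (fun n => Eventually.of_forall fun x => ?_)
      (Eventually.of_forall fun x => (hlim x).inner tendsto_const_nhds)
    refine (norm_inner_le_norm _ _).trans ?_
    gcongr
    exact hC' n x
  exact tendsto_nhds_unique (l1.congr fun n => hsimple _) l2

/-! ### Total variation of Radon vector measures. -/

namespace RadonVectorMeasure

section

variable {E : Type*} [TopologicalSpace E] [MeasurableSpace E] {U : Set E}

theorem _root_.IsRelCompactBorel.mono {B C : Set E} (hB : IsRelCompactBorel U B)
    (hC : MeasurableSet C) (h : C ⊆ B) : IsRelCompactBorel U C := by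
  obtain ⟨K, hK, hKU, hBK⟩ := hB.2
  exact ⟨hC, K, hK, hKU, h.trans hBK⟩

theorem _root_.IsRelCompactBorel.of_isCompact [T2Space E] [BorelSpace E] {K : Set E}
    (hK : IsCompact K) (hKU : K ⊆ U) : IsRelCompactBorel U K :=
  ⟨hK.measurableSet, K, hK, hKU, Subset.rfl⟩

end

variable {E : Type*} [TopologicalSpace E] [T2Space E] [MeasurableSpace E] [BorelSpace E]
  {U : Set E} {V : Type*} [NormedAddCommGroup V]

theorem variation_eq_preVariationFun (μ : RadonVectorMeasure U V) {s : Set E}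
    (hs : MeasurableSet s) : μ.variation s = preVariationFun μ.compactSup s := by
  rw [variation, preVariation_apply, VectorMeasure.ennrealToMeasure_apply hs,
    ennrealPreVariation_apply]

/-- Each sum over a partition of `s` is bounded by the corresponding sum of values of `m`, which
additivity of `m` bounds by `m s`. -/
theorem variation_apply_le (μ : RadonVectorMeasure U V) {s : Set E} (hs : MeasurableSet s)
    {m : Measure E} (h : ∀ B, IsRelCompactBorel U B → B ⊆ s → ‖μ B‖ₑ ≤ m B) :
    μ.variation s ≤ m s := by
  rw [variation_eq_preVariationFun μ hs, preVariationFun_apply _ hs, iSup_le_iff]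
  intro i
  calc
    ∑ x ∈ i.parts, μ.compactSup x ≤ ∑ x ∈ i.parts, m x := by
      refine Finset.sum_le_sum fun t ht => iSup_le fun K => ?_
      have hts : (t : Set E) ⊆ s := i.le ht
      refine (h _ ⟨t.2.inter K.2.1.measurableSet, K, K.2.1, K.2.2, inter_subset_right⟩
        (inter_subset_left.trans hts)).trans (measure_mono inter_subset_left)
    _ = m (⋃ x ∈ i.parts, x) := by
      refine (measure_biUnion_finset ?_ fun b _ => b.property).symm
      intro a ha b hb hab
      simpa [disjoint_iff, Subtype.ext_iff] using i.disjoint ha hb hab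
    _ ≤ m s := measure_mono <| Set.iUnion₂_subset fun _ hp => Subtype.coe_le_coe.mpr (i.le hp)

theorem enorm_le_variation (μ : RadonVectorMeasure U V) {B : Set E} (hB : IsRelCompactBorel U B) :
    ‖μ B‖ₑ ≤ μ.variation B := by
  obtain ⟨K, hK, hKU, hBK⟩ := hB.2
  rw [variation_eq_preVariationFun μ hB.1]
  -- The bound comes from the partition with the single piece `B`, which is a legitimate
  -- `Finpartition` only if `B` is nonempty.
  rcases B.eq_empty_or_nonempty with rfl | hne
  · simp [apply_empty]
  have h1 : ‖μ B‖ₑ ≤ μ.compactSup B := by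
    have := le_iSup (fun K : {K : Set E // IsCompact K ∧ K ⊆ U} => ‖μ (B ∩ K)‖ₑ) ⟨K, hK, hKU⟩
    rw [inter_eq_left.2 hBK] at this
    exact this
  refine h1.trans ?_
  have hb : (⟨B, hB.1⟩ : Subtype (MeasurableSet (α := E))) ≠ ⊥ := by
    intro h
    exact hne.ne_empty (congrArg Subtype.val h)
  have h2 := preVariation.sum_le μ.compactSup hB.1 (Finpartition.indiscrete hb)
  simpa using h2

theorem apply_eq_zero (μ : RadonVectorMeasure U V) {B : Set E} (hB : IsRelCompactBorel U B)
    (h : μ.variation B = 0) : μ B = 0 := by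
  have := μ.enorm_le_variation hB
  rw [h] at this
  simpa using this

theorem variation_compl (μ : RadonVectorMeasure U V) (hU : MeasurableSet U) :
    μ.variation Uᶜ = 0 := by
  have := μ.variation_apply_le hU.compl (m := 0) fun B hB hBU => by
    obtain ⟨K, hK, hKU, hBK⟩ := hB.2
    have : B = ∅ := by
      rw [eq_empty_iff_forall_notMem]
      exact fun x hx => hBU hx (hKU (hBK hx))
    simp [this, apply_empty]
  simpa using this

theorem apply_union (μ : RadonVectorMeasure U V) {A B : Set E} (hA : IsRelCompactBorel U A)
    (hB : IsRelCompactBorel U B) (hd : Disjoint A B) : μ (A ∪ B) = μ A + μ B := by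
  obtain ⟨K, hK, hKU, hAK⟩ := hA.2
  obtain ⟨L, hL, hLU, hBL⟩ := hB.2
  have hA' : A ⊆ K ∪ L := hAK.trans subset_union_left
  have hB' : B ⊆ K ∪ L := hBL.trans subset_union_right
  have h := (μ.onCompact (K ∪ L) (hK.union hL) (union_subset hKU hLU)).of_union hd hA.1 hB.1
  have key : ∀ C, MeasurableSet C → C ⊆ K ∪ L →
      (μ.onCompact (K ∪ L) (hK.union hL) (union_subset hKU hLU)) C = μ C := by
    intro C hC hCK
    classical
    refine (if_pos hC).trans ?_
    rw [inter_eq_left.2 hCK]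
  rwa [key _ (hA.1.union hB.1) (union_subset hA' hB'), key _ hA.1 hA', key _ hB.1 hB'] at h

theorem onCompact_apply (μ : RadonVectorMeasure U V) {K : Set E} (hK : IsCompact K)
    (hKU : K ⊆ U) {B : Set E} (hB : MeasurableSet B) :
    μ.onCompact K hK hKU B = μ (B ∩ K) := if_pos hB

theorem variation_restrict_le (μ : RadonVectorMeasure U V) {S : Set E} (hS : MeasurableSet S)
    {s : Set E} (hs : MeasurableSet s) : (μ.restrict S).variation s ≤ μ.variation s := by
  refine variation_apply_le _ hs fun B hB _ => ?_
  have : μ.restrict S B = μ (B ∩ S) := if_pos hS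
  rw [this]
  exact (μ.enorm_le_variation (hB.mono (hB.1.inter hS) inter_subset_left)).trans
    (measure_mono inter_subset_left)

theorem variation_lt_top {m : ℕ} (μ : RadonVectorMeasure U (EuclideanSpace ℝ (Fin m)))
    {K : Set E} (hK : IsCompact K) (hKU : K ⊆ U) : μ.variation K < ⊤ := by
  have hfin := (μ.onCompact K hK hKU).isFiniteMeasure_variation
  refine (μ.variation_apply_le hK.measurableSet
    (m := (μ.onCompact K hK hKU).variation) fun B hB hBK => ?_).trans_lt (measure_lt_top _ _)
  have := (μ.onCompact K hK hKU).enorm_measure_le_variation B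
  rwa [μ.onCompact_apply hK hKU hB.1, inter_eq_left.2 hBK] at this

theorem onCompact_integral_eq {V : Type*} [NormedAddCommGroup V] [InnerProductSpace ℝ V]
    [CompleteSpace V] (μ : RadonVectorMeasure U V)
    {K : Set E} (hK : IsCompact K) (hKU : K ⊆ U) {P : Measure E} {h : E → V}
    (hh : IntegrableOn h K P) (hμ : ∀ B, MeasurableSet B → B ⊆ K → μ B = ∫ x in B, h x ∂P)
    {f : E → V} (hf : StronglyMeasurable f) {C : ℝ} (hC : ∀ x, ‖f x‖ ≤ C) :
    (μ.onCompact K hK hKU).integral f (innerSL ℝ) = ∫ x in K, inner ℝ (f x) (h x) ∂P := by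
  have : μ.onCompact K hK hKU = (P.restrict K).withDensityᵥ h := by
    ext B hB
    rw [withDensityᵥ_apply hh hB, μ.onCompact_apply hK hKU hB,
      hμ _ (hB.inter hK.measurableSet) inter_subset_right, Measure.restrict_restrict hB]
  rw [this, Measure.integral_withDensityᵥ_innerSL hh hf hC]

end RadonVectorMeasure

/-! ### Subgraphs, supports and the extended fields. -/

theorem measurableSet_lt_graph {E : Type*} [MeasurableSpace E] {v : E → ℝ} (hv : Measurable v) :
    MeasurableSet {p : E × ℝ | p.2 < v p.1} :=
  measurableSet_lt measurable_snd (hv.comp measurable_fst)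

theorem hasCompactSupport_slice {E V : Type*} [TopologicalSpace E] [T2Space E]
    [Zero V] {f : E × ℝ → V} (hc : HasCompactSupport f)
    (w : E → ℝ) : HasCompactSupport fun x => f (x, w x) := by
  refine HasCompactSupport.intro (K := Prod.fst '' tsupport f) (hc.isCompact.image continuous_fst)
    fun x hx => ?_
  exact image_eq_zero_of_notMem_tsupport fun h => hx ⟨_, h, rfl⟩

theorem divX_eq_zero {E : Type*} [NormedAddCommGroup E] [NormedSpace ℝ E] {m : ℕ} {X : Fin m → E → E}
    {φ : E → EuclideanSpace ℝ (Fin m)} {x : E} (hx : x ∉ tsupport φ) : divX X φ x = 0 := by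
  refine Finset.sum_eq_zero fun i _ => ?_
  have : (fun y => φ y i • X i y) =ᶠ[𝓝 x] fun _ => 0 := by
    filter_upwards [(isClosed_tsupport φ).isOpen_compl.mem_nhds hx] with y hy
    simp [image_eq_zero_of_notMem_tsupport hy]
  rw [this.fderiv_eq]
  simp

theorem contDiff_extendedFields {E : Type*} [NormedAddCommGroup E] [NormedSpace ℝ E] {m : ℕ} {X : Fin m → E → E} (hX : ∀ i, ContDiff ℝ 1 (X i))
    (i : Fin (m + 1)) : ContDiff ℝ 1 (extendedFields X i) := by
  refine Fin.lastCases ?_ (fun i => ?_) i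
  · simpa [extendedFields] using contDiff_const
  · have : ContDiff ℝ 1 fun p : E × ℝ => (X i p.1, (0 : ℝ)) :=
      ((hX i).comp contDiff_fst).prodMk contDiff_const
    simpa [extendedFields] using this

theorem hasCompactSupport_divX {E : Type*} [NormedAddCommGroup E] [NormedSpace ℝ E] {m : ℕ} {X : Fin m → E → E}
    {φ : E → EuclideanSpace ℝ (Fin m)} (hc : HasCompactSupport φ) :
    HasCompactSupport (divX X φ) :=
  HasCompactSupport.intro hc fun _ hx => divX_eq_zero hx

/-! ### Divergence of vector fields and the divergence theorem. -/

section Divergence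

variable {E : Type*} [NormedAddCommGroup E] [NormedSpace ℝ E] [FiniteDimensional ℝ E]

/-- The divergence of a vector field, i.e. the trace of its differential. -/
noncomputable def fieldDiv (Y : E → E) (x : E) : ℝ :=
  LinearMap.trace ℝ E (fderiv ℝ Y x).toLinearMap

/-- The trace as a continuous linear functional. -/
noncomputable def traceCLM (E : Type*) [NormedAddCommGroup E] [NormedSpace ℝ E]
    [FiniteDimensional ℝ E] : (E →L[ℝ] E) →L[ℝ] ℝ :=
  LinearMap.toContinuousLinearMap
    ((LinearMap.trace ℝ E).comp (ContinuousLinearMap.coeLM ℝ))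

theorem traceCLM_apply (A : E →L[ℝ] E) : traceCLM E A = LinearMap.trace ℝ E A.toLinearMap := rfl

theorem fieldDiv_eq (Y : E → E) (x : E) : fieldDiv Y x = traceCLM E (fderiv ℝ Y x) := rfl

theorem continuous_fieldDiv {Y : E → E} (hY : ContDiff ℝ 1 Y) : Continuous (fieldDiv Y) :=
  (traceCLM E).continuous.comp (hY.continuous_fderiv one_ne_zero)

/-- The rank-one operator is the image of f ⊗ v, and the trace is the contraction of tensors. -/
theorem trace_smulRight (f : E →L[ℝ] ℝ) (v : E) :
    LinearMap.trace ℝ E (f.smulRight v).toLinearMap = f v := by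
  have := LinearMap.trace_eq_contract_apply (R := ℝ) (M := E) (f.toLinearMap ⊗ₜ[ℝ] v)
  rw [contractLeft_apply] at this
  rw [← ContinuousLinearMap.coe_coe f, ← this]
  congr 1

theorem fieldDiv_smul {g : E → ℝ} {Y : E → E} {x : E} (hg : DifferentiableAt ℝ g x)
    (hY : DifferentiableAt ℝ Y x) :
    fieldDiv (fun y => g y • Y y) x = g x * fieldDiv Y x + fderiv ℝ g x (Y x) := by
  rw [fieldDiv_eq, fderiv_fun_smul hg hY, map_add, map_smul, smul_eq_mul, fieldDiv_eq,
    traceCLM_apply, traceCLM_apply, trace_smulRight]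

/-- Integration by parts against the constant 1 kills the integral of every directional derivative,
so the operator ∫ DV is zero; the trace commutes with the integral. -/
theorem integral_fieldDiv_eq_zero [MeasureSpace E] [BorelSpace E]
    [(volume : Measure E).IsAddHaarMeasure] {V : E → E} (hV : ContDiff ℝ 1 V)
    (hc : HasCompactSupport V) : ∫ x, fieldDiv V x = 0 := by
  have hd : Continuous (fderiv ℝ V) := hV.continuous_fderiv one_ne_zero
  have hi : Integrable (fderiv ℝ V) := hd.integrable_of_hasCompactSupport (hc.fderiv ℝ)
  have h0 : ∫ x, fderiv ℝ V x = 0 := by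
    ext1 v
    rw [ContinuousLinearMap.integral_apply hi]
    have := integral_smul_fderiv_eq_neg_fderiv_smul_of_integrable (𝕜 := ℝ)
      (μ := (volume : Measure E)) (f := fun _ : E => (1 : ℝ)) (g := V) (v := v)
      (by simp) (by simpa using hi.apply_continuousLinearMap v)
      (by simpa using hV.continuous.integrable_of_hasCompactSupport hc)
      (fun x _ => differentiableAt_const _) (fun x _ => (hV.differentiable one_ne_zero) x)
    simpa using this
  simp_rw [fieldDiv_eq]
  rw [ContinuousLinearMap.integral_comp_comm _ hi, h0, map_zero]

theorem divX_eq {m : ℕ} {X : Fin m → E → E} (hX : ∀ i, ContDiff ℝ 1 (X i))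
    {φ : E → EuclideanSpace ℝ (Fin m)} (hφ : ContDiff ℝ 1 φ) (x : E) :
    divX X φ x = ∑ i, (φ x i * fieldDiv (X i) x + fderiv ℝ (fun y => φ y i) x (X i x)) := by
  refine Finset.sum_congr rfl fun i _ => ?_
  have h : ContDiff ℝ 1 fun y => φ y i := by fun_prop
  exact fieldDiv_smul (h.differentiable one_ne_zero x) ((hX i).differentiable one_ne_zero x)

theorem continuous_divX {m : ℕ} {X : Fin m → E → E} (hX : ∀ i, ContDiff ℝ 1 (X i))
    {φ : E → EuclideanSpace ℝ (Fin m)} (hφ : ContDiff ℝ 1 φ) : Continuous (divX X φ) := by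
  refine continuous_finsetSum _ fun i _ => ?_
  exact continuous_fieldDiv (Y := fun y => φ y i • X i y) (ContDiff.smul (by fun_prop) (hX i))

theorem fieldDiv_extend {Y : E → E} (hY : ContDiff ℝ 1 Y) (p : E × ℝ) :
    fieldDiv (fun q : E × ℝ => (Y q.1, (0 : ℝ))) p = fieldDiv Y p.1 := by
  have hd : HasFDerivAt (fun q : E × ℝ => (Y q.1, (0 : ℝ)))
      (((fderiv ℝ Y p.1).comp (ContinuousLinearMap.fst ℝ E ℝ)).prod 0) p :=
    (((hY.differentiable one_ne_zero p.1).hasFDerivAt).comp p hasFDerivAt_fst).prodMk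
      (hasFDerivAt_const _ _)
  rw [fieldDiv, hd.fderiv, fieldDiv]
  -- The differential factors through the projection to `E`, so cyclicity of the trace reduces it to
  -- the trace of the differential of `Y`.
  have e1 : (((fderiv ℝ Y p.1).comp (ContinuousLinearMap.fst ℝ E ℝ)).prod 0).toLinearMap
      = (LinearMap.inl ℝ E ℝ).comp ((fderiv ℝ Y p.1).toLinearMap.comp (LinearMap.fst ℝ E ℝ)) := by
    ext <;> simp
  rw [e1, LinearMap.trace_comp_comm', LinearMap.comp_assoc, LinearMap.fst_comp_inl,
    LinearMap.comp_id]

theorem divX_extendedFields {m : ℕ} {X : Fin m → E → E} (hX : ∀ i, ContDiff ℝ 1 (X i))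
    {φ : E × ℝ → EuclideanSpace ℝ (Fin (m + 1))} (hφ : ContDiff ℝ 1 φ) (p : E × ℝ) :
    divX (extendedFields X) φ p =
      ∑ i : Fin m, (φ p i.castSucc * fieldDiv (X i) p.1
        + fderiv ℝ (fun q => φ q i.castSucc) p (X i p.1, 0))
      + fderiv ℝ (fun q => φ q (Fin.last m)) p (0, 1) := by
  rw [divX_eq (contDiff_extendedFields hX) hφ, Fin.sum_univ_castSucc]
  congr 1
  · refine Finset.sum_congr rfl fun i _ => ?_
    simp only [extendedFields, Fin.snoc_castSucc]
    rw [fieldDiv_extend (hX i)]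
  · simp only [extendedFields, Fin.snoc_last]
    simp [fieldDiv]

end Divergence

/-! ### The derivative of the subgraph of a C¹ function. -/

section Graph

variable {E : Type*} [NormedAddCommGroup E] [NormedSpace ℝ E] [FiniteDimensional ℝ E]
  [MeasureSpace E] [BorelSpace E] [(volume : Measure E).IsAddHaarMeasure]

/-- The shear `(x, s) ↦ (x, s + v x)`. -/
def shear (v : E → ℝ) (hv : Continuous v) : E × ℝ ≃ₜ E × ℝ where
  toFun p := (p.1, p.2 + v p.1)
  invFun p := (p.1, p.2 - v p.1)
  left_inv p := by simp
  right_inv p := by simp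
  continuous_toFun := by fun_prop
  continuous_invFun := by fun_prop

theorem integral_lt_graph {v : E → ℝ} (hv : Measurable v) {H : E × ℝ → ℝ} (hH : Integrable H) :
    ∫ p in {p : E × ℝ | p.2 < v p.1}, H p = ∫ x, ∫ t in Iio (v x), H (x, t) := by
  have := FiniteDimensional.proper_real E
  have : SecondCountableTopology E := inferInstance
  have hm := measurableSet_lt_graph hv
  rw [← integral_indicator hm]
  change ∫ p, _ ∂((volume : Measure E).prod (volume : Measure ℝ)) = _
  rw [integral_prod]
  · refine integral_congr_ae (Eventually.of_forall fun x => ?_)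
    simp only
    rw [← integral_indicator measurableSet_Iio]
    rfl
  · exact hH.indicator hm

/-- The shear flattens the subgraph to the half-space s < 0. Integrating in `x` first leaves, at
each level s, an integral over all of `E`, to which the divergence theorem applies. -/
theorem integral_lt_graph_eq_shear {v : E → ℝ} (hv : Continuous v) {H : E × ℝ → ℝ}
    (hH : Continuous H) (hc : HasCompactSupport H) :
    ∫ p in {p : E × ℝ | p.2 < v p.1}, H p = ∫ s in Iio (0 : ℝ), ∫ x, H (x, s + v x) := by
  rw [integral_lt_graph hv.measurable (hH.integrable_of_hasCompactSupport hc)]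
  have h1 : ∀ x, ∫ t in Iio (v x), H (x, t) = ∫ s in Iio (0 : ℝ), H (x, s + v x) := by
    intro x
    rw [← integral_indicator measurableSet_Iio, ← integral_indicator measurableSet_Iio,
      ← integral_add_right_eq_self _ (v x)]
    congr 1
    ext s
    simp [indicator]
  simp_rw [h1]
  have hi : Integrable (fun p : E × ℝ => H (p.1, p.2 + v p.1)) :=
    (hH.comp (shear v hv).continuous).integrable_of_hasCompactSupport
      (hc.comp_homeomorph (shear v hv))
  refine integral_integral_swap (f := fun x s => H (x, s + v x)) ?_
  have : (volume : Measure E).prod ((volume : Measure ℝ).restrict (Iio 0))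
      = (volume : Measure (E × ℝ)).restrict (univ ×ˢ Iio 0) := by
    rw [Measure.volume_eq_prod, ← Measure.prod_restrict, Measure.restrict_univ]
  rw [this]
  exact hi.integrableOn

/-- Fundamental theorem of calculus on vertical lines, with no contribution from -∞ by compact
support. The weight `c` allows graph integrals containing derivatives of `v` to be written as
integrals over the subgraph. -/
theorem integral_lt_graph_deriv {v : E → ℝ} (hv : Continuous v) {f : E × ℝ → ℝ}
    (hf : ContDiff ℝ 1 f) (hc : HasCompactSupport f) {c : E → ℝ} (hcc : Continuous c) :
    ∫ p in {p : E × ℝ | p.2 < v p.1}, fderiv ℝ f p (0, 1) * c p.1 = ∫ x, f (x, v x) * c x := by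
  have hfd : Continuous fun p => fderiv ℝ f p (0, 1) :=
    (hf.continuous_fderiv one_ne_zero).clm_apply continuous_const
  have hfc : HasCompactSupport fun p => fderiv ℝ f p (0, 1) := by
    refine (hc.fderiv (𝕜 := ℝ)).mono fun p hp h0 => hp ?_
    simp [h0]
  have hint : Integrable fun p : E × ℝ => fderiv ℝ f p (0, 1) * c p.1 :=
    Continuous.integrable_of_hasCompactSupport (by fun_prop) hfc.mul_right
  rw [integral_lt_graph hv.measurable hint]
  refine integral_congr_ae (Eventually.of_forall fun x => ?_)
  simp only
  rw [integral_mul_const, ← integral_Iic_eq_integral_Iio]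
  congr 1
  have hemb : IsClosedEmbedding fun t : ℝ => (x, t) :=
    (Isometry.of_dist_eq fun s t => by simp [Prod.dist_eq]).isClosedEmbedding
  have hd : ∀ t, HasDerivAt (fun t => f (x, t)) (fderiv ℝ f (x, t) (0, 1)) t := by
    intro t
    have h1 : HasDerivAt (fun t : ℝ => (x, t)) ((0 : E), (1 : ℝ)) t :=
      (hasDerivAt_const t x).prodMk (hasDerivAt_id t)
    exact ((hf.differentiable one_ne_zero (x, t)).hasFDerivAt).comp_hasDerivAt t h1
  have hlim : Tendsto (fun t => f (x, t)) atBot (𝓝 0) := by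
    have := (hc.comp_isClosedEmbedding hemb).is_zero_at_infty
    rw [cocompact_eq_atBot_atTop] at this
    exact this.mono_left le_sup_left
  rw [integral_Iic_of_hasDerivAt_of_tendsto' (fun t _ => hd t) ?_ hlim, sub_zero]
  have h3 : Continuous fun t : ℝ => fderiv ℝ f (x, t) (0, 1) := by fun_prop
  exact (h3.integrable_of_hasCompactSupport (hfc.comp_isClosedEmbedding hemb)).integrableOn

/-- At each sheared level s the field x ↦ f(x, s + v x) Y x has compact support, and its divergence
is the integrand on the left plus ∂_t f · Yv. The divergence theorem trades the former for minus the
latter, which `integral_lt_graph_deriv` carries to the graph. -/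
theorem integral_lt_graph_horizontal {v : E → ℝ} (hv : ContDiff ℝ 1 v) {f : E × ℝ → ℝ}
    (hf : ContDiff ℝ 1 f) (hc : HasCompactSupport f) {Y : E → E} (hY : ContDiff ℝ 1 Y) :
    ∫ p in {p : E × ℝ | p.2 < v p.1}, (f p * fieldDiv Y p.1 + fderiv ℝ f p (Y p.1, 0))
      = - ∫ x, f (x, v x) * fderiv ℝ v x (Y x) := by
  have hYd := continuous_fieldDiv hY
  have hfd : Continuous (fderiv ℝ f) := hf.continuous_fderiv one_ne_zero
  have hYc := hY.continuous
  have hvc : Continuous fun x => fderiv ℝ v x (Y x) :=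
    (hv.continuous_fderiv one_ne_zero).clm_apply hYc
  have hc1 : ∀ w : E × ℝ → E × ℝ, HasCompactSupport fun p => fderiv ℝ f p (w p) := by
    intro w
    refine (hc.fderiv (𝕜 := ℝ)).mono fun p hp h0 => hp ?_
    simp [h0]
  rw [← integral_lt_graph_deriv hv.continuous hf hc hvc,
    integral_lt_graph_eq_shear (H := fun p => f p * fieldDiv Y p.1 + fderiv ℝ f p (Y p.1, 0))
      hv.continuous (by fun_prop) (hc.mul_right.add (hc1 _)),
    integral_lt_graph_eq_shear (H := fun p => fderiv ℝ f p (0, 1) * fderiv ℝ v p.1 (Y p.1))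
      hv.continuous (by fun_prop) (hc1 _).mul_right, ← integral_neg]
  refine integral_congr_ae (Eventually.of_forall fun s => ?_)
  simp only
  have hw : ContDiff ℝ 1 fun x => f (x, s + v x) := by fun_prop
  have hdw : ∀ x, fderiv ℝ (fun x => f (x, s + v x)) x (Y x)
      = fderiv ℝ f (x, s + v x) (Y x, 0)
        + fderiv ℝ f (x, s + v x) (0, 1) * fderiv ℝ v x (Y x) := by
    intro x
    have h1 : HasFDerivAt (fun x => (x, s + v x))
        ((ContinuousLinearMap.id ℝ E).prod (fderiv ℝ v x)) x :=
      (hasFDerivAt_id x).prodMk ((hv.differentiable one_ne_zero x).hasFDerivAt.const_add s)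
    have h2 := ((hf.differentiable one_ne_zero (x, s + v x)).hasFDerivAt).comp x h1
    have h3 : fderiv ℝ (fun x => f (x, s + v x)) x
        = (fderiv ℝ f (x, s + v x)).comp ((ContinuousLinearMap.id ℝ E).prod (fderiv ℝ v x)) :=
      h2.fderiv
    rw [h3]
    have h4 : ((Y x, fderiv ℝ v x (Y x)) : E × ℝ)
        = (Y x, 0) + (fderiv ℝ v x (Y x)) • ((0 : E), (1 : ℝ)) := by simp
    simp only [ContinuousLinearMap.comp_apply, ContinuousLinearMap.prod_apply,
      ContinuousLinearMap.id_apply]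
    rw [h4, map_add, map_smul, smul_eq_mul, mul_comm]
  have h0 := integral_fieldDiv_eq_zero (V := fun x => f (x, s + v x) • Y x) (hw.smul hY)
    ((hasCompactSupport_slice hc fun x => s + v x).smul_right)
  have h5 : ∀ x, fieldDiv (fun x => f (x, s + v x) • Y x) x
      = (f (x, s + v x) * fieldDiv Y x + fderiv ℝ f (x, s + v x) (Y x, 0))
        + fderiv ℝ f (x, s + v x) (0, 1) * fderiv ℝ v x (Y x) := by
    intro x
    rw [fieldDiv_smul (hw.differentiable one_ne_zero x) (hY.differentiable one_ne_zero x), hdw,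
      add_assoc]
  simp_rw [h5] at h0
  rw [integral_add] at h0
  · linarith
  · refine Continuous.integrable_of_hasCompactSupport (by fun_prop) ?_
    exact hasCompactSupport_slice (f := fun p : E × ℝ => f p * fieldDiv Y p.1
      + fderiv ℝ f p (Y p.1, 0)) (hc.mul_right.add (hc1 _)) _
  · refine Continuous.integrable_of_hasCompactSupport (by fun_prop) ?_
    exact HasCompactSupport.mul_right (hasCompactSupport_slice (hc1 fun _ => (0, 1)) _)

/-- The horizontal derivatives `(X₁ v, …, X_m v, -1)` of `(x, t) ↦ v x - t`. -/
noncomputable def graphGradient {m : ℕ} (X : Fin m → E → E) (v : E → ℝ) (x : E) :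
    EuclideanSpace ℝ (Fin (m + 1)) :=
  euclideanSnoc (WithLp.toLp 2 fun i => fderiv ℝ v x (X i x)) (-1)

theorem integral_lt_graph_divX {m : ℕ} {X : Fin m → E → E} (hX : ∀ i, ContDiff ℝ 1 (X i))
    {v : E → ℝ} (hv : ContDiff ℝ 1 v) {φ : E × ℝ → EuclideanSpace ℝ (Fin (m + 1))}
    (hφ : ContDiff ℝ 1 φ) (hc : HasCompactSupport φ) :
    ∫ p in {p : E × ℝ | p.2 < v p.1}, divX (extendedFields X) φ p
      = - ∫ x, inner ℝ (φ (x, v x)) (graphGradient X v x) := by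
  have hφi : ∀ i, ContDiff ℝ 1 fun q => φ q i := fun i => by fun_prop
  have hci : ∀ i, HasCompactSupport fun q => φ q i := fun i =>
    hc.mono fun q hq h0 => hq (by simp [h0])
  have hvX : ∀ i, Continuous fun x => fderiv ℝ v x (X i x) := fun i =>
    (hv.continuous_fderiv one_ne_zero).clm_apply (hX i).continuous
  have hc1 : ∀ i (w : E × ℝ → E × ℝ),
      HasCompactSupport fun p => fderiv ℝ (fun q => φ q i) p (w p) := by
    intro i w
    refine ((hci i).fderiv (𝕜 := ℝ)).mono fun p hp h0 => hp ?_
    simp [h0]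
  have hsl : ∀ i, HasCompactSupport fun x => φ (x, v x) i := fun i =>
    hasCompactSupport_slice (hci i) v
  have hvc := hv.continuous
  have hφc : ∀ i, Continuous fun q => φ q i := fun i => (hφi i).continuous
  have hφd : ∀ i, Continuous (fderiv ℝ fun q => φ q i) := fun i =>
    (hφi i).continuous_fderiv one_ne_zero
  have hXc : ∀ i, Continuous (X i) := fun i => (hX i).continuous
  have hXd : ∀ i, Continuous (fieldDiv (X i)) := fun i => continuous_fieldDiv (hX i)
  have hslc : ∀ i, Continuous fun x => φ (x, v x) i := fun i =>
    (hφc i).comp (by fun_prop : Continuous fun x => (x, v x))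
  simp_rw [divX_extendedFields hX hφ]
  rw [integral_add, integral_finsetSum]
  · have hlast := integral_lt_graph_deriv hvc (hφi (Fin.last m)) (hci _)
      (c := fun _ => 1) continuous_const
    simp only [mul_one] at hlast
    rw [hlast]
    simp_rw [fun i : Fin m => integral_lt_graph_horizontal hv (hφi i.castSucc) (hci _) (hX i)]
    have h1 : ∀ x, inner ℝ (φ (x, v x)) (graphGradient X v x)
        = ∑ i : Fin m, φ (x, v x) i.castSucc * fderiv ℝ v x (X i x)
          - φ (x, v x) (Fin.last m) := by
      intro x
      rw [PiLp.inner_apply, Fin.sum_univ_castSucc]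
      simp [graphGradient, euclideanSnoc, mul_comm, sub_eq_add_neg]
    simp_rw [h1]
    rw [integral_sub, integral_finsetSum, Finset.sum_neg_distrib]
    · ring
    · intro i _
      exact ((hslc _).mul (hvX i)).integrable_of_hasCompactSupport (hsl _).mul_right
    · refine integrable_finsetSum _ fun i _ => ?_
      exact ((hslc _).mul (hvX i)).integrable_of_hasCompactSupport (hsl _).mul_right
    · exact (hslc _).integrable_of_hasCompactSupport (hsl _)
  · intro i _
    refine (Continuous.integrable_of_hasCompactSupport ?_
      ((hci _).mul_right.add (hc1 _ _))).integrableOn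
    have := hXc i
    have := hXd i
    have := hφd i.castSucc
    have := hφc i.castSucc
    fun_prop
  · refine integrable_finsetSum _ fun i _ => ?_
    refine (Continuous.integrable_of_hasCompactSupport ?_
      ((hci _).mul_right.add (hc1 _ _))).integrableOn
    have := hXc i
    have := hXd i
    have := hφd i.castSucc
    have := hφc i.castSucc
    fun_prop
  · refine (Continuous.integrable_of_hasCompactSupport ?_ (hc1 _ _)).integrableOn
    have := hφd (Fin.last m)
    fun_prop

end Graph

/-! ### Continuity of translations in L¹ and mollification. -/

section Mollification

variable {E : Type*} [NormedAddCommGroup E] [NormedSpace ℝ E] [FiniteDimensional ℝ E]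
  [MeasureSpace E] [BorelSpace E] [(volume : Measure E).IsAddHaarMeasure]

/-- Translation by `h` is composition with a measure-preserving map depending continuously on `h`,
and such compositions act continuously on L¹ classes. -/
theorem tendsto_lintegral_translate_sub {w : E → ℝ} (hw : Integrable w) :
    Tendsto (fun h : E => ∫⁻ x, ‖w (x - h) - w x‖ₑ) (𝓝 0) (𝓝 0) := by
  have := FiniteDimensional.proper_real E
  have hm : MemLp w 1 (volume : Measure E) := memLp_one_iff_integrable.2 hw
  let W : Lp ℝ 1 (volume : Measure E) := hm.toLp w
  let g : E → C(E, E) := fun h => ⟨fun x => x - h, by fun_prop⟩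
  have hg : Continuous g :=
    (ContinuousMap.mk (fun p : E × E => p.2 - p.1) (by fun_prop)).curry.continuous
  have hgm : ∀ h, MeasurePreserving (g h) (volume : Measure E) volume := fun h =>
    measurePreserving_sub_right _ h
  have hc : Continuous fun h => Lp.compMeasurePreserving (g h) (hgm h) W :=
    Continuous.compMeasurePreservingLp continuous_const hg hgm ENNReal.one_ne_top
  have key : ∀ h, ∫⁻ x, ‖w (x - h) - w x‖ₑ
      = edist (Lp.compMeasurePreserving (g h) (hgm h) W) W := by
    intro h
    rw [Lp.edist_def, eLpNorm_one_eq_lintegral_enorm]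
    refine lintegral_congr_ae ?_
    filter_upwards [Lp.coeFn_compMeasurePreserving W (hgm h), hm.coeFn_toLp,
      (hgm h).quasiMeasurePreserving.ae_eq_comp hm.coeFn_toLp] with x h1 h2 h3
    rw [Pi.sub_apply, h1, h2, h3]
    rfl
  have h0 : Lp.compMeasurePreserving (g 0) (hgm 0) W = W := by
    have := key 0
    simp only [sub_zero, sub_self, enorm_zero, lintegral_zero] at this
    exact edist_eq_zero.1 this.symm
  simp_rw [key]
  have := (hc.tendsto 0).edist (tendsto_const_nhds (x := W))
  rwa [h0, edist_self] at this

/-- After exchanging the integrals, the inner one tends to zero for each `z` and is at most 2‖w‖₁, a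
constant, which is integrable on the unit ball. -/
theorem tendsto_lintegral_lintegral_translate_sub {w : E → ℝ} (hw : Integrable w)
    (hwm : Measurable w) {ε : ℕ → ℝ} (hε : Tendsto ε atTop (𝓝 0)) :
    Tendsto (fun k => ∫⁻ x, ∫⁻ z in Metric.closedBall (0 : E) 1, ‖w (x - ε k • z) - w x‖ₑ)
      atTop (𝓝 0) := by
  have := FiniteDimensional.proper_real E
  have hmeas : ∀ k, Measurable fun p : E × E => ‖w (p.1 - ε k • p.2) - w p.1‖ₑ := fun k => by
    have : Measurable fun p : E × E => p.1 - ε k • p.2 :=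
      (by fun_prop : Continuous fun p : E × E => p.1 - ε k • p.2).measurable
    exact ((hwm.comp this).sub (hwm.comp measurable_fst)).enorm
  have hswap : ∀ k, ∫⁻ x, ∫⁻ z in Metric.closedBall (0 : E) 1, ‖w (x - ε k • z) - w x‖ₑ
      = ∫⁻ z in Metric.closedBall (0 : E) 1, ∫⁻ x, ‖w (x - ε k • z) - w x‖ₑ := fun k =>
    lintegral_lintegral_swap (hmeas k).aemeasurable
  simp_rw [hswap]
  have hbound : ∀ h : E, ∫⁻ x, ‖w (x - h) - w x‖ₑ ≤ 2 * ∫⁻ x, ‖w x‖ₑ := by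
    intro h
    calc ∫⁻ x, ‖w (x - h) - w x‖ₑ ≤ ∫⁻ x, (‖w (x - h)‖ₑ + ‖w x‖ₑ) :=
          lintegral_mono fun x => enorm_sub_le
      _ = (∫⁻ x, ‖w (x - h)‖ₑ) + ∫⁻ x, ‖w x‖ₑ := lintegral_add_right _ hwm.enorm
      _ = 2 * ∫⁻ x, ‖w x‖ₑ := by
        rw [lintegral_sub_right_eq_self (fun x => ‖w x‖ₑ), two_mul]
  have h2 := tendsto_lintegral_of_dominated_convergence
    (μ := (volume : Measure E).restrict (Metric.closedBall 0 1))
    (F := fun k z => ∫⁻ x, ‖w (x - ε k • z) - w x‖ₑ) (f := fun _ => 0)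
    (fun _ => 2 * ∫⁻ x, ‖w x‖ₑ) (fun k => ?_) (fun k => Eventually.of_forall fun z => hbound _) ?_
    (Eventually.of_forall fun z => ?_)
  · simpa using h2
  · exact (hmeas k).lintegral_prod_left'
  · rw [lintegral_const]
    refine ENNReal.mul_ne_top (ENNReal.mul_ne_top ENNReal.ofNat_ne_top hw.2.ne) ?_
    rw [Measure.restrict_apply_univ]
    exact (isCompact_closedBall _ _).measure_lt_top.ne
  · have h3 : Tendsto (fun k => ε k • z) atTop (𝓝 0) := by
      simpa using hε.smul_const z
    exact (tendsto_lintegral_translate_sub hw).comp h3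

/-- A smooth probability density supported in the closed unit ball. -/
structure IsMollifier (ρ : E → ℝ) : Prop where
  contDiff : ContDiff ℝ 1 ρ
  nonneg : ∀ z, 0 ≤ ρ z
  eq_zero : ∀ z, z ∉ Metric.closedBall (0 : E) 1 → ρ z = 0
  integral_eq_one : ∫ z, ρ z = 1

theorem exists_isMollifier : ∃ ρ : E → ℝ, IsMollifier ρ := by
  let f : ContDiffBump (0 : E) := ⟨1 / 2, 1, by norm_num, by norm_num⟩
  refine ⟨f.normed volume, f.contDiff_normed, f.nonneg_normed, fun z hz => ?_, f.integral_normed⟩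
  have := f.tsupport_normed_eq (μ := (volume : Measure E))
  refine image_eq_zero_of_notMem_tsupport ?_
  rwa [this]

theorem integral_eq_smul_integral_sub_smul (f : E → ℝ) (x : E) {ε : ℝ} (hε : 0 < ε) :
    ∫ y, f y = ε ^ Module.finrank ℝ E * ∫ z, f (x - ε • z) := by
  rw [Measure.integral_comp_smul_of_nonneg volume (fun y => f (x - y)) ε (hR := hε.le),
    integral_sub_left_eq_self f volume x, smul_eq_mul, ← mul_assoc, mul_inv_cancel₀, one_mul]
  positivity

/-- The rescaled kernel `z ↦ ε⁻ⁿ ρ (z / ε)`. -/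
noncomputable def scaledKernel (ρ : E → ℝ) (ε : ℝ) (z : E) : ℝ :=
  (ε ^ Module.finrank ℝ E)⁻¹ * ρ (ε⁻¹ • z)

/-- The mollification of `w` at scale `ε`. -/
noncomputable def mollify (ρ : E → ℝ) (ε : ℝ) (w : E → ℝ) (x : E) : ℝ :=
  ∫ y, w y * scaledKernel ρ ε (x - y)

theorem mollify_eq_convolution (ρ : E → ℝ) (ε : ℝ) (w : E → ℝ) :
    mollify ρ ε w = convolution w (scaledKernel ρ ε) (ContinuousLinearMap.lsmul ℝ ℝ) volume := rfl

theorem mollify_apply (ρ : E → ℝ) {ε : ℝ} (hε : 0 < ε) (w : E → ℝ) (x : E) :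
    mollify ρ ε w x = ∫ z, w (x - ε • z) * ρ z := by
  rw [mollify, integral_eq_smul_integral_sub_smul _ x hε, ← integral_const_mul]
  refine integral_congr_ae (Eventually.of_forall fun z => ?_)
  have : (ε ^ Module.finrank ℝ E) ≠ 0 := by positivity
  simp only [scaledKernel, sub_sub_cancel, smul_smul, inv_mul_cancel₀ hε.ne', one_smul]
  field_simp

/-- A family of kernels bounded by `C` and supported in the unit ball, applied to differences of
translates. -/
theorem enorm_integral_mul_kernel_le {w κ : E → ℝ} {C c : ℝ} (hw : Integrable w) (x : E)
    {ε : ℝ} (hε : 0 < ε) (hκ : Continuous κ) (hκC : ∀ z, ‖κ z‖ ≤ C)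
    (hκ0 : ∀ z, z ∉ Metric.closedBall (0 : E) 1 → κ z = 0) (hc : ∫ z, κ z = c) :
    ‖(∫ z, w (x - ε • z) * κ z) - w x * c‖ₑ
      ≤ ENNReal.ofReal C * ∫⁻ z in Metric.closedBall (0 : E) 1, ‖w (x - ε • z) - w x‖ₑ := by
  have := FiniteDimensional.proper_real E
  have hκi : Integrable κ := hκ.integrable_of_hasCompactSupport
    (HasCompactSupport.intro (isCompact_closedBall 0 1) hκ0)
  have hwi : Integrable fun z => w (x - ε • z) := by
    have h1 : Integrable fun y => w (x - y) := hw.comp_sub_left x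
    exact (integrable_comp_smul_iff volume (fun y => w (x - y)) hε.ne').2 h1
  -- Since `κ` has integral `c`, the subtracted term is an integral against the same kernel, and
  -- only differences of `w` remain.
  have h1 : (∫ z, w (x - ε • z) * κ z) - w x * c = ∫ z, (w (x - ε • z) - w x) * κ z := by
    simp_rw [sub_mul]
    rw [integral_sub, integral_const_mul, hc]
    · exact hwi.mul_bdd (c := C) hκi.1 (Eventually.of_forall hκC)
    · exact hκi.const_mul _
  rw [h1]
  refine (enorm_integral_le_lintegral_enorm _).trans ?_
  rw [← lintegral_const_mul' _ _ ENNReal.ofReal_ne_top,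
    ← lintegral_indicator measurableSet_closedBall]
  refine lintegral_mono fun z => ?_
  by_cases hz : z ∈ Metric.closedBall (0 : E) 1
  · rw [indicator_of_mem hz, enorm_mul, mul_comm]
    gcongr
    rw [← ofReal_norm]
    exact ENNReal.ofReal_le_ofReal (hκC z)
  · simp [hκ0 z hz]

namespace IsMollifier

variable {ρ : E → ℝ}

theorem tsupport_subset (hρ : IsMollifier ρ) : tsupport ρ ⊆ Metric.closedBall 0 1 := by
  refine closure_minimal (fun z hz => ?_) Metric.isClosed_closedBall
  by_contra h
  exact hz (hρ.eq_zero z h)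

theorem hasCompactSupport (hρ : IsMollifier ρ) : HasCompactSupport ρ := by
  have := FiniteDimensional.proper_real E
  exact HasCompactSupport.intro (isCompact_closedBall 0 1) fun z hz => hρ.eq_zero z hz

theorem fderiv_eq_zero (hρ : IsMollifier ρ) {z : E} (hz : z ∉ Metric.closedBall (0 : E) 1) : fderiv ℝ ρ z = 0 :=
  image_eq_zero_of_notMem_tsupport fun h =>
    hz (hρ.tsupport_subset (tsupport_fderiv_subset ℝ h))

theorem contDiff_scaledKernel (hρ : IsMollifier ρ) (ε : ℝ) : ContDiff ℝ 1 (scaledKernel ρ ε) :=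
  contDiff_const.mul (hρ.contDiff.comp (contDiff_const_smul _))

theorem scaledKernel_eq_zero (hρ : IsMollifier ρ) {ε : ℝ} (hε : 0 < ε) {z : E} (hz : ε < ‖z‖) :
    scaledKernel ρ ε z = 0 := by
  rw [scaledKernel, hρ.eq_zero, mul_zero]
  rw [mem_closedBall_zero_iff, norm_smul, norm_inv, Real.norm_of_nonneg hε.le, not_le,
    ← div_eq_inv_mul, one_lt_div hε]
  exact hz

theorem scaledKernel_nonneg (hρ : IsMollifier ρ) {ε : ℝ} (hε : 0 < ε) (z : E) : 0 ≤ scaledKernel ρ ε z :=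
  mul_nonneg (by positivity) (hρ.nonneg _)

theorem tsupport_scaledKernel_subset (hρ : IsMollifier ρ) {ε : ℝ} (hε : 0 < ε) :
    tsupport (scaledKernel ρ ε) ⊆ Metric.closedBall 0 ε := by
  refine closure_minimal (fun z hz => ?_) Metric.isClosed_closedBall
  by_contra h
  exact hz (hρ.scaledKernel_eq_zero hε (by simpa using h))

theorem hasCompactSupport_scaledKernel (hρ : IsMollifier ρ) {ε : ℝ} (hε : 0 < ε) :
    HasCompactSupport (scaledKernel ρ ε) := by
  have := FiniteDimensional.proper_real E
  exact (isCompact_closedBall 0 ε).of_isClosed_subset (isClosed_tsupport _)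
    (hρ.tsupport_scaledKernel_subset hε)

theorem fderiv_scaledKernel (hρ : IsMollifier ρ) {ε : ℝ} (z : E) (v : E) :
    fderiv ℝ (scaledKernel ρ ε) z v
      = (ε ^ Module.finrank ℝ E)⁻¹ * fderiv ℝ ρ (ε⁻¹ • z) (ε⁻¹ • v) := by
  have h1 : HasFDerivAt (fun z : E => ε⁻¹ • z) (ε⁻¹ • ContinuousLinearMap.id ℝ E) z :=
    (hasFDerivAt_id z).const_smul _
  have h2 := (((hρ.contDiff.differentiable one_ne_zero (ε⁻¹ • z)).hasFDerivAt).comp z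
    h1).const_mul (ε ^ Module.finrank ℝ E)⁻¹
  have h3 : fderiv ℝ (scaledKernel ρ ε) z = _ := h2.fderiv
  rw [h3]
  simp

theorem contDiff_mollify (hρ : IsMollifier ρ) {ε : ℝ} (hε : 0 < ε) {w : E → ℝ} (hw : Integrable w) :
    ContDiff ℝ 1 (mollify ρ ε w) := by
  rw [mollify_eq_convolution]
  exact (hρ.hasCompactSupport_scaledKernel hε).contDiff_convolution_right _
    hw.locallyIntegrable (hρ.contDiff_scaledKernel ε)

theorem fderiv_mollify (hρ : IsMollifier ρ) {ε : ℝ} (hε : 0 < ε) {w : E → ℝ} (hw : Integrable w) (x v : E) :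
    fderiv ℝ (mollify ρ ε w) x v = ∫ y, w y * fderiv ℝ (scaledKernel ρ ε) (x - y) v := by
  have hk := hρ.contDiff_scaledKernel ε
  have hkc := hρ.hasCompactSupport_scaledKernel hε
  rw [mollify_eq_convolution, (hkc.hasFDerivAt_convolution_right _ hw.locallyIntegrable
    hk x).fderiv, convolution_precompR_apply _ hw.locallyIntegrable (hkc.fderiv ℝ)
    (hk.continuous_fderiv one_ne_zero)]
  rfl

theorem integral_scaledKernel (hρ : IsMollifier ρ) {ε : ℝ} (hε : 0 < ε) (x : E) :
    ∫ y, scaledKernel ρ ε (x - y) = 1 := by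
  have := mollify_apply ρ hε (fun _ => 1) x
  simpa [mollify, hρ.integral_eq_one] using this

theorem exists_bound (hρ : IsMollifier ρ) : ∃ C, 0 ≤ C ∧ ∀ z, ‖ρ z‖ ≤ C ∧ ‖fderiv ℝ ρ z‖ ≤ C := by
  obtain ⟨C, hC⟩ := hρ.contDiff.continuous.bounded_above_of_compact_support hρ.hasCompactSupport
  obtain ⟨D, hD⟩ := (hρ.contDiff.continuous_fderiv one_ne_zero).bounded_above_of_compact_support
    (hρ.hasCompactSupport.fderiv ℝ)
  exact ⟨max C D, ((norm_nonneg _).trans (hC 0)).trans (le_max_left _ _),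
    fun z => ⟨(hC z).trans (le_max_left _ _), (hD z).trans (le_max_right _ _)⟩⟩

theorem tendsto_mollify (hρ : IsMollifier ρ) {w : E → ℝ} (hw : Integrable w) (hwm : Measurable w) {ε : ℕ → ℝ}
    (hε0 : ∀ k, 0 < ε k) (hε : Tendsto ε atTop (𝓝 0)) :
    Tendsto (fun k => ∫⁻ x, ‖mollify ρ (ε k) w x - w x‖ₑ) atTop (𝓝 0) := by
  obtain ⟨C, hC, hCρ⟩ := hρ.exists_bound
  have h1 := ENNReal.Tendsto.const_mul (tendsto_lintegral_lintegral_translate_sub hw hwm hε)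
    (a := ENNReal.ofReal C) (Or.inr ENNReal.ofReal_ne_top)
  rw [mul_zero] at h1
  refine tendsto_of_tendsto_of_tendsto_of_le_of_le tendsto_const_nhds h1 (fun _ => zero_le)
    fun k => ?_
  simp only
  rw [← lintegral_const_mul' _ _ ENNReal.ofReal_ne_top]
  refine lintegral_mono fun x => ?_
  have := enorm_integral_mul_kernel_le hw x (hε0 k) hρ.contDiff.continuous (fun z => (hCρ z).1)
    hρ.eq_zero hρ.integral_eq_one
  rwa [mul_one, ← mollify_apply ρ (hε0 k)] at this

end IsMollifier

end Mollification

/-! ### Friedrichs' commutator lemma. -/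

section Commutator

variable {E : Type*} [NormedAddCommGroup E] [NormedSpace ℝ E] [FiniteDimensional ℝ E]
  [MeasureSpace E] [BorelSpace E] [(volume : Measure E).IsAddHaarMeasure]

/-- The rescaled kernel of the commutator of mollification with the derivative along `Y`. -/
noncomputable def commutatorKernel (ρ : E → ℝ) (Y : E → E) (ε : ℝ) (x z : E) : ℝ :=
  fderiv ℝ ρ z (ε⁻¹ • (Y x - Y (x - ε • z))) + ρ z * fieldDiv Y (x - ε • z)

/-- The commutator of mollification with the derivative along `Y`. -/
noncomputable def mollifyCommutator (ρ : E → ℝ) (Y : E → E) (w : E → ℝ) (ε : ℝ) (x : E) : ℝ :=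
  ∫ z, w (x - ε • z) * commutatorKernel ρ Y ε x z

variable {ρ : E → ℝ} {Y : E → E}

theorem IsMollifier.fieldDiv_scaledKernel_smul (hρ : IsMollifier ρ) (hY : ContDiff ℝ 1 Y) (ε : ℝ)
    (x y : E) :
    fieldDiv (fun y' => scaledKernel ρ ε (x - y') • Y y') y
      = scaledKernel ρ ε (x - y) * fieldDiv Y y - fderiv ℝ (scaledKernel ρ ε) (x - y) (Y y) := by
  have h1 : HasFDerivAt (fun y' => scaledKernel ρ ε (x - y'))
      (-(fderiv ℝ (scaledKernel ρ ε) (x - y))) y := by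
    have h2 := (((hρ.contDiff_scaledKernel ε).differentiable one_ne_zero
      (x - y)).hasFDerivAt).comp y ((hasFDerivAt_id y).const_sub x)
    convert! h2 using 1
    ext v
    simp
  rw [fieldDiv_smul h1.differentiableAt (hY.differentiable one_ne_zero y), h1.fderiv]
  simp [sub_eq_add_neg]

/-- The second integral is minus the mollified distributional derivative Yw at `x`, so the left side
is Y(w_ε) - (Yw)_ε. With y = x - εz, the factor ε⁻¹ from differentiating the kernel meets the
difference Y x - Y (x - εz). -/
theorem IsMollifier.fderiv_mollify_add (hρ : IsMollifier ρ) (hY : ContDiff ℝ 1 Y) {w : E → ℝ}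
    (hw : Integrable w) {ε : ℝ} (hε : 0 < ε) (x : E) :
    fderiv ℝ (mollify ρ ε w) x (Y x)
      + ∫ y, w y * fieldDiv (fun y' => scaledKernel ρ ε (x - y') • Y y') y
      = mollifyCommutator ρ Y w ε x := by
  have hk := hρ.contDiff_scaledKernel ε
  have hkc := hρ.hasCompactSupport_scaledKernel hε
  have hint : ∀ c : E → ℝ, Continuous c → HasCompactSupport c → Integrable fun y => w y * c y := by
    intro c hc hcc
    obtain ⟨C, hC⟩ := hc.bounded_above_of_compact_support hcc
    exact hw.mul_bdd hc.aestronglyMeasurable (Eventually.of_forall hC)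
  have hcomp : ∀ c : E → ℝ, HasCompactSupport c → HasCompactSupport fun y => c (x - y) :=
    fun c hc => hc.comp_homeomorph (Homeomorph.subLeft x)
  rw [hρ.fderiv_mollify hε hw, ← integral_add]
  · rw [mollifyCommutator, integral_eq_smul_integral_sub_smul _ x hε, ← integral_const_mul]
    refine integral_congr_ae (Eventually.of_forall fun z => ?_)
    have : (ε ^ Module.finrank ℝ E) ≠ 0 := by positivity
    simp only
    rw [hρ.fieldDiv_scaledKernel_smul hY, hρ.fderiv_scaledKernel, hρ.fderiv_scaledKernel,
      commutatorKernel, scaledKernel, sub_sub_cancel, smul_smul, inv_mul_cancel₀ hε.ne', one_smul,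
      smul_sub, map_sub]
    field_simp
    ring
  · refine hint _ ?_ (hcomp (fun y => fderiv ℝ (scaledKernel ρ ε) y (Y x)) ?_)
    · have := hk.continuous_fderiv one_ne_zero
      fun_prop
    · exact (hkc.fderiv (𝕜 := ℝ)).mono fun p hp h0 => hp (by simp [h0])
  · refine hint _ ?_ ?_
    · exact continuous_fieldDiv (ContDiff.smul (hk.comp (contDiff_const.sub contDiff_id)) hY)
    · have h1 : HasCompactSupport fun y' => scaledKernel ρ ε (x - y') • Y y' :=
        HasCompactSupport.smul_right (hcomp _ hkc)
      exact (h1.fderiv (𝕜 := ℝ)).mono fun p hp h0 => hp (by simp [fieldDiv, h0])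

/-- The integrand is the divergence of z ↦ ρ(z) DY(x)z. It is also the limit of `commutatorKernel`
as ε → 0; this cancellation is what makes Friedrichs' lemma work. -/
theorem IsMollifier.integral_commutatorKernel_zero (hρ : IsMollifier ρ) (x : E) :
    ∫ z, (fderiv ℝ ρ z (fderiv ℝ Y x z) + ρ z * fieldDiv Y x) = 0 := by
  have hA : ContDiff ℝ 1 (fderiv ℝ Y x) := (fderiv ℝ Y x).contDiff
  have h1 := integral_fieldDiv_eq_zero (V := fun z => ρ z • fderiv ℝ Y x z)
    (hρ.contDiff.smul hA) hρ.hasCompactSupport.smul_right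
  rw [← h1]
  refine integral_congr_ae (Eventually.of_forall fun z => ?_)
  simp only
  rw [fieldDiv_smul (hρ.contDiff.differentiable one_ne_zero z) (hA.differentiable one_ne_zero z),
    add_comm]
  congr 2
  simp [fieldDiv]

theorem IsMollifier.commutatorKernel_eq_zero (hρ : IsMollifier ρ) {ε : ℝ} {x z : E}
    (hz : z ∉ Metric.closedBall (0 : E) 1) : commutatorKernel ρ Y ε x z = 0 := by
  simp [commutatorKernel, hρ.fderiv_eq_zero hz, hρ.eq_zero z hz]

theorem IsMollifier.continuous_commutatorKernel (hρ : IsMollifier ρ) (hY : ContDiff ℝ 1 Y)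
    (ε : ℝ) : Continuous fun p : E × E => commutatorKernel ρ Y ε p.1 p.2 := by
  have h1 := hρ.contDiff.continuous
  have h2 := hρ.contDiff.continuous_fderiv one_ne_zero
  have h3 := hY.continuous
  have h4 := continuous_fieldDiv hY
  unfold commutatorKernel
  fun_prop

theorem IsMollifier.exists_commutatorKernel_bound (hρ : IsMollifier ρ) (hY : ContDiff ℝ 1 Y)
    {K : Set E} (hK : IsCompact K) : ∃ C, 0 ≤ C ∧ ∀ ε, 0 < ε → ε ≤ 1 → ∀ x ∈ K, ∀ z,
      ‖commutatorKernel ρ Y ε x z‖ ≤ C := by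
  have := FiniteDimensional.proper_real E
  obtain ⟨C, hC, hCρ⟩ := hρ.exists_bound
  have hK1 : IsCompact (Metric.cthickening 1 K) := hK.cthickening
  obtain ⟨L, hL⟩ := hK1.exists_bound_of_continuousOn
    (hY.continuous_fderiv one_ne_zero).continuousOn
  obtain ⟨D, hD⟩ := hK1.exists_bound_of_continuousOn (continuous_fieldDiv hY).continuousOn
  refine ⟨C * (max L 0) + C * (max D 0), by positivity, fun ε hε hε1 x hx z => ?_⟩
  by_cases hz : z ∈ Metric.closedBall (0 : E) 1
  swap
  · rw [hρ.commutatorKernel_eq_zero hz, norm_zero]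
    positivity
  have hz1 : ‖z‖ ≤ 1 := by simpa using hz
  have hsub : Metric.closedBall x 1 ⊆ Metric.cthickening 1 K :=
    Metric.closedBall_subset_cthickening hx 1
  have hmem : x - ε • z ∈ Metric.closedBall x 1 := by
    rw [Metric.mem_closedBall, dist_eq_norm, sub_sub_cancel_left, norm_neg, norm_smul,
      Real.norm_of_nonneg hε.le]
    exact mul_le_one₀ hε1 (norm_nonneg _) hz1
  -- The mean value inequality yields the factor ε that compensates ε⁻¹ in the kernel. The unit
  -- thickening of `K` is large enough because ε ≤ 1 and ‖z‖ ≤ 1.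
  have h1 : ‖Y x - Y (x - ε • z)‖ ≤ max L 0 * ε := by
    have := (convex_closedBall x 1).norm_image_sub_le_of_norm_fderiv_le (𝕜 := ℝ) (f := Y)
      (C := max L 0) (fun y _ => hY.differentiable one_ne_zero y)
      (fun y hy => (hL y (hsub hy)).trans (le_max_left _ _)) hmem
      (Metric.mem_closedBall_self zero_le_one)
    refine this.trans ?_
    gcongr
    rw [sub_sub_cancel, norm_smul, Real.norm_of_nonneg hε.le]
    exact mul_le_of_le_one_right hε.le hz1
  refine (norm_add_le _ _).trans (add_le_add ?_ ?_)
  · refine (ContinuousLinearMap.le_opNorm _ _).trans ?_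
    refine mul_le_mul (hCρ z).2 ?_ (norm_nonneg _) hC
    rw [norm_smul, norm_inv, Real.norm_of_nonneg hε.le, ← div_eq_inv_mul, div_le_iff₀ hε]
    exact h1
  · rw [norm_mul]
    exact mul_le_mul (hCρ z).1 ((hD _ (hsub hmem)).trans (le_max_left _ _)) (norm_nonneg _) hC

theorem IsMollifier.tendsto_integral_commutatorKernel (hρ : IsMollifier ρ) (hY : ContDiff ℝ 1 Y)
    {ε : ℕ → ℝ} (hε0 : ∀ k, 0 < ε k) (hε1 : ∀ k, ε k ≤ 1) (hε : Tendsto ε atTop (𝓝 0)) (x : E) :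
    Tendsto (fun k => ∫ z, commutatorKernel ρ Y (ε k) x z) atTop (𝓝 0) := by
  have := FiniteDimensional.proper_real E
  obtain ⟨C, hC, hCb⟩ := hρ.exists_commutatorKernel_bound hY (isCompact_singleton (x := x))
  rw [← hρ.integral_commutatorKernel_zero (Y := Y) x]
  refine tendsto_integral_of_dominated_convergence
    ((Metric.closedBall (0 : E) 1).indicator fun _ => C) (fun k => ?_) ?_ (fun k => ?_) ?_
  · exact ((hρ.continuous_commutatorKernel hY (ε k)).comp
      (by fun_prop : Continuous fun z : E => (x, z))).aestronglyMeasurable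
  · refine (integrable_indicator_iff measurableSet_closedBall).2 ?_
    exact integrableOn_const (isCompact_closedBall _ _).measure_lt_top.ne
  · refine Eventually.of_forall fun z => ?_
    by_cases hz : z ∈ Metric.closedBall (0 : E) 1
    · rw [indicator_of_mem hz]
      exact hCb _ (hε0 k) (hε1 k) x rfl z
    · rw [indicator_of_notMem hz, hρ.commutatorKernel_eq_zero hz, norm_zero]
  · refine Eventually.of_forall fun z => ?_
    have hεz : Tendsto (fun k => x - ε k • z) atTop (𝓝 x) := by
      simpa using (hε.smul_const z).const_sub x
    refine Tendsto.add ?_ (((continuous_fieldDiv hY).tendsto x).comp hεz |>.const_mul _)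
    refine ((fderiv ℝ ρ z).continuous.tendsto _).comp ?_
    -- Up to sign, the difference quotient in the kernel is the slope of this curve at 0.
    have h1 : HasDerivAt (fun t : ℝ => Y (x - t • z)) (-(fderiv ℝ Y x z)) 0 := by
      have h2 : HasDerivAt (fun t : ℝ => x - t • z) (-z) 0 := by
        simpa using ((hasDerivAt_id (0 : ℝ)).smul_const z).const_sub x
      have h3 : HasFDerivAt Y (fderiv ℝ Y x) (x - (0 : ℝ) • z) := by
        simpa using (hY.differentiable one_ne_zero x).hasFDerivAt
      have h4 := h3.comp_hasDerivAt (0 : ℝ) h2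
      rwa [map_neg] at h4
    have h4 := (hasDerivAt_iff_tendsto_slope_zero.1 h1).comp
      (tendsto_nhdsWithin_iff.2 ⟨hε, Eventually.of_forall fun k => (hε0 k).ne'⟩)
    have h5 := h4.neg
    rw [neg_neg] at h5
    refine h5.congr fun k => ?_
    simp [← smul_neg]

/-- Friedrichs' lemma: the commutator tends to zero in `L¹` on compact sets. -/
theorem IsMollifier.tendsto_commutator (hρ : IsMollifier ρ) (hY : ContDiff ℝ 1 Y) {w : E → ℝ}
    (hw : Integrable w) (hwm : Measurable w) {ε : ℕ → ℝ} (hε0 : ∀ k, 0 < ε k)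
    (hε1 : ∀ k, ε k ≤ 1) (hε : Tendsto ε atTop (𝓝 0)) {K : Set E} (hK : IsCompact K) :
    Tendsto (fun k => ∫⁻ x in K, ‖mollifyCommutator ρ Y w (ε k) x‖ₑ) atTop (𝓝 0) := by
  have := FiniteDimensional.proper_real E
  obtain ⟨C, hC, hCb⟩ := hρ.exists_commutatorKernel_bound hY hK
  -- The commutator is split by writing w(x - εz) as its difference from w(x) plus w(x). The
  -- difference is controlled by translations in L¹. The rest is w(x) times `c k x`, the mean of the
  -- kernel, which is bounded on `K` and tends to 0 pointwise.
  let c : ℕ → E → ℝ := fun k x => ∫ z, commutatorKernel ρ Y (ε k) x z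
  have hcm : ∀ k, Measurable (c k) := fun k =>
    ((hρ.continuous_commutatorKernel hY (ε k)).stronglyMeasurable.integral_prod_right').measurable
  have hker : ∀ k x, Continuous (commutatorKernel ρ Y (ε k) x) := fun k x =>
    (hρ.continuous_commutatorKernel hY (ε k)).comp (by fun_prop : Continuous fun z : E => (x, z))
  have h1 : Tendsto (fun k => ENNReal.ofReal C * ∫⁻ x,
      ∫⁻ z in Metric.closedBall (0 : E) 1, ‖w (x - ε k • z) - w x‖ₑ) atTop (𝓝 0) := by
    have h1 := ENNReal.Tendsto.const_mul (tendsto_lintegral_lintegral_translate_sub hw hwm hε)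
      (a := ENNReal.ofReal C) (Or.inr ENNReal.ofReal_ne_top)
    rwa [mul_zero] at h1
  have hcb : ∀ k, ∀ x ∈ K, ‖c k x‖ₑ ≤ ENNReal.ofReal C * volume (Metric.closedBall (0 : E) 1) := by
    intro k x hx
    refine (enorm_integral_le_lintegral_enorm _).trans ?_
    rw [← setLIntegral_const, ← lintegral_indicator measurableSet_closedBall]
    refine lintegral_mono fun z => ?_
    by_cases hz : z ∈ Metric.closedBall (0 : E) 1
    · rw [indicator_of_mem hz, ← ofReal_norm]
      exact ENNReal.ofReal_le_ofReal (hCb _ (hε0 k) (hε1 k) x hx z)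
    · rw [indicator_of_notMem hz, hρ.commutatorKernel_eq_zero hz, enorm_zero]
  have h2 : Tendsto (fun k => ∫⁻ x in K, ‖w x * c k x‖ₑ) atTop (𝓝 0) := by
    have h3 := tendsto_lintegral_of_dominated_convergence (μ := (volume : Measure E).restrict K)
      (F := fun k x => ‖w x * c k x‖ₑ) (f := fun _ => 0)
      (fun x => ‖w x‖ₑ * (ENNReal.ofReal C * volume (Metric.closedBall (0 : E) 1)))
      (fun k => (hwm.mul (hcm k)).enorm) (fun k => ?_) ?_ (Eventually.of_forall fun x => ?_)
    · simpa using h3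
    · refine (ae_restrict_iff' hK.measurableSet).2 (Eventually.of_forall fun x hx => ?_)
      simp only
      rw [enorm_mul]
      gcongr
      exact hcb k x hx
    · rw [lintegral_mul_const _ hwm.enorm]
      refine ENNReal.mul_ne_top hw.integrableOn.2.ne (ENNReal.mul_ne_top ENNReal.ofReal_ne_top ?_)
      exact (isCompact_closedBall _ _).measure_lt_top.ne
    · have h4 := (hρ.tendsto_integral_commutatorKernel hY hε0 hε1 hε x).const_mul (w x)
      rw [mul_zero] at h4
      simpa using h4.enorm
  have h3 := h1.add h2
  rw [add_zero] at h3
  refine tendsto_of_tendsto_of_tendsto_of_le_of_le tendsto_const_nhds h3 (fun _ => zero_le)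
    fun k => ?_
  simp only
  rw [← lintegral_const_mul' _ _ ENNReal.ofReal_ne_top]
  refine le_trans ?_ (add_le_add_left (setLIntegral_le_lintegral K _) _)
  have hm : Measurable fun x => ‖w x * c k x‖ₑ := (hwm.mul (hcm k)).enorm
  rw [← lintegral_add_right _ hm]
  refine setLIntegral_mono' hK.measurableSet fun x hx => ?_
  have h5 := enorm_integral_mul_kernel_le (c := c k x) hw x (hε0 k) (hker k x)
    (hCb _ (hε0 k) (hε1 k) x hx) (fun z hz => hρ.commutatorKernel_eq_zero hz) rfl
  calc ‖mollifyCommutator ρ Y w (ε k) x‖ₑ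
      = ‖(mollifyCommutator ρ Y w (ε k) x - w x * c k x) + w x * c k x‖ₑ := by rw [sub_add_cancel]
    _ ≤ _ := (enorm_add_le _ _).trans (add_le_add_left h5 _)

end Commutator

@[simp]
theorem euclideanSnoc_castSucc {m : ℕ} (v : EuclideanSpace ℝ (Fin m)) (t : ℝ) (i : Fin m) :
    euclideanSnoc v t i.castSucc = v i := by
  simp [euclideanSnoc]

@[simp]
theorem euclideanSnoc_last {m : ℕ} (v : EuclideanSpace ℝ (Fin m)) (t : ℝ) :
    euclideanSnoc v t (Fin.last m) = t := by
  simp [euclideanSnoc]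

theorem EuclideanSpace.enorm_le_sum {m : ℕ} (v : EuclideanSpace ℝ (Fin m)) :
    ‖v‖ₑ ≤ ∑ i, ‖v i‖ₑ := by
  have h2 : v = ∑ i, EuclideanSpace.single i (v i) := by
    ext j
    simp [Pi.single_apply]
  calc ‖v‖ₑ = ‖∑ i, EuclideanSpace.single i (v i)‖ₑ := by rw [← h2]
    _ ≤ ∑ i, ‖EuclideanSpace.single i (v i)‖ₑ := enorm_sum_le _ _
    _ = ∑ i, ‖v i‖ₑ := by
      refine Finset.sum_congr rfl fun i _ => ?_
      rw [← ofReal_norm, ← ofReal_norm, PiLp.norm_single]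

/-! ### The measure (D_H w, -ℒⁿ) and mollified graph gradients. -/

section GraphMeasure

variable {E : Type*} [NormedAddCommGroup E] [NormedSpace ℝ E] [FiniteDimensional ℝ E]

/-- The divergence of the horizontal part of `g`. -/
noncomputable def horizontalDiv {m : ℕ} (X : Fin m → E → E)
    (g : E → EuclideanSpace ℝ (Fin (m + 1))) (x : E) : ℝ :=
  ∑ i : Fin m, fieldDiv (fun y => g y i.castSucc • X i y) x

variable [MeasureSpace E]

/-- `τ M` is the vector measure `(D_H w, -ℒⁿ)` on `Ω`, where `|τ| ≤ 1`. -/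
structure IsGraphMeasure {m : ℕ} (X : Fin m → E → E) (Ω : Set E) (w : E → ℝ) (M : Measure E)
    (τ : E → EuclideanSpace ℝ (Fin (m + 1))) : Prop where
  measurable : Measurable τ
  norm_le_one : ∀ x, ‖τ x‖ ≤ 1
  lt_top : ∀ K, IsCompact K → K ⊆ Ω → M K < ⊤
  integral_inner : ∀ g : E → EuclideanSpace ℝ (Fin (m + 1)), ContDiff ℝ 1 g →
    HasCompactSupport g → tsupport g ⊆ Ω →
    ∫ x, inner ℝ (g x) (τ x) ∂M = -(∫ x, w x * horizontalDiv X g x) - ∫ x, g x (Fin.last m)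

variable [BorelSpace E] [(volume : Measure E).IsAddHaarMeasure]

variable {m : ℕ} {X : Fin m → E → E} {Ω : Set E} {w : E → ℝ} {M : Measure E}
  {τ : E → EuclideanSpace ℝ (Fin (m + 1))} {ρ : E → ℝ}

theorem IsGraphMeasure.integrable_smul (h : IsGraphMeasure X Ω w M τ) {f : E → ℝ}
    (hf : Continuous f) (hc : HasCompactSupport f) (hs : tsupport f ⊆ Ω) :
    Integrable (fun y => f y • τ y) M := by
  have := FiniteDimensional.proper_real E
  obtain ⟨C, hC⟩ := hf.bounded_above_of_compact_support hc
  have h1 : IntegrableOn (fun y => f y • τ y) (tsupport f) M := by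
    refine Measure.integrableOn_of_bounded (M := C) (h.lt_top _ hc hs).ne
      (hf.measurable.smul h.measurable).aestronglyMeasurable (Eventually.of_forall fun y => ?_)
    rw [norm_smul]
    calc ‖f y‖ * ‖τ y‖ ≤ C * 1 := mul_le_mul (hC y) (h.norm_le_one y) (norm_nonneg _)
          ((norm_nonneg _).trans (hC y))
      _ = C := mul_one C
  refine (integrableOn_iff_integrable_of_support_subset fun y hy => ?_).1 h1
  refine subset_tsupport f fun h0 => hy ?_
  simp [h0]

theorem IsGraphMeasure.integral_smul_apply (h : IsGraphMeasure X Ω w M τ) {f : E → ℝ}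
    (hf : Continuous f) (hc : HasCompactSupport f) (hs : tsupport f ⊆ Ω) (j : Fin (m + 1)) :
    (∫ y, f y • τ y ∂M) j = ∫ y, inner ℝ (f y • EuclideanSpace.single j (1 : ℝ)) (τ y) ∂M := by
  have h1 := (EuclideanSpace.proj (𝕜 := ℝ) j).integral_comp_comm (h.integrable_smul hf hc hs)
  refine Eq.trans (show _ = _ from h1.symm) ?_
  refine integral_congr_ae (Eventually.of_forall fun y => ?_)
  simp [real_inner_smul_left, EuclideanSpace.inner_single_left]

/-- The defining identity is tested with the kernel centred at `x` times each basis vector, which is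
admissible because the closed ball lies in `Ω`. The horizontal components differ from the
derivatives of the mollification by commutators. The last one is exactly -1, since the kernel has
integral one. -/
theorem IsGraphMeasure.graphGradient_mollify (h : IsGraphMeasure X Ω w M τ)
    (hρ : IsMollifier ρ) (hX : ∀ i, ContDiff ℝ 1 (X i)) (hw : Integrable w) {ε : ℝ} (hε : 0 < ε)
    {x : E} (hx : Metric.closedBall x ε ⊆ Ω) :
    graphGradient X (mollify ρ ε w) x = (∫ y, scaledKernel ρ ε (x - y) • τ y ∂M)
      + euclideanSnoc (WithLp.toLp 2 fun i => mollifyCommutator ρ (X i) w ε x) 0 := by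
  have := FiniteDimensional.proper_real E
  have hk : ContDiff ℝ 1 fun y => scaledKernel ρ ε (x - y) :=
    (hρ.contDiff_scaledKernel ε).comp (contDiff_const.sub contDiff_id)
  have hsup : tsupport (fun y => scaledKernel ρ ε (x - y)) ⊆ Metric.closedBall x ε := by
    refine closure_minimal (fun y hy => ?_) Metric.isClosed_closedBall
    by_contra hn
    refine hy (hρ.scaledKernel_eq_zero hε ?_)
    rw [Metric.mem_closedBall, dist_comm, dist_eq_norm, not_le] at hn
    exact hn
  have hkc : HasCompactSupport fun y => scaledKernel ρ ε (x - y) :=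
    (isCompact_closedBall x ε).of_isClosed_subset (isClosed_tsupport _) hsup
  have key : ∀ j : Fin (m + 1), (∫ y, scaledKernel ρ ε (x - y) • τ y ∂M) j
      = -(∫ y, w y * horizontalDiv X
          (fun y => scaledKernel ρ ε (x - y) • EuclideanSpace.single j (1 : ℝ)) y)
        - ∫ y, (scaledKernel ρ ε (x - y) • EuclideanSpace.single j (1 : ℝ)) (Fin.last m) := by
    intro j
    rw [h.integral_smul_apply hk.continuous hkc (hsup.trans hx), h.integral_inner]
    · exact hk.smul contDiff_const
    · exact hkc.smul_right
    · exact (tsupport_smul_subset_left _ _).trans (hsup.trans hx)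
  ext j
  rw [PiLp.add_apply, key]
  refine Fin.lastCases ?_ (fun i => ?_) j
  · have h0 : ∀ y, horizontalDiv X (fun y => scaledKernel ρ ε (x - y) •
        EuclideanSpace.single (Fin.last m) (1 : ℝ)) y = 0 := by
      intro y
      refine Finset.sum_eq_zero fun i _ => ?_
      simp [fieldDiv, (Fin.castSucc_lt_last i).ne]
    simp [h0, graphGradient, hρ.integral_scaledKernel hε]
  · have h0 : ∀ y, horizontalDiv X (fun y => scaledKernel ρ ε (x - y) •
        EuclideanSpace.single i.castSucc (1 : ℝ)) y
        = fieldDiv (fun y => scaledKernel ρ ε (x - y) • X i y) y := by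
      intro y
      rw [horizontalDiv, Finset.sum_eq_single i]
      · simp
      · intro l _ hl
        have : l.castSucc ≠ i.castSucc := fun h => hl (Fin.castSucc_injective _ h)
        simp [fieldDiv, hl]
      · simp
    have h1 := hρ.fderiv_mollify_add (hX i) hw hε x
    simp only [h0, graphGradient, euclideanSnoc_castSucc]
    simp only [PiLp.smul_apply, PiLp.single_apply, smul_eq_mul]
    simp only [(Fin.castSucc_lt_last i).ne', if_false, mul_zero, integral_zero, sub_zero]
    linarith

theorem IsGraphMeasure.enorm_graphGradient_mollify_le (h : IsGraphMeasure X Ω w M τ)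
    (hρ : IsMollifier ρ) (hX : ∀ i, ContDiff ℝ 1 (X i)) (hw : Integrable w) {ε : ℝ} (hε : 0 < ε)
    {x : E} (hx : Metric.closedBall x ε ⊆ Ω) :
    ‖graphGradient X (mollify ρ ε w) x‖ₑ
      ≤ (∫⁻ y, ENNReal.ofReal (scaledKernel ρ ε (x - y)) ∂M)
        + ∑ i, ‖mollifyCommutator ρ (X i) w ε x‖ₑ := by
  rw [h.graphGradient_mollify hρ hX hw hε hx]
  refine (enorm_add_le _ _).trans (add_le_add ?_ ?_)
  · refine (enorm_integral_le_lintegral_enorm _).trans (lintegral_mono fun y => ?_)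
    rw [← ofReal_norm]
    refine ENNReal.ofReal_le_ofReal ?_
    rw [norm_smul, Real.norm_of_nonneg (hρ.scaledKernel_nonneg hε _)]
    exact mul_le_of_le_one_right (hρ.scaledKernel_nonneg hε _) (h.norm_le_one y)
  · refine (EuclideanSpace.enorm_le_sum _).trans ?_
    rw [Fin.sum_univ_castSucc]
    simp

theorem IsMollifier.lintegral_scaledKernel (hρ : IsMollifier ρ) {ε : ℝ} (hε : 0 < ε) (y : E) :
    ∫⁻ x, ENNReal.ofReal (scaledKernel ρ ε (x - y)) = 1 := by
  rw [lintegral_sub_right_eq_self (fun x => ENNReal.ofReal (scaledKernel ρ ε x)) y,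
    ← ofReal_integral_eq_lintegral_ofReal]
  · have := hρ.integral_scaledKernel hε 0
    rw [← integral_sub_left_eq_self (scaledKernel ρ ε) volume 0, this, ENNReal.ofReal_one]
  · exact (hρ.contDiff_scaledKernel ε).continuous.integrable_of_hasCompactSupport
      (hρ.hasCompactSupport_scaledKernel hε)
  · exact Eventually.of_forall fun x => hρ.scaledKernel_nonneg hε x

/-- The total variations of the mollified graph gradients are asymptotically bounded by `M`. -/
theorem IsGraphMeasure.eventually_lintegral_le (h : IsGraphMeasure X Ω w M τ) (hΩ : IsOpen Ω)
    (hρ : IsMollifier ρ) (hX : ∀ i, ContDiff ℝ 1 (X i)) (hw : Integrable w) (hwm : Measurable w)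
    {ε : ℕ → ℝ} (hε0 : ∀ k, 0 < ε k) (hε1 : ∀ k, ε k ≤ 1) (hε : Tendsto ε atTop (𝓝 0))
    {g : E → ℝ} (hg : Continuous g) (hgc : HasCompactSupport g)
    (hgs : tsupport g ⊆ Ω) {δ : ℝ≥0∞} (hδ : 0 < δ) :
    ∀ᶠ k in atTop, ∫⁻ x, ENNReal.ofReal (g x) * ‖graphGradient X (mollify ρ (ε k) w) x‖ₑ
      ≤ (∫⁻ x, ENNReal.ofReal (g x) ∂M) + δ := by
  have := FiniteDimensional.proper_real E
  set K := tsupport g with hKdef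
  have hK : IsCompact K := hgc
  obtain ⟨C, hC⟩ := hg.bounded_above_of_compact_support hgc
  obtain ⟨r, hr, hrΩ⟩ := hK.exists_cthickening_subset_open hΩ hgs
  set K' := Metric.cthickening r K with hK'def
  have hK' : IsCompact K' := hK.cthickening
  have hMK' : M K' < ⊤ := h.lt_top _ hK' hrΩ
  have hKm : MeasurableSet K := hK.measurableSet
  have hK'm : MeasurableSet K' := hK'.measurableSet
  -- the modulus of continuity of `g`
  obtain ⟨η, hη, hηδ⟩ : ∃ η : ℝ, 0 < η ∧ ENNReal.ofReal η * M K' ≤ δ / 2 := by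
    have h2 : 0 < δ / 2 := ENNReal.half_pos hδ.ne'
    have h3 : Tendsto (fun η : ℝ => ENNReal.ofReal η * M K') (𝓝[>] 0) (𝓝 0) := by
      have h4 : Tendsto (fun η : ℝ => ENNReal.ofReal η) (𝓝[>] 0) (𝓝 0) := by
        have := (ENNReal.continuous_ofReal.tendsto 0).mono_left
          (nhdsWithin_le_nhds (s := Ioi (0 : ℝ)))
        rwa [ENNReal.ofReal_zero] at this
      have := ENNReal.Tendsto.mul_const h4 (b := M K') (Or.inr hMK'.ne)
      rwa [zero_mul] at this
    obtain ⟨η, h5, h6⟩ := ((h3.eventually (gt_mem_nhds h2)).and self_mem_nhdsWithin).exists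
    exact ⟨η, h6, h5.le⟩
  obtain ⟨s, hs, hsg⟩ := Metric.uniformContinuous_iff.1
    (hgc.uniformContinuous_of_continuous hg) η hη
  -- the error term
  have herr : Tendsto (fun k => ENNReal.ofReal C *
      ∑ i, ∫⁻ x in K, ‖mollifyCommutator ρ (X i) w (ε k) x‖ₑ) atTop (𝓝 0) := by
    have h1 := tendsto_finsetSum Finset.univ fun i _ =>
      hρ.tendsto_commutator (hX i) hw hwm hε0 hε1 hε hK
    simp only [Finset.sum_const_zero] at h1
    have h2 := ENNReal.Tendsto.const_mul h1 (a := ENNReal.ofReal C) (Or.inr ENNReal.ofReal_ne_top)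
    rwa [mul_zero] at h2
  filter_upwards [herr.eventually (gt_mem_nhds (ENNReal.half_pos hδ.ne')),
    hε.eventually (gt_mem_nhds (lt_min hr hs))] with k hk hkε
  have hε0 := hε0 k
  set e := ε k
  have her : e ≤ r := (hkε.trans_le (min_le_left _ _)).le
  have hes : e < s := hkε.trans_le (min_le_right _ _)
  -- Only finiteness of `M` on compact subsets of `Ω` is known. Restricting to `K'`, which contains
  -- every ball that the kernel sees from `K`, gives a finite measure, for which Tonelli's theorem
  -- applies.
  let MK := M.restrict K'
  have : IsFiniteMeasure MK := ⟨by simpa [MK] using hMK'⟩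
  have hkm : Measurable fun p : E × E => ENNReal.ofReal (scaledKernel ρ e (p.1 - p.2)) := by
    have := (hρ.contDiff_scaledKernel e).continuous
    exact (by fun_prop : Continuous fun p : E × E =>
      scaledKernel ρ e (p.1 - p.2)).measurable.ennreal_ofReal
  have hgm : Measurable fun x => ENNReal.ofReal (g x) := hg.measurable.ennreal_ofReal
  have hpt : ∀ x ∈ K, ‖graphGradient X (mollify ρ e w) x‖ₑ
      ≤ (∫⁻ y, ENNReal.ofReal (scaledKernel ρ e (x - y)) ∂MK)
        + ∑ i, ‖mollifyCommutator ρ (X i) w e x‖ₑ := by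
    intro x hx
    have hb : Metric.closedBall x e ⊆ K' :=
      (Metric.closedBall_subset_closedBall her).trans (Metric.closedBall_subset_cthickening hx r)
    refine (h.enorm_graphGradient_mollify_le hρ hX hw hε0 (hb.trans hrΩ)).trans ?_
    refine add_le_add ?_ le_rfl
    rw [← lintegral_indicator hK'm]
    refine lintegral_mono fun y => ?_
    by_cases hy : y ∈ K'
    · rw [indicator_of_mem hy]
    · rw [hρ.scaledKernel_eq_zero hε0, ENNReal.ofReal_zero]
      · exact zero_le
      · by_contra hn
        refine hy (hb ?_)
        rw [Metric.mem_closedBall, dist_comm, dist_eq_norm]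
        exact not_lt.1 hn
  have hsupp : ∀ f : E → ℝ≥0∞, ∫⁻ x, ENNReal.ofReal (g x) * f x
      = ∫⁻ x in K, ENNReal.ofReal (g x) * f x := by
    intro f
    rw [← lintegral_indicator hKm]
    refine lintegral_congr fun x => ?_
    by_cases hx : x ∈ K
    · rw [indicator_of_mem hx]
    · rw [indicator_of_notMem hx, image_eq_zero_of_notMem_tsupport hx]
      simp
  rw [hsupp]
  have hm1 : Measurable fun x =>
      ENNReal.ofReal (g x) * ∫⁻ y, ENNReal.ofReal (scaledKernel ρ e (x - y)) ∂MK :=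
    hgm.mul hkm.lintegral_prod_right'
  calc ∫⁻ x in K, ENNReal.ofReal (g x) * ‖graphGradient X (mollify ρ e w) x‖ₑ
      ≤ ∫⁻ x in K, (ENNReal.ofReal (g x) *
          (∫⁻ y, ENNReal.ofReal (scaledKernel ρ e (x - y)) ∂MK)
          + ENNReal.ofReal C * ∑ i, ‖mollifyCommutator ρ (X i) w e x‖ₑ) := by
        refine setLIntegral_mono' hKm fun x hx => ?_
        refine (mul_le_mul_right (hpt x hx) _).trans ?_
        rw [mul_add]
        gcongr
        exact (le_abs_self _).trans (hC x)
    _ = (∫⁻ x in K, ENNReal.ofReal (g x) *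
          (∫⁻ y, ENNReal.ofReal (scaledKernel ρ e (x - y)) ∂MK))
          + ∫⁻ x in K, ENNReal.ofReal C * ∑ i, ‖mollifyCommutator ρ (X i) w e x‖ₑ :=
        lintegral_add_left hm1 _
    _ ≤ ((∫⁻ x, ENNReal.ofReal (g x) ∂M) + δ / 2) + δ / 2 := by
        refine add_le_add ?_ ?_
        · rw [← hsupp]
          -- Tonelli moves the kernel from `M` onto `g`.
          have h1 : ∫⁻ x, ENNReal.ofReal (g x) *
              (∫⁻ y, ENNReal.ofReal (scaledKernel ρ e (x - y)) ∂MK)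
              = ∫⁻ y, (∫⁻ x, ENNReal.ofReal (g x) *
                ENNReal.ofReal (scaledKernel ρ e (x - y))) ∂MK := by
            rw [← lintegral_lintegral_swap]
            · refine lintegral_congr fun x => ?_
              exact (lintegral_const_mul _ (hkm.comp (measurable_prodMk_left (x := x)))).symm
            · exact ((hgm.comp measurable_fst).mul hkm).aemeasurable
          rw [h1]
          -- The kernel has mass one and sees only points closer than `s` to `y`, where `g` exceeds
          -- `g y` by less than `η`.
          have h2 : ∀ y, ∫⁻ x, ENNReal.ofReal (g x) * ENNReal.ofReal (scaledKernel ρ e (x - y))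
              ≤ ENNReal.ofReal (g y) + ENNReal.ofReal η := by
            intro y
            calc ∫⁻ x, ENNReal.ofReal (g x) * ENNReal.ofReal (scaledKernel ρ e (x - y))
                ≤ ∫⁻ x, (ENNReal.ofReal (g y) + ENNReal.ofReal η)
                    * ENNReal.ofReal (scaledKernel ρ e (x - y)) := by
                  refine lintegral_mono fun x => ?_
                  by_cases hxy : e < ‖x - y‖
                  · rw [hρ.scaledKernel_eq_zero hε0 hxy]
                    simp
                  · have h3 : dist x y < s := by
                      rw [dist_eq_norm]
                      exact (not_lt.1 hxy).trans_lt hes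
                    have h4 := (abs_lt.1 (Real.dist_eq _ _ ▸ hsg h3)).2
                    refine mul_le_mul_left ?_ _
                    refine le_trans (ENNReal.ofReal_le_ofReal (by linarith)) ENNReal.ofReal_add_le
              _ = ENNReal.ofReal (g y) + ENNReal.ofReal η := by
                  have h3 : Measurable fun x => ENNReal.ofReal (scaledKernel ρ e (x - y)) :=
                    hkm.comp measurable_prodMk_right
                  rw [lintegral_const_mul _ h3, hρ.lintegral_scaledKernel hε0, mul_one]
          refine (lintegral_mono h2).trans ?_
          rw [lintegral_add_left hgm, lintegral_const]
          refine add_le_add (lintegral_mono' Measure.restrict_le_self le_rfl) ?_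
          simpa [MK] using hηδ
        · rw [lintegral_const_mul' _ _ ENNReal.ofReal_ne_top, lintegral_finsetSum']
          · exact hk.le
          · intro i _
            have h3 : Measurable fun x => mollifyCommutator ρ (X i) w e x := by
              have h5 := (hρ.continuous_commutatorKernel (hX i) e).measurable
              have h6 : Measurable fun p : E × E => w (p.1 - e • p.2) :=
                hwm.comp (by fun_prop : Continuous fun p : E × E => p.1 - e • p.2).measurable
              exact ((h6.mul h5).stronglyMeasurable.integral_prod_right').measurable
            exact h3.enorm.aemeasurable
    _ = (∫⁻ x, ENNReal.ofReal (g x) ∂M) + δ := by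
        rw [add_assoc, ENNReal.add_halves]

end GraphMeasure

/-! ### Weak limits of positive functionals along an ultrafilter. -/

/-- Continuous functions with compact support in `U`. -/
structure IsCompactlySupportedIn {Z V : Type*} [TopologicalSpace Z] [TopologicalSpace V] [Zero V]
    (U : Set Z) (φ : Z → V) : Prop where
  continuous : Continuous φ
  hasCompactSupport : HasCompactSupport φ
  tsupport_subset : tsupport φ ⊆ U

namespace IsCompactlySupportedIn

variable {Z : Type*} [TopologicalSpace Z] {U : Set Z}

theorem const_smul {φ : Z → ℝ} (hφ : IsCompactlySupportedIn U φ) (c : ℝ) :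
    IsCompactlySupportedIn U (c • φ) :=
  ⟨hφ.continuous.const_smul c, hφ.hasCompactSupport.smul_left (f := fun _ => c),
    (tsupport_smul_subset_right (fun _ => c) φ).trans hφ.tsupport_subset⟩

theorem extend [T2Space Z] (hU : IsOpen U) {f : U → ℝ} (hf : Continuous f)
    (hc : HasCompactSupport f) : IsCompactlySupportedIn U (Function.extend Subtype.val f 0) :=
  ⟨hc.continuous_extend_zero hU hf, hc.extend_zero continuous_subtype_val,
    (hc.tsupport_extend_zero_subset continuous_subtype_val).trans (Subtype.coe_image_subset _ _)⟩

theorem comp_norm {V : Type*} [NormedAddCommGroup V] {φ : Z → V}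
    (hφ : IsCompactlySupportedIn U φ) : IsCompactlySupportedIn U fun z => ‖φ z‖ := by
  have hs : tsupport (fun z => ‖φ z‖) = tsupport φ := by
    simp [tsupport, Function.support]
  exact ⟨hφ.continuous.norm, hφ.hasCompactSupport.norm, hs ▸ hφ.tsupport_subset⟩

theorem integrable {V : Type*} [NormedAddCommGroup V] [MeasurableSpace Z] [T2Space Z]
    [OpensMeasurableSpace Z] [SecondCountableTopology Z]
    {φ : Z → V} (hφ : IsCompactlySupportedIn U φ) {μ : Measure Z}
    (hμ : ∀ K, IsCompact K → K ⊆ U → μ K < ⊤) : Integrable φ μ := by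
  obtain ⟨C, hC⟩ := hφ.hasCompactSupport.exists_bound_of_continuous hφ.continuous
  refine (integrableOn_iff_integrable_of_support_subset (subset_tsupport φ)).1 ?_
  refine Measure.integrableOn_of_bounded (M := C)
    (hμ _ hφ.hasCompactSupport hφ.tsupport_subset).ne ?_ (Eventually.of_forall hC)
  exact hφ.continuous.stronglyMeasurable_of_hasCompactSupport
    hφ.hasCompactSupport |>.aestronglyMeasurable

end IsCompactlySupportedIn

/-- A limit of positive linear functionals along an ultrafilter is represented by a measure. -/
theorem exists_measure_tendsto_integral {Z : Type*} [TopologicalSpace Z] [T2Space Z]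
    [LocallyCompactSpace Z] [SecondCountableTopology Z] [MeasurableSpace Z] [BorelSpace Z]
    {U : Set Z} (hU : IsOpen U) (L : ℕ → (Z → ℝ) → ℝ) (F : Ultrafilter ℕ)
    (hadd : ∀ k φ ψ, IsCompactlySupportedIn U φ → IsCompactlySupportedIn U ψ →
      L k (φ + ψ) = L k φ + L k ψ)
    (hsmul : ∀ k φ (c : ℝ), IsCompactlySupportedIn U φ → L k (c • φ) = c * L k φ)
    (hpos : ∀ k φ, IsCompactlySupportedIn U φ → (∀ z, 0 ≤ φ z) → 0 ≤ L k φ)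
    (hbdd : ∀ φ, IsCompactlySupportedIn U φ → ∃ C : ℝ, ∀ᶠ k in (F : Filter ℕ), |L k φ| ≤ C) :
    ∃ μ : Measure Z, SigmaFinite μ ∧ μ Uᶜ = 0 ∧ (∀ K, IsCompact K → K ⊆ U → μ K < ⊤) ∧
      ∀ φ, IsCompactlySupportedIn U φ →
        Tendsto (fun k => L k φ) F (𝓝 (∫ z, φ z ∂μ)) := by
  -- Along an ultrafilter every eventually bounded real sequence converges, so all `φ` are treated
  -- at once, without a diagonal subsequence.
  have hlim : ∀ φ, IsCompactlySupportedIn U φ →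
      ∃ l, Tendsto (fun k => L k φ) F (𝓝 l) := by
    intro φ hφ
    obtain ⟨C, hC⟩ := hbdd φ hφ
    obtain ⟨l, _, hl⟩ := (isCompact_Icc (a := -C) (b := C)).ultrafilter_le_nhds
      (F.map fun k => L k φ) (by
        rw [Ultrafilter.coe_map, le_principal_iff]
        exact hC.mono fun k hk => abs_le.1 hk)
    exact ⟨l, hl⟩
  -- The Riesz theorem is applied on the locally compact space `U`, since the functionals are
  -- controlled only on supports inside `U`; test functions are extended by zero.
  have : LocallyCompactSpace U := hU.locallyCompactSpace
  have hext : ∀ f : CompactlySupportedContinuousMap U ℝ,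
      IsCompactlySupportedIn U (Function.extend Subtype.val f 0) := fun f =>
    IsCompactlySupportedIn.extend hU f.continuous f.hasCompactSupport
  choose l hl using fun f : CompactlySupportedContinuousMap U ℝ => hlim _ (hext f)
  have hex : ∀ (f : U → ℝ) (p : Z) (hp : p ∈ U),
      Function.extend Subtype.val f 0 p = f ⟨p, hp⟩ := fun f p hp =>
    Subtype.val_injective.extend_apply f 0 ⟨p, hp⟩
  have hex0 : ∀ (f : U → ℝ) (p : Z) (_ : p ∉ U), Function.extend Subtype.val f 0 p = 0 := by
    intro f p hp
    exact Function.extend_apply' _ _ _ fun ⟨q, hq⟩ => hp (hq ▸ q.2)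
  let Λ : CompactlySupportedContinuousMap U ℝ →ₗ[ℝ] ℝ :=
    { toFun := l
      map_add' := fun f g => by
        refine tendsto_nhds_unique (hl (f + g)) ?_
        refine ((hl f).add (hl g)).congr fun k => ?_
        rw [← hadd k _ _ (hext f) (hext g)]
        congr 1
        ext p
        by_cases hp : p ∈ U
        · simp [hex _ p hp]
        · simp [hex0 _ p hp]
      map_smul' := fun c f => by
        refine tendsto_nhds_unique (hl (c • f)) ?_
        refine ((hl f).const_mul c).congr fun k => ?_
        rw [← hsmul k _ _ (hext f)]
        congr 1
        ext p
        by_cases hp : p ∈ U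
        · simp [hex _ p hp]
        · simp [hex0 _ p hp] }
  let Λp : CompactlySupportedContinuousMap U ℝ →ₚ[ℝ] ℝ := PositiveLinearMap.mk₀ Λ fun f hf =>
    ge_of_tendsto (hl f) (Eventually.of_forall fun k => hpos k _ (hext f) fun p => by
      by_cases hp : p ∈ U
      · rw [hex _ p hp]
        exact hf _
      · rw [hex0 _ p hp])
  let μU : Measure U := RealRMK.rieszMeasure Λp
  have hemb : MeasurableEmbedding (Subtype.val : U → Z) := .subtype_coe hU.measurableSet
  have hμU : SigmaFinite μU := inferInstance
  refine ⟨μU.map Subtype.val, hemb.sigmaFinite_map, ?_, fun K hK hKU => ?_, fun φ hφ => ?_⟩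
  · rw [hemb.map_apply]
    simp
  · rw [hemb.map_apply]
    have : IsCompact (Subtype.val ⁻¹' K : Set U) := by
      rw [Subtype.isCompact_iff]
      rwa [Subtype.image_preimage_coe, inter_eq_right.2 hKU]
    exact this.measure_lt_top
  · rw [hemb.integral_map]
    have hcs : HasCompactSupport fun x : U => φ x := by
      refine HasCompactSupport.intro (K := Subtype.val ⁻¹' tsupport φ) ?_ fun x hx =>
        image_eq_zero_of_notMem_tsupport hx
      rw [Subtype.isCompact_iff, Subtype.image_preimage_coe, inter_eq_right.2 hφ.tsupport_subset]
      exact hφ.hasCompactSupport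
    let f : CompactlySupportedContinuousMap U ℝ :=
      ⟨⟨fun x => φ x, hφ.continuous.comp continuous_subtype_val⟩, hcs⟩
    have hf : Function.extend Subtype.val f 0 = φ := by
      ext p
      by_cases hp : p ∈ U
      · rw [hex _ p hp]
        rfl
      · rw [hex0 _ p hp, image_eq_zero_of_notMem_tsupport fun h => hp (hφ.tsupport_subset h)]
    have h1 := RealRMK.integral_rieszMeasure Λp f
    have h2 : Tendsto (fun k => L k φ) F (𝓝 (Λp f)) := by
      have := hl f
      rwa [hf] at this
    rw [← h1] at h2
    exact h2

/-! ### Limit measures on graphs and their projections. -/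

section GraphLimit

variable {E : Type*} [NormedAddCommGroup E] [NormedSpace ℝ E] [FiniteDimensional ℝ E]
  [MeasureSpace E] [BorelSpace E] [(volume : Measure E).IsAddHaarMeasure]

theorem enorm_integral_graph_mul_le {v g : E → ℝ} {φ : E × ℝ → ℝ} {a : E → ℝ} {b : E → ℝ≥0∞}
    (hab : ∀ x, ‖a x‖ₑ ≤ b x) (hφ : ∀ x t, |φ (x, t)| ≤ g x) :
    ‖∫ x, φ (x, v x) * a x‖ₑ ≤ ∫⁻ x, ENNReal.ofReal (g x) * b x := by
  refine (enorm_integral_le_lintegral_enorm _).trans (lintegral_mono fun x => ?_)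
  rw [enorm_mul]
  refine mul_le_mul' ?_ (hab x)
  rw [← ofReal_norm]
  exact ENNReal.ofReal_le_ofReal (hφ x _)

theorem exists_cutoff {Ω : Set E} (hΩ : IsOpen Ω) {K : Set E} (hK : IsCompact K) (hKΩ : K ⊆ Ω) :
    ∃ g : E → ℝ, IsCompactlySupportedIn Ω g ∧ (∀ x ∈ K, g x = 1) ∧ ∀ x, 0 ≤ g x ∧ g x ≤ 1 := by
  have := FiniteDimensional.proper_real E
  obtain ⟨K', hK', hKK', hK'Ω⟩ := exists_compact_between hK hΩ hKΩ
  obtain ⟨g, hg1, hg0, hgc, hg⟩ := exists_continuous_one_zero_of_isCompact hK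
    (isOpen_interior (s := K')).isClosed_compl (disjoint_compl_right_iff_subset.2 hKK')
  refine ⟨g, ⟨g.continuous, hgc, ?_⟩, fun x hx => hg1 hx, fun x => hg x⟩
  refine (closure_minimal (fun x hx => ?_) hK'.isClosed).trans hK'Ω
  by_contra hn
  exact hx (hg0 fun h => hn (interior_subset h))

theorem integrable_graph_mul {Ω : Set E} {φ : E × ℝ → ℝ}
    (hφ : IsCompactlySupportedIn (Ω ×ˢ univ) φ) {v a : E → ℝ} (hv : Continuous v)
    (ha : Continuous a) : Integrable fun x => φ (x, v x) * a x :=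
  Continuous.integrable_of_hasCompactSupport
    ((hφ.continuous.comp (continuous_id.prodMk hv)).mul ha)
    (hasCompactSupport_slice hφ.hasCompactSupport v).mul_right

/-- Weak limits of the measures `(id, v k)_# (a k ℒⁿ)`, where `0 ≤ a k` is bounded by a sequence
with asymptotically locally bounded masses. -/
theorem exists_graph_limit_measure {Ω : Set E} (hΩ : IsOpen Ω) {M : Measure E}
    (hM : ∀ K, IsCompact K → K ⊆ Ω → M K < ⊤) {v : ℕ → E → ℝ} (hv : ∀ k, Continuous (v k))
    {b : ℕ → E → ℝ≥0∞}
    (hb : ∀ g : E → ℝ, IsCompactlySupportedIn Ω g → ∀ δ : ℝ≥0∞, 0 < δ →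
      ∀ᶠ k in atTop, ∫⁻ x, ENNReal.ofReal (g x) * b k x ≤ (∫⁻ x, ENNReal.ofReal (g x) ∂M) + δ)
    {F : Ultrafilter ℕ} (hF : (F : Filter ℕ) ≤ atTop) {a : ℕ → E → ℝ}
    (ha : ∀ k, Continuous (a k)) (ha0 : ∀ k x, 0 ≤ a k x) (hab : ∀ k x, ‖a k x‖ₑ ≤ b k x) :
    ∃ μ : Measure (E × ℝ), SigmaFinite μ ∧ μ (Ω ×ˢ univ)ᶜ = 0 ∧
      (∀ K, IsCompact K → K ⊆ Ω ×ˢ univ → μ K < ⊤) ∧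
      ∀ φ, IsCompactlySupportedIn (Ω ×ˢ univ) φ →
        Tendsto (fun k => ∫ x, φ (x, v k x) * a k x) F (𝓝 (∫ p, φ p ∂μ)) := by
  have := FiniteDimensional.proper_real E
  have : SecondCountableTopology E := inferInstance
  refine exists_measure_tendsto_integral (hΩ.prod isOpen_univ)
    (fun k φ => ∫ x, φ (x, v k x) * a k x) F (fun k φ ψ hφ hψ => ?_) (fun k φ c hφ => ?_)
    (fun k φ hφ h0 => integral_nonneg fun x => mul_nonneg (h0 _) (ha0 _ _)) (fun φ hφ => ?_)
  · simp only [Pi.add_apply, add_mul]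
    exact integral_add (integrable_graph_mul hφ (hv k) (ha k))
      (integrable_graph_mul hψ (hv k) (ha k))
  · simp only [Pi.smul_apply, smul_eq_mul, mul_assoc]
    exact integral_const_mul _ _
  -- A multiple of a cutoff equal to 1 on the projection of the support of `φ` dominates `φ` at
  -- every height, so the bound on `Ω` controls the functional whatever `v k` is.
  · obtain ⟨g, hg, hg1, hg01⟩ := exists_cutoff hΩ
      (hφ.hasCompactSupport.isCompact.image continuous_fst) (by
        rintro _ ⟨p, hp, rfl⟩
        exact (hφ.tsupport_subset hp).1)
    obtain ⟨C, hC⟩ := hφ.continuous.bounded_above_of_compact_support hφ.hasCompactSupport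
    have hC0 : 0 ≤ C := (norm_nonneg _).trans (hC 0)
    have hCg := hg.const_smul C
    have hle : ∀ x t, |φ (x, t)| ≤ (C • g) x := by
      intro x t
      by_cases hx : (x, t) ∈ tsupport φ
      · simpa [hg1 x ⟨_, hx, rfl⟩] using hC (x, t)
      · rw [image_eq_zero_of_notMem_tsupport hx, abs_zero]
        exact mul_nonneg hC0 (hg01 x).1
    set I := (∫⁻ x, ENNReal.ofReal ((C • g) x) ∂M) + 1
    have hI : I ≠ ⊤ := ENNReal.add_ne_top.2 ⟨by
      have h1 := (hCg.integrable hM).2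
      rw [hasFiniteIntegral_iff_norm] at h1
      refine ((lintegral_mono fun x => ?_).trans_lt h1).ne
      exact ENNReal.ofReal_le_ofReal (le_abs_self _), ENNReal.one_ne_top⟩
    refine ⟨I.toReal, hF ((hb _ hCg 1 one_pos).mono fun k hk => ?_)⟩
    have h2 := (enorm_integral_graph_mul_le (v := v k) (hab k) hle).trans hk
    rw [← Real.norm_eq_abs, ← toReal_enorm]
    exact ENNReal.toReal_mono hI h2

/-- If the weights are exactly the bounding sequence, then the limit measure projects
below `M`. -/
theorem graph_limit_measure_prod_le {Ω : Set E} (hΩ : IsOpen Ω) {M : Measure E}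
    (hM : ∀ K, IsCompact K → K ⊆ Ω → M K < ⊤) {v : ℕ → E → ℝ}
    {b : ℕ → E → ℝ≥0∞}
    (hb : ∀ g : E → ℝ, IsCompactlySupportedIn Ω g → ∀ δ : ℝ≥0∞, 0 < δ →
      ∀ᶠ k in atTop, ∫⁻ x, ENNReal.ofReal (g x) * b k x ≤ (∫⁻ x, ENNReal.ofReal (g x) ∂M) + δ)
    {F : Ultrafilter ℕ} (hF : (F : Filter ℕ) ≤ atTop) {a : ℕ → E → ℝ}
    (hab : ∀ k x, ‖a k x‖ₑ ≤ b k x) {μ : Measure (E × ℝ)}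
    (hfin : ∀ K, IsCompact K → K ⊆ Ω ×ˢ univ → μ K < ⊤)
    (hμ : ∀ φ, IsCompactlySupportedIn (Ω ×ˢ univ) φ →
        Tendsto (fun k => ∫ x, φ (x, v k x) * a k x) F (𝓝 (∫ p, φ p ∂μ)))
    {K : Set E} (hK : IsCompact K) (hKΩ : K ⊆ Ω) : μ (K ×ˢ univ) ≤ M K := by
  have := FiniteDimensional.proper_real E
  have : SecondCountableTopology E := inferInstance
  obtain ⟨r, hr, hrΩ⟩ := hK.exists_cthickening_subset_open hΩ hKΩ
  -- Closed thickenings shrink to `K` with finite `M`-mass, so it suffices to bound the left side by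
  -- the mass of each small thickening.
  have hM1 : Tendsto (fun s => M (Metric.cthickening s K)) (𝓝[>] 0) (𝓝 (M K)) := by
    refine (tendsto_measure_cthickening_of_isClosed ⟨r, hr, ?_⟩ hK.isClosed).mono_left
      nhdsWithin_le_nhds
    exact (hM _ hK.cthickening hrΩ).ne
  refine ge_of_tendsto hM1 ?_
  filter_upwards [Ioo_mem_nhdsGT hr] with s hs
  obtain ⟨g, hg, hg1, hg01⟩ := exists_cutoff (Metric.isOpen_thickening (δ := s) (E := K)) hK
    (Metric.self_subset_thickening hs.1 K)
  have hsub : tsupport g ⊆ Metric.cthickening s K :=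
    hg.tsupport_subset.trans (Metric.thickening_subset_cthickening s K)
  have hgΩ : IsCompactlySupportedIn Ω g := ⟨hg.continuous, hg.hasCompactSupport,
    hsub.trans ((Metric.cthickening_mono hs.2.le K).trans hrΩ)⟩
  have hgM : ∫⁻ x, ENNReal.ofReal (g x) ∂M ≤ M (Metric.cthickening s K) := by
    rw [← setLIntegral_one, ← lintegral_indicator Metric.isClosed_cthickening.measurableSet]
    refine lintegral_mono fun x => ?_
    by_cases hx : x ∈ Metric.cthickening s K
    · rw [indicator_of_mem hx]
      exact ENNReal.ofReal_le_one.2 (hg01 x).2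
    · rw [image_eq_zero_of_notMem_tsupport fun h => hx (hsub h)]
      simp
  have hunion : K ×ˢ (univ : Set ℝ) = ⋃ j : ℕ, K ×ˢ Icc (-(j : ℝ)) j := by
    ext p
    simp only [mem_prod, mem_univ, and_true, mem_iUnion, mem_Icc]
    constructor
    · intro h
      obtain ⟨j, hj⟩ := exists_nat_ge |p.2|
      exact ⟨j, h, abs_le.1 hj⟩
    · rintro ⟨j, h, _⟩
      exact h
  have hmono : Monotone fun j : ℕ => K ×ˢ Icc (-(j : ℝ)) j := by
    intro i j hij
    have : (i : ℝ) ≤ j := by exact_mod_cast hij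
    exact prod_mono le_rfl (Icc_subset_Icc (by linarith) this)
  rw [hunion, hmono.measure_iUnion]
  refine iSup_le fun j => ?_
  -- A vertical cutoff gives the test function compact support. As 0 ≤ ψ ≤ 1, the resulting bound
  -- involves `g` alone and is uniform in the height `j`.
  obtain ⟨ψ, hψ, hψ1, hψ01⟩ := exists_cutoff (E := ℝ) isOpen_univ
    (isCompact_Icc (a := -(j : ℝ)) (b := j)) (subset_univ _)
  have hφ : IsCompactlySupportedIn (Ω ×ˢ univ) fun p : E × ℝ => g p.1 * ψ p.2 := by
    have hsup : tsupport (fun p : E × ℝ => g p.1 * ψ p.2) ⊆ tsupport g ×ˢ tsupport ψ := by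
      refine closure_minimal (fun p hp => ?_) ((isClosed_tsupport _).prod (isClosed_tsupport _))
      exact ⟨subset_tsupport _ (left_ne_zero_of_mul hp),
        subset_tsupport _ (right_ne_zero_of_mul hp)⟩
    exact ⟨(hg.continuous.comp continuous_fst).mul (hψ.continuous.comp continuous_snd),
      (hg.hasCompactSupport.isCompact.prod hψ.hasCompactSupport.isCompact).of_isClosed_subset
        (isClosed_tsupport _) hsup, hsup.trans (prod_mono hgΩ.tsupport_subset (subset_univ _))⟩
  have h0 : ∀ p : E × ℝ, 0 ≤ g p.1 * ψ p.2 := fun p => mul_nonneg (hg01 _).1 (hψ01 _).1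
  have hle : ∀ x t, |g x * ψ t| ≤ g x := by
    intro x t
    rw [abs_of_nonneg (h0 (x, t))]
    exact mul_le_of_le_one_right (hg01 x).1 (hψ01 t).2
  have hint := hφ.integrable hfin
  have h1 : μ (K ×ˢ Icc (-(j : ℝ)) j) ≤ ENNReal.ofReal (∫ p, g p.1 * ψ p.2 ∂μ) := by
    rw [ofReal_integral_eq_lintegral_ofReal hint (Eventually.of_forall h0), ← setLIntegral_one,
      ← lintegral_indicator (hK.measurableSet.prod measurableSet_Icc)]
    refine lintegral_mono fun p => ?_
    by_cases hp : p ∈ K ×ˢ Icc (-(j : ℝ)) j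
    · rw [indicator_of_mem hp, hg1 _ hp.1, hψ1 _ hp.2]
      simp
    · simp [indicator_of_notMem hp]
  refine h1.trans (le_trans ?_ hgM)
  refine le_of_forall_pos_le_add fun δ hδ => ?_
  refine le_of_tendsto ((ENNReal.continuous_ofReal.tendsto _).comp (hμ _ hφ)) ?_
  refine hF ((hb g hgΩ δ hδ).mono fun k hk => ?_)
  refine le_trans ?_ ((enorm_integral_graph_mul_le (v := v k)
    (φ := fun p => g p.1 * ψ p.2) (hab k) hle).trans hk)
  rw [← ofReal_norm]
  exact ENNReal.ofReal_le_ofReal (le_abs_self _)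

end GraphLimit

/-! ### Passing to the limit in the subgraphs of the mollifications. -/

section SubgraphLimit

variable {E : Type*} [NormedAddCommGroup E] [NormedSpace ℝ E] [FiniteDimensional ℝ E]
  [MeasureSpace E] [BorelSpace E] [(volume : Measure E).IsAddHaarMeasure]

/-- Over each `x` the two slices differ by the interval between `w x` and `v x`, on which |H| ≤ C.
-/
theorem enorm_integral_lt_graph_sub_le {w v : E → ℝ} (hw : Measurable w) (hv : Measurable v)
    {H : E × ℝ → ℝ} (hH : Continuous H) (hc : HasCompactSupport H) {C : ℝ}
    (hC : ∀ p, ‖H p‖ ≤ C) :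
    ‖(∫ p in {p : E × ℝ | p.2 < v p.1}, H p) - ∫ p in {p : E × ℝ | p.2 < w p.1}, H p‖ₑ
      ≤ ENNReal.ofReal C * ∫⁻ x, ‖v x - w x‖ₑ := by
  have := FiniteDimensional.proper_real E
  have : SecondCountableTopology E := inferInstance
  have hint : Integrable H := hH.integrable_of_hasCompactSupport hc
  have hslice : ∀ f : E → ℝ, Measurable f → Integrable fun x => ∫ t in Iio (f x), H (x, t) := by
    intro f hf
    have h1 : Integrable ({p : E × ℝ | p.2 < f p.1}.indicator H)
        ((volume : Measure E).prod (volume : Measure ℝ)) :=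
      hint.indicator (measurableSet_lt_graph hf)
    refine h1.integral_prod_left.congr (Eventually.of_forall fun x => ?_)
    simp only
    rw [← integral_indicator measurableSet_Iio]
    rfl
  rw [integral_lt_graph hv hint, integral_lt_graph hw hint, ← integral_sub (hslice v hv)
    (hslice w hw)]
  refine (enorm_integral_le_lintegral_enorm _).trans ?_
  rw [← lintegral_const_mul' _ _ ENNReal.ofReal_ne_top]
  refine lintegral_mono fun x => ?_
  have hemb : IsClosedEmbedding fun t : ℝ => (x, t) :=
    (Isometry.of_dist_eq fun s t => by simp [Prod.dist_eq]).isClosedEmbedding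
  have hx : Integrable fun t => H (x, t) :=
    (hH.comp (by fun_prop : Continuous fun t : ℝ => (x, t))).integrable_of_hasCompactSupport
      (hc.comp_isClosedEmbedding hemb)
  have hC0 : 0 ≤ C := (norm_nonneg _).trans (hC 0)
  have h2 := intervalIntegral.norm_integral_le_of_norm_le_const (a := w x) (b := v x)
    (f := fun t => H (x, t)) (C := C) fun t _ => hC (x, t)
  rw [← intervalIntegral.integral_Iic_sub_Iic hx.integrableOn hx.integrableOn,
    integral_Iic_eq_integral_Iio, integral_Iic_eq_integral_Iio] at h2
  rw [← ofReal_norm, ← ofReal_norm, ← ENNReal.ofReal_mul hC0]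
  exact ENNReal.ofReal_le_ofReal h2

theorem continuous_graphGradient {m : ℕ} {X : Fin m → E → E} (hX : ∀ i, ContDiff ℝ 1 (X i))
    {v : E → ℝ} (hv : ContDiff ℝ 1 v) : Continuous (graphGradient X v) := by
  refine (PiLp.continuous_toLp 2 _).comp (continuous_pi fun j => ?_)
  refine Fin.lastCases ?_ (fun i => ?_) j
  · simpa using continuous_const
  · simpa using (hv.continuous_fderiv one_ne_zero).clm_apply (hX i).continuous

variable {m : ℕ} {X : Fin m → E → E} {Ω : Set E} {w : E → ℝ} {M : Measure E}
  {τ : E → EuclideanSpace ℝ (Fin (m + 1))} {ρ : E → ℝ}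

/-- For each `k` the integral equals minus the subgraph integral of the divergence, by the C¹
formula; L¹ convergence of the mollifications gives convergence of these. -/
theorem IsMollifier.tendsto_integral_graphGradient (hρ : IsMollifier ρ)
    (hX : ∀ i, ContDiff ℝ 1 (X i)) (hw : Integrable w) (hwm : Measurable w) {ε : ℕ → ℝ}
    (hε0 : ∀ k, 0 < ε k) (hε : Tendsto ε atTop (𝓝 0))
    {φ : E × ℝ → EuclideanSpace ℝ (Fin (m + 1))} (hφ : ContDiff ℝ 1 φ)
    (hc : HasCompactSupport φ) :
    Tendsto (fun k => ∫ x, inner ℝ (φ (x, mollify ρ (ε k) w x))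
      (graphGradient X (mollify ρ (ε k) w) x)) atTop
      (𝓝 (-∫ p in {p : E × ℝ | p.2 < w p.1}, divX (extendedFields X) φ p)) := by
  have hcont : Continuous (divX (extendedFields X) φ) :=
    continuous_divX (contDiff_extendedFields hX) hφ
  have hcs := hasCompactSupport_divX (X := extendedFields X) hc
  obtain ⟨C, hC⟩ := hcont.bounded_above_of_compact_support hcs
  have h1 : Tendsto (fun k => ∫ p in {p : E × ℝ | p.2 < mollify ρ (ε k) w p.1},
      divX (extendedFields X) φ p) atTop
      (𝓝 (∫ p in {p : E × ℝ | p.2 < w p.1}, divX (extendedFields X) φ p)) := by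
    rw [tendsto_iff_edist_tendsto_0]
    have h2 := ENNReal.Tendsto.const_mul (hρ.tendsto_mollify hw hwm hε0 hε)
      (a := ENNReal.ofReal C) (Or.inr ENNReal.ofReal_ne_top)
    rw [mul_zero] at h2
    refine tendsto_of_tendsto_of_tendsto_of_le_of_le tendsto_const_nhds h2 (fun _ => zero_le)
      fun k => ?_
    simp only
    rw [edist_eq_enorm_sub]
    exact enorm_integral_lt_graph_sub_le hwm
      (hρ.contDiff_mollify (hε0 k) hw).continuous.measurable hcont hcs hC
  refine h1.neg.congr fun k => ?_
  rw [integral_lt_graph_divX hX (hρ.contDiff_mollify (hε0 k) hw) hφ hc, neg_neg]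

theorem tendsto_inv_add_one : Tendsto (fun k : ℕ => ((k : ℝ) + 1)⁻¹) atTop (𝓝 0) := by
  simpa [one_div] using tendsto_one_div_add_atTop_nhds_zero_nat (𝕜 := ℝ)

theorem inv_add_one_le_one (k : ℕ) : ((k : ℝ) + 1)⁻¹ ≤ 1 :=
  inv_le_one_of_one_le₀ (by linarith [k.cast_nonneg (α := ℝ)])

theorem IsCompactlySupportedIn.apply {Z : Type*} [TopologicalSpace Z] {U : Set Z}
    {φ : Z → EuclideanSpace ℝ (Fin m)} (hφ : IsCompactlySupportedIn U φ) (j : Fin m) :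
    IsCompactlySupportedIn U fun z => φ z j := by
  have hs : tsupport (fun z => φ z j) ⊆ tsupport φ :=
    closure_mono fun z (hz : φ z j ≠ 0) h0 => hz (by simp [h0])
  have hc := hφ.continuous
  exact ⟨by fun_prop, hφ.hasCompactSupport.of_isClosed_subset (isClosed_tsupport _) hs,
    hs.trans hφ.tsupport_subset⟩

/-- The subgraph functional is dominated by a measure which projects below `M`. -/
theorem IsGraphMeasure.exists_dominating_measure (h : IsGraphMeasure X Ω w M τ) (hΩ : IsOpen Ω)
    (hX : ∀ i, ContDiff ℝ 1 (X i)) (hw : Integrable w) (hwm : Measurable w) :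
    ∃ μ : Measure (E × ℝ), (∀ K, IsCompact K → K ⊆ Ω ×ˢ univ → μ K < ⊤) ∧
      (∀ K, IsCompact K → K ⊆ Ω → μ (K ×ˢ univ) ≤ M K) ∧
      ∀ φ : E × ℝ → EuclideanSpace ℝ (Fin (m + 1)), ContDiff ℝ 1 φ →
        IsCompactlySupportedIn (Ω ×ˢ univ) φ →
        -∫ p in {p : E × ℝ | p.2 < w p.1}, divX (extendedFields X) φ p ≤ ∫ p, ‖φ p‖ ∂μ := by
  obtain ⟨ρ, hρ⟩ := exists_isMollifier (E := E)
  have hε0 : ∀ k : ℕ, 0 < ((k : ℝ) + 1)⁻¹ := fun k => by positivity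
  set v : ℕ → E → ℝ := fun k => mollify ρ ((k : ℝ) + 1)⁻¹ w
  have hv : ∀ k, ContDiff ℝ 1 (v k) := fun k => hρ.contDiff_mollify (hε0 k) hw
  have hb := fun (g : E → ℝ) (hg : IsCompactlySupportedIn Ω g) (δ : ℝ≥0∞) (hδ : 0 < δ) =>
    h.eventually_lintegral_le hΩ hρ hX hw hwm hε0 inv_add_one_le_one tendsto_inv_add_one
      hg.continuous hg.hasCompactSupport hg.tsupport_subset hδ
  have hgc : ∀ k, Continuous fun x => ‖graphGradient X (v k) x‖ := fun k =>
    (continuous_graphGradient hX (hv k)).norm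
  have hF : (Ultrafilter.of (atTop : Filter ℕ) : Filter ℕ) ≤ atTop := Ultrafilter.of_le _
  have hab : ∀ k x, ‖‖graphGradient X (v k) x‖‖ₑ ≤ ‖graphGradient X (v k) x‖ₑ := fun k x => by
    rw [enorm_norm]
  obtain ⟨μ, -, -, hfin, hμ⟩ := exists_graph_limit_measure hΩ h.lt_top
    (fun k => (hv k).continuous) hb hF hgc (fun k x => norm_nonneg _) hab
  refine ⟨μ, hfin, fun K hK hKΩ =>
    graph_limit_measure_prod_le hΩ h.lt_top hb hF hab hfin hμ hK hKΩ, fun φ hφ hφc => ?_⟩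
  -- The Cauchy–Schwarz inequality holds on the graph of each `v k`. Its left side tends to the
  -- subgraph functional, its right side to the integral of ‖φ‖ against the limit of the masses
  -- ‖graphGradient‖ℒⁿ on the graphs.
  refine le_of_tendsto_of_tendsto ((hρ.tendsto_integral_graphGradient hX hw hwm hε0
    tendsto_inv_add_one hφ hφc.hasCompactSupport).mono_left hF) (hμ _ hφc.comp_norm)
    (Eventually.of_forall fun k => ?_)
  have hvc := (hv k).continuous
  have hint : Integrable fun x => inner ℝ (φ (x, v k x)) (graphGradient X (v k) x) := by
    have hφk : Continuous fun x => φ (x, v k x) := hφ.continuous.comp (by fun_prop)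
    refine (hφk.inner (continuous_graphGradient hX (hv k))).integrable_of_hasCompactSupport ?_
    refine (hasCompactSupport_slice hφc.hasCompactSupport (v k)).mono fun x hx => ?_
    refine fun h0 => hx ?_
    simp only at h0
    simp only [h0, inner_zero_left]
  exact integral_mono hint (integrable_graph_mul hφc.comp_norm hvc (hgc k)) fun x =>
    real_inner_le_norm _ _

end SubgraphLimit

/-! ### Vector measures assembled from positive measures. -/

namespace RadonVectorMeasure

variable {E : Type*} [TopologicalSpace E] [T2Space E] [MeasurableSpace E] [BorelSpace E]
  {U : Set E}

/-- The vector measure `h P`, for a density `h` which is integrable on compact subsets. -/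
noncomputable def ofDensity {V : Type*} [NormedAddCommGroup V] [NormedSpace ℝ V] (P : Measure E)
    (h : E → V) (hh : ∀ K, IsCompact K → K ⊆ U → IntegrableOn h K P) : RadonVectorMeasure U V where
  toFun B := ∫ x in B, h x ∂P
  hasSum_iUnion' K hK hKU _ hB hBK hd :=
    hasSum_integral_iUnion hB hd ((hh K hK hKU).mono_set (iUnion_subset hBK))

/-- The vector measure whose components are differences of positive measures. -/
theorem exists_integral_eq_sum_sub [SecondCountableTopology E] {d : ℕ}
    (μ ν : Fin d → Measure E) [∀ j, SigmaFinite (μ j)] [∀ j, SigmaFinite (ν j)]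
    (hμ : ∀ j K, IsCompact K → K ⊆ U → μ j K < ⊤) (hν : ∀ j K, IsCompact K → K ⊆ U → ν j K < ⊤) :
    ∃ D : RadonVectorMeasure U (EuclideanSpace ℝ (Fin d)),
      ∀ φ : E → EuclideanSpace ℝ (Fin d), IsCompactlySupportedIn U φ →
        ∀ (hc : HasCompactSupport φ) (hs : tsupport φ ⊆ U),
          (D.onCompact (tsupport φ) hc hs).integral φ (innerSL ℝ) =
            ∑ j, ((∫ x, φ x j ∂μ j) - ∫ x, φ x j ∂ν j) := by
  -- A common dominating measure. The differences μ_j - ν_j may be meaningless on noncompact sets,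
  -- but the differences of densities are integrable on compact subsets of `U` and define the vector
  -- measure there.
  set P : Measure E := Measure.sum fun j => μ j + ν j
  have hPμ : ∀ j, μ j ≪ P := fun j =>
    (Measure.le_add_right le_rfl |>.trans (Measure.le_sum _ j)).absolutelyContinuous
  have hPν : ∀ j, ν j ≪ P := fun j =>
    (Measure.le_add_left le_rfl |>.trans (Measure.le_sum _ j)).absolutelyContinuous
  set h : E → EuclideanSpace ℝ (Fin d) := fun x => WithLp.toLp 2 fun j =>
    ((μ j).rnDeriv P x).toReal - ((ν j).rnDeriv P x).toReal
  have key : ∀ (κ : Measure E) [SigmaFinite κ], κ ≪ P → ∀ K, MeasurableSet K → κ K < ⊤ →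
      IntegrableOn (fun x => (κ.rnDeriv P x).toReal) K P := by
    intro κ _ hκ K hKm hK
    have h1 : Integrable (K.indicator fun _ => (1 : ℝ)) κ :=
      (integrable_indicator_iff hKm).2 (integrableOn_const hK.ne)
    rw [← integrable_rnDeriv_smul_iff hκ] at h1
    rw [← integrable_indicator_iff hKm]
    refine h1.congr (Eventually.of_forall fun x => ?_)
    by_cases hx : x ∈ K <;> simp [hx]
  have hh : ∀ K, IsCompact K → K ⊆ U → IntegrableOn h K P := fun K hK hKU =>
    Integrable.of_eval_piLp fun j =>
      (key _ (hPμ j) K hK.measurableSet (hμ j K hK hKU)).sub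
        (key _ (hPν j) K hK.measurableSet (hν j K hK hKU))
  refine ⟨ofDensity P h hh, fun φ hφ hc hs => ?_⟩
  obtain ⟨C, hC⟩ := hc.exists_bound_of_continuous hφ.continuous
  have hmeas : StronglyMeasurable φ := hφ.continuous.stronglyMeasurable_of_hasCompactSupport hc
  rw [onCompact_integral_eq _ hc hs (hh _ hc hs) (fun B _ _ => rfl) hmeas hC]
  have hzero : ∀ x, x ∉ tsupport φ → inner ℝ (φ x) (h x) = 0 := fun x hx => by
    rw [image_eq_zero_of_notMem_tsupport hx, inner_zero_left]
  rw [setIntegral_eq_integral_of_forall_compl_eq_zero hzero]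
  have hφμ : ∀ j, Integrable (fun x => φ x j) (μ j) := fun j => (hφ.apply j).integrable (hμ j)
  have hφν : ∀ j, Integrable (fun x => φ x j) (ν j) := fun j => (hφ.apply j).integrable (hν j)
  have h1 : ∀ x, inner ℝ (φ x) (h x) = ∑ j, (((μ j).rnDeriv P x).toReal • φ x j -
      ((ν j).rnDeriv P x).toReal • φ x j) := fun x => by
    rw [PiLp.inner_apply]
    refine Finset.sum_congr rfl fun j _ => ?_
    simp only [h, smul_eq_mul, RCLike.inner_apply, conj_trivial]
    ring
  simp_rw [h1]
  rw [integral_finsetSum]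
  · refine Finset.sum_congr rfl fun j _ => ?_
    rw [integral_sub ((integrable_rnDeriv_smul_iff (hPμ j)).2 (hφμ j))
      ((integrable_rnDeriv_smul_iff (hPν j)).2 (hφν j)), integral_rnDeriv_smul (hPμ j),
      integral_rnDeriv_smul (hPν j)]
  · exact fun j _ => ((integrable_rnDeriv_smul_iff (hPμ j)).2 (hφμ j)).sub
      ((integrable_rnDeriv_smul_iff (hPν j)).2 (hφν j))

end RadonVectorMeasure

/-! ### Existence of the horizontal derivative of the subgraph. -/

section SubgraphDerivative

variable {E : Type*} [NormedAddCommGroup E] [NormedSpace ℝ E] [FiniteDimensional ℝ E]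
  [MeasureSpace E] [BorelSpace E] [(volume : Measure E).IsAddHaarMeasure]

theorem subgraph_ae_eq {Ω : Set E} (hΩ : MeasurableSet Ω) {u w : E → ℝ}
    (huw : u =ᵐ[volume.restrict Ω] w) :
    subgraph Ω u =ᵐ[(volume : Measure (E × ℝ))] ((Ω ×ˢ univ) ∩ {p : E × ℝ | p.2 < w p.1} : Set (E × ℝ)) := by
  have := FiniteDimensional.proper_real E
  have h1 : ∀ᵐ p : E × ℝ, p.1 ∈ Ω → u p.1 = w p.1 :=
    Measure.quasiMeasurePreserving_fst.ae ((ae_restrict_iff' hΩ).1 huw)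
  filter_upwards [h1] with p hp
  refine propext ?_
  change (p.1 ∈ Ω ∧ p.2 < u p.1) ↔ ((p.1 ∈ Ω ∧ True) ∧ p.2 < w p.1)
  constructor
  · rintro ⟨h, h2⟩
    exact ⟨⟨h, trivial⟩, hp h ▸ h2⟩
  · rintro ⟨⟨h, -⟩, h2⟩
    exact ⟨h, (hp h).symm ▸ h2⟩

theorem locallyIntegrable_indicator_subgraph {Ω : Set E} (hΩ : MeasurableSet Ω) {u w : E → ℝ}
    (huw : u =ᵐ[volume.restrict Ω] w) (hw : Measurable w) :
    LocallyIntegrable ((subgraph Ω u).indicator fun _ => (1 : ℝ))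
      (volume : Measure (E × ℝ)) := by
  have := FiniteDimensional.proper_real E
  have hm : NullMeasurableSet (subgraph Ω u) (volume : Measure (E × ℝ)) :=
    ((hΩ.prod MeasurableSet.univ).inter (measurableSet_lt_graph hw)).nullMeasurableSet.congr
      (subgraph_ae_eq hΩ huw).symm
  refine (locallyIntegrable_const (1 : ℝ)).mono
    (aestronglyMeasurable_const.indicator₀ hm) (Eventually.of_forall fun p => ?_)
  by_cases hp : p ∈ subgraph Ω u <;> simp [hp]

theorem integral_indicator_subgraph_mul {Ω : Set E} (hΩ : MeasurableSet Ω) {u w : E → ℝ}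
    (huw : u =ᵐ[volume.restrict Ω] w) (hw : Measurable w) {H : E × ℝ → ℝ}
    (hH : ∀ p : E × ℝ, p ∉ Ω ×ˢ (univ : Set ℝ) → H p = 0) :
    ∫ p in Ω ×ˢ univ, (subgraph Ω u).indicator (fun _ => (1 : ℝ)) p * H p =
      ∫ p in {p : E × ℝ | p.2 < w p.1}, H p := by
  rw [setIntegral_eq_integral_of_forall_compl_eq_zero fun p hp => by rw [hH p hp, mul_zero],
    ← integral_indicator (measurableSet_lt_graph hw)]
  refine integral_congr_ae ?_
  filter_upwards [subgraph_ae_eq hΩ huw] with p hp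
  have hp' : p ∈ subgraph Ω u ↔ p ∈ ((Ω ×ˢ univ) ∩ {p : E × ℝ | p.2 < w p.1} : Set (E × ℝ)) := iff_of_eq hp
  by_cases hΩp : p ∈ Ω ×ˢ (univ : Set ℝ)
  · by_cases h2 : p.2 < w p.1
    · rw [indicator_of_mem (hp'.2 ⟨hΩp, h2⟩),
        indicator_of_mem (show p ∈ {p : E × ℝ | p.2 < w p.1} from h2), one_mul]
    · rw [indicator_of_notMem fun h => h2 (hp'.1 h).2,
        indicator_of_notMem (show p ∉ {p : E × ℝ | p.2 < w p.1} from h2), zero_mul]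
  · simp [hH p hΩp, indicator]

variable {m : ℕ} {X : Fin m → E → E} {Ω : Set E} {u w : E → ℝ} {M : Measure E}
  {τ : E → EuclideanSpace ℝ (Fin (m + 1))}

/-- Replaces `u` by a measurable representative `w`, which changes the subgraph by a null set. The
test fields are supported in Ω × ℝ, so the values of `w` off `Ω` play no role. -/
theorem isHDerivative_subgraph_iff (hΩ : MeasurableSet Ω) (huw : u =ᵐ[volume.restrict Ω] w)
    (hw : Measurable w)
    (D : RadonVectorMeasure (Ω ×ˢ (univ : Set ℝ)) (EuclideanSpace ℝ (Fin (m + 1)))) :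
    IsHDerivative (extendedFields X) (Ω ×ˢ univ)
        ((subgraph Ω u).indicator (fun _ => (1 : ℝ))) D ↔
      ∀ φ : E × ℝ → EuclideanSpace ℝ (Fin (m + 1)), ContDiff ℝ 1 φ →
        ∀ (hc : HasCompactSupport φ) (hs : tsupport φ ⊆ Ω ×ˢ univ),
          (D.onCompact (tsupport φ) hc hs).integral φ (innerSL ℝ) =
            -∫ p in {p : E × ℝ | p.2 < w p.1}, divX (extendedFields X) φ p := by
  refine forall_congr' fun φ => forall_congr' fun _ => forall_congr' fun hc =>
    forall_congr' fun hs => ?_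
  rw [integral_indicator_subgraph_mul hΩ huw hw fun p hp => divX_eq_zero fun h => hp (hs h)]

/-- The positive and negative parts of each component of the mollified graph gradients have weak
limits on the graphs. The vector measure built from their differences represents the limit of the C¹
formula. -/
theorem IsGraphMeasure.exists_isHDerivative (h : IsGraphMeasure X Ω w M τ) (hΩ : IsOpen Ω)
    (hX : ∀ i, ContDiff ℝ 1 (X i)) (hw : Integrable w) (hwm : Measurable w) :
    ∃ D : RadonVectorMeasure (Ω ×ˢ (univ : Set ℝ)) (EuclideanSpace ℝ (Fin (m + 1))),
      ∀ φ : E × ℝ → EuclideanSpace ℝ (Fin (m + 1)), ContDiff ℝ 1 φ →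
        ∀ (hc : HasCompactSupport φ) (hs : tsupport φ ⊆ Ω ×ˢ univ),
          (D.onCompact (tsupport φ) hc hs).integral φ (innerSL ℝ) =
            -∫ p in {p : E × ℝ | p.2 < w p.1}, divX (extendedFields X) φ p := by
  have := FiniteDimensional.proper_real E
  have : SecondCountableTopology E := inferInstance
  obtain ⟨ρ, hρ⟩ := exists_isMollifier (E := E)
  have hε0 : ∀ k : ℕ, 0 < ((k : ℝ) + 1)⁻¹ := fun k => by positivity
  set v : ℕ → E → ℝ := fun k => mollify ρ ((k : ℝ) + 1)⁻¹ w
  have hv : ∀ k, ContDiff ℝ 1 (v k) := fun k => hρ.contDiff_mollify (hε0 k) hw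
  have hb := fun (g : E → ℝ) (hg : IsCompactlySupportedIn Ω g) (δ : ℝ≥0∞) (hδ : 0 < δ) =>
    h.eventually_lintegral_le hΩ hρ hX hw hwm hε0 inv_add_one_le_one tendsto_inv_add_one
      hg.continuous hg.hasCompactSupport hg.tsupport_subset hδ
  have hgc : ∀ k j, Continuous fun x => graphGradient X (v k) x j := fun k j => by
    have := continuous_graphGradient hX (hv k)
    fun_prop
  -- One ultrafilter serves all components and both signs, so the limits can be recombined.
  have hF : (Ultrafilter.of (atTop : Filter ℕ) : Filter ℕ) ≤ atTop := Ultrafilter.of_le _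
  have hle : ∀ k x j (c : ℝ), |c| ≤ |graphGradient X (v k) x j| →
      ‖c‖ₑ ≤ ‖graphGradient X (v k) x‖ₑ := fun k x j c hc => by
    rw [← ofReal_norm, ← ofReal_norm]
    exact ENNReal.ofReal_le_ofReal (hc.trans (PiLp.norm_apply_le (graphGradient X (v k) x) j))
  choose μ hμs _ hμf hμ using fun j => exists_graph_limit_measure hΩ h.lt_top
    (fun k => (hv k).continuous) hb hF (fun k => (hgc k j).max continuous_const)
    (fun k x => le_max_right (graphGradient X (v k) x j) 0) (fun k x => hle k x j _ (by
      rw [abs_of_nonneg (le_max_right _ _)]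
      exact max_le (le_abs_self _) (abs_nonneg _)))
  choose ν hνs _ hνf hν using fun j => exists_graph_limit_measure hΩ h.lt_top
    (fun k => (hv k).continuous) hb hF (fun k => (hgc k j).neg.max continuous_const)
    (fun k x => le_max_right (-graphGradient X (v k) x j) 0) (fun k x => hle k x j _ (by
      rw [abs_of_nonneg (le_max_right _ _)]
      exact max_le (neg_le_abs _) (abs_nonneg _)))
  obtain ⟨D, hD⟩ := RadonVectorMeasure.exists_integral_eq_sum_sub μ ν hμf hνf
  refine ⟨D, fun φ hφ hc hs => ?_⟩
  have hφc : IsCompactlySupportedIn (Ω ×ˢ univ) φ := ⟨hφ.continuous, hc, hs⟩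
  rw [hD φ hφc hc hs]
  have h1 := (hρ.tendsto_integral_graphGradient hX hw hwm hε0
    tendsto_inv_add_one hφ hc).mono_left hF
  refine tendsto_nhds_unique ?_ h1
  refine (tendsto_finsetSum Finset.univ fun j _ =>
    (hμ j _ (hφc.apply j)).sub (hν j _ (hφc.apply j))).congr fun k => ?_
  have hi1 : ∀ j, Integrable fun x => φ (x, v k x) j * max (graphGradient X (v k) x j) 0 :=
    fun j => integrable_graph_mul (hφc.apply j) (hv k).continuous
      ((hgc k j).max continuous_const)
  have hi2 : ∀ j, Integrable fun x => φ (x, v k x) j * max (-graphGradient X (v k) x j) 0 :=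
    fun j => integrable_graph_mul (hφc.apply j) (hv k).continuous
      ((hgc k j).neg.max continuous_const)
  refine (Finset.sum_congr rfl fun j _ => (integral_sub (hi1 j) (hi2 j)).symm).trans ?_
  refine (integral_finsetSum _ fun j _ => (hi1 j).sub (hi2 j)).symm.trans ?_
  refine integral_congr_ae (Eventually.of_forall fun x => ?_)
  simp only
  rw [PiLp.inner_apply]
  refine Finset.sum_congr rfl fun j _ => ?_
  simp only [Pi.sub_apply]
  rw [← mul_sub, max_zero_sub_max_neg_zero_eq_self]
  exact mul_comm _ _

end SubgraphDerivative

/-! ### Approximation of bounded functions by C¹ test functions. -/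

section Approximation

variable {Z : Type*} [NormedAddCommGroup Z] [NormedSpace ℝ Z] [FiniteDimensional ℝ Z]
  {V : Type*} [NormedAddCommGroup V] [NormedSpace ℝ V]

theorem exists_contDiff_cutoff {K U : Set Z} (hK : IsCompact K) (hU : IsOpen U) (hKU : K ⊆ U) :
    ∃ χ : Z → ℝ, ContDiff ℝ ∞ χ ∧ IsCompactlySupportedIn U χ ∧ (∀ z ∈ K, χ z = 1) ∧
      ∀ z, 0 ≤ χ z ∧ χ z ≤ 1 := by
  have := FiniteDimensional.proper_real Z
  obtain ⟨K', hK', hKK', hK'U⟩ := exists_compact_between hK hU hKU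
  obtain ⟨χ, h0, h1, h01⟩ := exists_contMDiffMap_zero_one_of_isClosed (n := ⊤)
    (modelWithCornersSelf ℝ Z) (isOpen_interior (s := K')).isClosed_compl hK.isClosed
    (disjoint_compl_left_iff_subset.2 hKK')
  have hχ : ContDiff ℝ ∞ χ := contMDiff_iff_contDiff.1 χ.contMDiff
  have hs : tsupport χ ⊆ K' := by
    refine closure_minimal (fun x hx => ?_) hK'.isClosed
    by_contra hn
    exact hx (h0 fun h => hn (interior_subset h))
  exact ⟨χ, hχ, ⟨hχ.continuous, hK'.of_isClosed_subset (isClosed_tsupport _) hs, hs.trans hK'U⟩,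
    fun z hz => h1 hz, fun z => h01 z⟩

variable [MeasurableSpace Z] [BorelSpace Z]

/-- Bounded functions supported in a compact subset of `U` are limits in `L¹` of `C¹` functions
with compact support in `U`. -/
theorem exists_tendsto_contDiff {U K : Set Z} (hU : IsOpen U) {P : Measure Z}
    (hP : ∀ K, IsCompact K → K ⊆ U → P K < ⊤) (hK : IsCompact K) (hKU : K ⊆ U)
    {h : Z → V} (hm : StronglyMeasurable h) {C : ℝ} (hC : ∀ z, ‖h z‖ ≤ C)
    (h0 : ∀ z, z ∉ K → h z = 0) :
    ∃ φ : ℕ → Z → V, (∀ k, ContDiff ℝ 1 (φ k)) ∧ (∀ k, IsCompactlySupportedIn U (φ k)) ∧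
      Tendsto (fun k => ∫⁻ z, ‖φ k z - h z‖ₑ ∂P) atTop (𝓝 0) := by
  obtain ⟨χ, hχ, hχc, hχ1, hχ01⟩ := exists_contDiff_cutoff hK hU hKU
  have hfin : IsFiniteMeasure (P.restrict (tsupport χ)) :=
    ⟨by simpa using hP _ hχc.hasCompactSupport hχc.tsupport_subset⟩
  have hmem : MemLp h 1 (P.restrict (tsupport χ)) :=
    MemLp.of_bound hm.aestronglyMeasurable C (Eventually.of_forall hC)
  choose g _ hg2 hg3 using fun k : ℕ =>
    hmem.exist_eLpNorm_sub_le ENNReal.one_ne_top le_rfl (ε := ((k : ℝ) + 1)⁻¹) (by positivity)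
  -- Multiplication by χ moves the support into `U` and does not increase the L¹ error, since h = χ
  -- h and 0 ≤ χ ≤ 1.
  refine ⟨fun k z => χ z • g k z, fun k =>
    (hχ.of_le (mod_cast le_top)).smul ((hg2 k).of_le (mod_cast le_top)), fun k => ?_, ?_⟩
  · exact ⟨hχc.continuous.smul (hg2 k).continuous, hχc.hasCompactSupport.smul_right,
      (tsupport_smul_subset_left _ _).trans hχc.tsupport_subset⟩
  · have h1 : Tendsto (fun k : ℕ => ENNReal.ofReal ((k : ℝ) + 1)⁻¹) atTop (𝓝 0) := by
      simpa using ENNReal.tendsto_ofReal tendsto_inv_add_one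
    refine tendsto_of_tendsto_of_tendsto_of_le_of_le tendsto_const_nhds h1 (fun _ => zero_le)
      fun k => ?_
    refine le_trans ?_ (hg3 k)
    rw [eLpNorm_one_eq_lintegral_enorm, ← lintegral_indicator (isClosed_tsupport χ).measurableSet]
    refine lintegral_mono fun z => ?_
    have hhz : h z = χ z • h z := by
      by_cases hz : z ∈ K
      · rw [hχ1 z hz, one_smul]
      · rw [h0 z hz, smul_zero]
    by_cases hz : z ∈ tsupport χ
    · have h2 : χ z • g k z - h z = χ z • (g k z - h z) := by rw [smul_sub, ← hhz]
      rw [indicator_of_mem hz, h2, enorm_smul, Pi.sub_apply, enorm_sub_rev (h z)]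
      refine mul_le_of_le_one_left zero_le ?_
      rw [← ofReal_norm, Real.norm_of_nonneg (hχ01 z).1]
      exact ENNReal.ofReal_le_one.2 (hχ01 z).2
    · rw [image_eq_zero_of_notMem_tsupport hz, zero_smul] at hhz
      simp [hhz, image_eq_zero_of_notMem_tsupport hz]

end Approximation

/-! ### Comparing measures through test functions. -/

section TotalVariation

variable {Z : Type*} [NormedAddCommGroup Z] [NormedSpace ℝ Z] [FiniteDimensional ℝ Z]
  [MeasurableSpace Z] [BorelSpace Z]
  {V : Type*} [NormedAddCommGroup V] [InnerProductSpace ℝ V] [FiniteDimensional ℝ V]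
  [MeasurableSpace V] [BorelSpace V]

/-- Convergence is assumed in L¹ of a larger measure `P`, so that a single approximating sequence
can be used for several measures below `P`. -/
theorem tendsto_integral_inner {P Q : Measure Z} (hQP : Q ≤ P) {ν : Z → V}
    (hν : Measurable ν) (hν1 : ∀ z, ‖ν z‖ ≤ 1) {h : Z → V} (hh : Integrable h Q)
    {φ : ℕ → Z → V} (hφ : ∀ k, Integrable (φ k) Q)
    (hφh : Tendsto (fun k => ∫⁻ z, ‖φ k z - h z‖ₑ ∂P) atTop (𝓝 0)) :
    Tendsto (fun k => ∫ z, inner ℝ (φ k z) (ν z) ∂Q) atTop (𝓝 (∫ z, inner ℝ (h z) (ν z) ∂Q)) := by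
  have hi : ∀ {f : Z → V}, Integrable f Q → Integrable (fun z => inner ℝ (f z) (ν z)) Q :=
    fun {f} hf => hf.mono (hf.aestronglyMeasurable.inner hν.aestronglyMeasurable)
      (Eventually.of_forall fun z => (norm_inner_le_norm _ _).trans
        (mul_le_of_le_one_right (norm_nonneg _) (hν1 z)))
  refine tendsto_integral_of_L1 _ (hi hh).aestronglyMeasurable
    (Eventually.of_forall fun k => hi (hφ k)) ?_
  refine tendsto_of_tendsto_of_tendsto_of_le_of_le tendsto_const_nhds hφh (fun _ => zero_le)
    fun k => ?_
  refine (lintegral_mono fun z => ?_).trans (lintegral_mono' hQP le_rfl)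
  rw [← inner_sub_left, ← ofReal_norm, ← ofReal_norm]
  exact ENNReal.ofReal_le_ofReal ((norm_inner_le_norm _ _).trans
    (mul_le_of_le_one_right (norm_nonneg _) (hν1 z)))

/-- If `∫ φ · ν dQ ≤ ∫ |φ| dμ` for all test functions, where `|ν| = 1`, then `Q ≤ μ` on compact
sets. -/
theorem measure_le_of_integral_inner_le {U : Set Z} (hU : IsOpen U) {Q μ : Measure Z}
    (hQ : ∀ K, IsCompact K → K ⊆ U → Q K < ⊤) (hμ : ∀ K, IsCompact K → K ⊆ U → μ K < ⊤)
    {ν : Z → V} (hν : Measurable ν) (hν1 : ∀ z, ‖ν z‖ ≤ 1) (hν2 : ∀ᵐ z ∂Q, ‖ν z‖ = 1)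
    (hle : ∀ φ : Z → V, ContDiff ℝ 1 φ → IsCompactlySupportedIn U φ →
      ∫ z, inner ℝ (φ z) (ν z) ∂Q ≤ ∫ z, ‖φ z‖ ∂μ)
    {K : Set Z} (hK : IsCompact K) (hKU : K ⊆ U) : Q K ≤ μ K := by
  have := FiniteDimensional.proper_real Z
  have hm : Measurable (K.indicator ν) := hν.indicator hK.measurableSet
  have hb : ∀ z, ‖K.indicator ν z‖ ≤ 1 := fun z =>
    (norm_indicator_le_norm_self _ _).trans (hν1 z)
  -- The optimal test field is `ν` on `K` and zero elsewhere: it turns the left side into Q(K) and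
  -- the right side into at most μ(K). It is approximated in L¹ of both measures at once.
  obtain ⟨φ, hφ, hφc, hφt⟩ := exists_tendsto_contDiff (P := Q + μ) hU
    (fun K hK hKU => ENNReal.add_lt_top.2 ⟨hQ K hK hKU, hμ K hK hKU⟩) hK hKU
    hm.stronglyMeasurable hb fun z hz => indicator_of_notMem hz ν
  have hint : ∀ {R : Measure Z}, R K < ⊤ → Integrable (K.indicator ν) R := fun {R} hR =>
    (integrable_indicator_iff hK.measurableSet).2 (Measure.integrableOn_of_bounded (M := 1) hR.ne
      hν.aestronglyMeasurable (Eventually.of_forall hν1))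
  have h1 := tendsto_integral_inner (P := Q + μ) (Measure.le_add_right le_rfl) hν hν1
    (hint (hQ K hK hKU)) (fun k => (hφc k).integrable hQ) hφt
  have h2 : Tendsto (fun k => ∫ z, ‖φ k z‖ ∂μ) atTop (𝓝 (∫ z, ‖K.indicator ν z‖ ∂μ)) := by
    refine tendsto_integral_of_L1 _ (hint (hμ K hK hKU)).norm.aestronglyMeasurable
      (Eventually.of_forall fun k => ((hφc k).integrable hμ).norm) ?_
    refine tendsto_of_tendsto_of_tendsto_of_le_of_le tendsto_const_nhds hφt (fun _ => zero_le)
      fun k => (lintegral_mono fun z => ?_).trans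
        (lintegral_mono' (Measure.le_add_left le_rfl) le_rfl)
    rw [← ofReal_norm, ← ofReal_norm]
    exact ENNReal.ofReal_le_ofReal (abs_norm_sub_norm_le _ _)
  have h3 := le_of_tendsto_of_tendsto h1 h2 (Eventually.of_forall fun k => hle _ (hφ k) (hφc k))
  have h4 : ∫ z, inner ℝ (K.indicator ν z) (ν z) ∂Q = Q.real K := by
    rw [← integral_indicator_one hK.measurableSet]
    refine integral_congr_ae ?_
    filter_upwards [hν2] with z hz
    by_cases hzK : z ∈ K
    · simp [hzK, hz]
    · simp [hzK]
  have h5 : ∫ z, ‖K.indicator ν z‖ ∂μ ≤ μ.real K := by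
    rw [← integral_indicator_one hK.measurableSet]
    refine integral_mono (hint (hμ K hK hKU)).norm ((integrable_indicator_iff
      hK.measurableSet).2 (integrableOn_const (hμ K hK hKU).ne)) fun z => ?_
    by_cases hzK : z ∈ K
    · simpa [hzK] using hν1 z
    · simp [hzK]
  rw [h4] at h3
  exact (ENNReal.toReal_le_toReal (hQ K hK hKU).ne (hμ K hK hKU).ne).1 (h3.trans h5)

end TotalVariation

/-! ### Test fields of the form η(t) g(x). -/

section VerticalCutoff

variable {E : Type*} [NormedAddCommGroup E] [NormedSpace ℝ E] [FiniteDimensional ℝ E]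
  {m : ℕ} {X : Fin m → E → E}

theorem fderiv_mul_snd {a : E → ℝ} {η : ℝ → ℝ} {x : E} {t : ℝ} (ha : DifferentiableAt ℝ a x)
    (hη : DifferentiableAt ℝ η t) (y : E) (s : ℝ) :
    fderiv ℝ (fun q : E × ℝ => η q.2 * a q.1) (x, t) (y, s) =
      η t * fderiv ℝ a x y + a x * (s * deriv η t) := by
  have h1 : HasFDerivAt (fun q : E × ℝ => a q.1)
      ((fderiv ℝ a x).comp (ContinuousLinearMap.fst ℝ E ℝ)) (x, t) :=
    HasFDerivAt.comp (x, t) (f := Prod.fst) (g := a) ha.hasFDerivAt hasFDerivAt_fst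
  have h2 : HasFDerivAt (fun q : E × ℝ => η q.2)
      ((fderiv ℝ η t).comp (ContinuousLinearMap.snd ℝ E ℝ)) (x, t) :=
    HasFDerivAt.comp (x, t) (f := Prod.snd) (g := η) hη.hasFDerivAt hasFDerivAt_snd
  have h4 := (h2.fun_mul h1).fderiv
  rw [h4]
  have h3 : fderiv ℝ η t s = s * deriv η t := by
    rw [← fderiv_apply_one_eq_deriv, ← smul_eq_mul, ← map_smul, smul_eq_mul, mul_one]
  simp [h3]

theorem divX_extendedFields_smul (hX : ∀ i, ContDiff ℝ 1 (X i))
    {g : E → EuclideanSpace ℝ (Fin (m + 1))} (hg : ContDiff ℝ 1 g) {η : ℝ → ℝ}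
    (hη : ContDiff ℝ 1 η) (x : E) (t : ℝ) :
    divX (extendedFields X) (fun p => η p.2 • g p.1) (x, t) =
      horizontalDiv X g x * η t + g x (Fin.last m) * deriv η t := by
  have hφ : ContDiff ℝ 1 fun p : E × ℝ => η p.2 • g p.1 :=
    (hη.comp contDiff_snd).smul (hg.comp contDiff_fst)
  have hgj : ∀ j, DifferentiableAt ℝ (fun y => g y j) x := fun j => by
    have : ContDiff ℝ 1 fun y => g y j := by fun_prop
    exact this.differentiable one_ne_zero x
  have hηt := hη.differentiable one_ne_zero t
  rw [divX_extendedFields hX hφ]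
  simp only [PiLp.smul_apply, smul_eq_mul, horizontalDiv]
  rw [Finset.sum_mul]
  congr 1
  · refine Finset.sum_congr rfl fun i _ => ?_
    rw [fieldDiv_smul (hgj _) ((hX i).differentiable one_ne_zero x), fderiv_mul_snd (hgj _) hηt]
    ring
  · rw [fderiv_mul_snd (hgj _) hηt]
    simp

theorem horizontalDiv_eq_zero {g : E → EuclideanSpace ℝ (Fin (m + 1))} {x : E}
    (hx : x ∉ tsupport g) : horizontalDiv X g x = 0 := by
  refine Finset.sum_eq_zero fun i _ => ?_
  have : (fun y => g y i.castSucc • X i y) =ᶠ[𝓝 x] fun _ => 0 := by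
    filter_upwards [(isClosed_tsupport g).isOpen_compl.mem_nhds hx] with y hy
    simp [image_eq_zero_of_notMem_tsupport hy]
  simp [fieldDiv, this.fderiv_eq]

variable {g : E → EuclideanSpace ℝ (Fin (m + 1))}

theorem contDiff_apply_smul (hX : ∀ i, ContDiff ℝ 1 (X i)) (hg : ContDiff ℝ 1 g) (i : Fin m) :
    ContDiff ℝ 1 fun y => g y i.castSucc • X i y := by
  have : ContDiff ℝ 1 fun y => g y i.castSucc := by fun_prop
  exact this.smul (hX i)

theorem continuous_horizontalDiv (hX : ∀ i, ContDiff ℝ 1 (X i)) (hg : ContDiff ℝ 1 g) :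
    Continuous (horizontalDiv X g) :=
  continuous_finsetSum _ fun i _ => continuous_fieldDiv (contDiff_apply_smul hX hg i)

theorem hasCompactSupport_horizontalDiv (hc : HasCompactSupport g) :
    HasCompactSupport (horizontalDiv X g) :=
  HasCompactSupport.intro hc fun _ hx => horizontalDiv_eq_zero hx

variable [MeasureSpace E] [BorelSpace E] [(volume : Measure E).IsAddHaarMeasure]

theorem integral_horizontalDiv_eq_zero (hX : ∀ i, ContDiff ℝ 1 (X i)) (hg : ContDiff ℝ 1 g)
    (hc : HasCompactSupport g) : ∫ x, horizontalDiv X g x = 0 := by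
  have hc' : ∀ i : Fin m, HasCompactSupport fun y => g y i.castSucc • X i y := fun i =>
    HasCompactSupport.intro hc fun x hx => by simp [image_eq_zero_of_notMem_tsupport hx]
  have hi : ∀ i : Fin m, Integrable (fieldDiv fun y => g y i.castSucc • X i y) := fun i => by
    refine (continuous_fieldDiv (contDiff_apply_smul hX hg i)).integrable_of_hasCompactSupport ?_
    refine HasCompactSupport.intro (hc' i) fun x hx => ?_
    simp [fieldDiv, fderiv_of_notMem_tsupport ℝ hx]
  simp only [horizontalDiv]
  rw [integral_finsetSum _ fun i _ => hi i]
  exact Finset.sum_eq_zero fun i _ =>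
    integral_fieldDiv_eq_zero (contDiff_apply_smul hX hg i) (hc' i)

/-- Vertical integration replaces η by its primitive from -∞ at `w x`. The part over (-∞, 0) is a
constant times the horizontal divergence, whose integral is zero. What remains is a primitive
starting at 0, bounded by |w x| independently of the support of η. -/
theorem integral_lt_graph_divX_smul (hX : ∀ i, ContDiff ℝ 1 (X i)) (hg : ContDiff ℝ 1 g)
    (hc : HasCompactSupport g) {η : ℝ → ℝ} (hη : ContDiff ℝ 1 η) (hηc : HasCompactSupport η)
    (hη1 : ∀ t, |η t| ≤ 1) {w : E → ℝ} (hwm : Measurable w) (hw : Integrable w) :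
    ∫ p in {p : E × ℝ | p.2 < w p.1}, divX (extendedFields X) (fun p => η p.2 • g p.1) p =
      ∫ x, (horizontalDiv X g x * (∫ t in (0 : ℝ)..w x, η t) + g x (Fin.last m) * η (w x)) := by
  have := FiniteDimensional.proper_real E
  have hφ : ContDiff ℝ 1 fun p : E × ℝ => η p.2 • g p.1 :=
    (hη.comp contDiff_snd).smul (hg.comp contDiff_fst)
  have hφc : HasCompactSupport fun p : E × ℝ => η p.2 • g p.1 :=
    HasCompactSupport.intro (hc.isCompact.prod hηc.isCompact) fun p hp => by
      by_cases h1 : p.1 ∈ tsupport g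
      · have h2 : p.2 ∉ tsupport η := fun h2 => hp ⟨h1, h2⟩
        simp [image_eq_zero_of_notMem_tsupport h2]
      · simp [image_eq_zero_of_notMem_tsupport h1]
  have hηi : Integrable η := hη.continuous.integrable_of_hasCompactSupport hηc
  have hdi : Integrable (deriv η) :=
    (hη.continuous_deriv le_rfl).integrable_of_hasCompactSupport hηc.deriv
  rw [integral_lt_graph hwm ((continuous_divX (contDiff_extendedFields hX) hφ
    ).integrable_of_hasCompactSupport (hasCompactSupport_divX hφc))]
  have hinner : ∀ x, ∫ t in Iio (w x), divX (extendedFields X) (fun p => η p.2 • g p.1) (x, t) =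
      horizontalDiv X g x * (∫ t in Iio 0, η t) +
        (horizontalDiv X g x * (∫ t in (0 : ℝ)..w x, η t) + g x (Fin.last m) * η (w x)) := by
    intro x
    simp_rw [divX_extendedFields_smul hX hg hη]
    rw [integral_add (hηi.integrableOn.const_mul _) (hdi.integrableOn.const_mul _),
      integral_const_mul, integral_const_mul, ← integral_Iic_eq_integral_Iio,
      ← integral_Iic_eq_integral_Iio, ← integral_Iic_eq_integral_Iio,
      hηc.integral_Iic_deriv_eq hη, ← intervalIntegral.integral_Iic_sub_Iic
        hηi.integrableOn hηi.integrableOn]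
    ring
  simp_rw [hinner]
  have hgl : Continuous fun x => g x (Fin.last m) := by
    have := hg.continuous
    fun_prop
  have hglc : HasCompactSupport fun x => g x (Fin.last m) :=
    HasCompactSupport.intro hc fun x hx => by simp [image_eq_zero_of_notMem_tsupport hx]
  have hhd := continuous_horizontalDiv hX hg
  have hhdc := hasCompactSupport_horizontalDiv (X := X) hc
  obtain ⟨C, hC⟩ := hhd.bounded_above_of_compact_support hhdc
  rw [integral_add ((hhd.integrable_of_hasCompactSupport hhdc).mul_const _),
    integral_mul_const, integral_horizontalDiv_eq_zero hX hg hc, zero_mul, zero_add]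
  have hprim : Continuous fun s => ∫ t in (0 : ℝ)..s, η t :=
    intervalIntegral.continuous_primitive (fun a b => hη.continuous.intervalIntegrable a b) 0
  refine Integrable.add ?_ ?_
  · refine (hw.norm.const_mul C).mono
      (hhd.measurable.mul (hprim.measurable.comp hwm)).aestronglyMeasurable
      (Eventually.of_forall fun x => ?_)
    have h1 := intervalIntegral.norm_integral_le_of_norm_le_const (a := 0) (b := w x)
      (f := η) (C := 1) fun t _ => hη1 t
    rw [norm_mul, norm_mul, norm_norm]
    refine mul_le_mul ((hC x).trans (le_abs_self C)) ?_ (norm_nonneg _) (norm_nonneg _)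
    simpa using h1
  · refine (hgl.integrable_of_hasCompactSupport hglc).mono
      (hgl.measurable.mul (hη.continuous.measurable.comp hwm)).aestronglyMeasurable
      (Eventually.of_forall fun x => ?_)
    rw [norm_mul]
    exact mul_le_of_le_one_right (norm_nonneg _) (hη1 _)

end VerticalCutoff

/-! ### Rigidity: the derivative of the subgraph projects onto (D_H w, -ℒⁿ). -/

section Projection

theorem exists_vertical_cutoff : ∃ η : ℕ → ℝ → ℝ, (∀ k, ContDiff ℝ 1 (η k)) ∧
    (∀ k, HasCompactSupport (η k)) ∧ (∀ k t, |η k t| ≤ 1) ∧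
    ∀ r : ℝ, ∀ᶠ k in atTop, ∀ t, |t| ≤ r → η k t = 1 := by
  choose η hη hηc hη1 hη01 using fun k : ℕ =>
    exists_contDiff_cutoff (Z := ℝ) (isCompact_Icc (a := -(k : ℝ)) (b := k)) isOpen_univ
      (subset_univ _)
  refine ⟨η, fun k => (hη k).of_le (mod_cast le_top), fun k => (hηc k).hasCompactSupport,
    fun k t => ?_, fun r => ?_⟩
  · rw [abs_of_nonneg (hη01 k t).1]
    exact (hη01 k t).2
  · obtain ⟨j, hj⟩ := exists_nat_ge r
    filter_upwards [eventually_ge_atTop j] with k hk t ht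
    exact hη1 k t (abs_le.1 (ht.trans (hj.trans (by exact_mod_cast hk))))

variable {E : Type*} [NormedAddCommGroup E] [NormedSpace ℝ E] [FiniteDimensional ℝ E]
  [MeasureSpace E] [BorelSpace E] [(volume : Measure E).IsAddHaarMeasure]
  {m : ℕ} {X : Fin m → E → E} {Ω : Set E} {w : E → ℝ} {M : Measure E}
  {τ : E → EuclideanSpace ℝ (Fin (m + 1))} {g : E → EuclideanSpace ℝ (Fin (m + 1))}

/-- Since |η| ≤ 1, the primitives starting at 0 are at most |w|, which gives a majorant independent
of `k`; at each `x` the integrand equals its limit once η is 1 on [-|w x|, |w x|]. -/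
theorem tendsto_integral_lt_graph_divX_smul (hX : ∀ i, ContDiff ℝ 1 (X i)) (hg : ContDiff ℝ 1 g)
    (hc : HasCompactSupport g) (hwm : Measurable w) (hw : Integrable w) {η : ℕ → ℝ → ℝ}
    (hη : ∀ k, ContDiff ℝ 1 (η k)) (hηc : ∀ k, HasCompactSupport (η k))
    (hη1 : ∀ k t, |η k t| ≤ 1) (hηt : ∀ r : ℝ, ∀ᶠ k in atTop, ∀ t, |t| ≤ r → η k t = 1) :
    Tendsto (fun k => ∫ p in {p : E × ℝ | p.2 < w p.1},
        divX (extendedFields X) (fun p => η k p.2 • g p.1) p) atTop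
      (𝓝 ((∫ x, w x * horizontalDiv X g x) + ∫ x, g x (Fin.last m))) := by
  have := FiniteDimensional.proper_real E
  have hgl : Continuous fun x => g x (Fin.last m) := by
    have := hg.continuous
    fun_prop
  have hglc : HasCompactSupport fun x => g x (Fin.last m) :=
    HasCompactSupport.intro hc fun x hx => by simp [image_eq_zero_of_notMem_tsupport hx]
  have hgli := hgl.integrable_of_hasCompactSupport (μ := volume) hglc
  have hhd := continuous_horizontalDiv hX hg
  obtain ⟨C, hC⟩ := hhd.bounded_above_of_compact_support
    (hasCompactSupport_horizontalDiv (X := X) hc)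
  have hwi : Integrable fun x => w x * horizontalDiv X g x :=
    hw.mul_bdd hhd.measurable.aestronglyMeasurable (Eventually.of_forall hC)
  rw [← integral_add hwi hgli]
  simp_rw [fun k => integral_lt_graph_divX_smul hX hg hc (hη k) (hηc k) (hη1 k) hwm hw]
  refine tendsto_integral_of_dominated_convergence
    (fun x => C * ‖w x‖ + ‖g x (Fin.last m)‖) (fun k => ?_)
    ((hw.norm.const_mul C).add hgli.norm) (fun k => Eventually.of_forall fun x => ?_)
    (Eventually.of_forall fun x => ?_)
  · have hprim : Continuous fun s => ∫ t in (0 : ℝ)..s, η k t :=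
      intervalIntegral.continuous_primitive
        (fun a b => (hη k).continuous.intervalIntegrable a b) 0
    exact ((hhd.measurable.mul (hprim.measurable.comp hwm)).add
      (hgl.measurable.mul ((hη k).continuous.measurable.comp hwm))).aestronglyMeasurable
  · have h1 := intervalIntegral.norm_integral_le_of_norm_le_const (a := 0) (b := w x)
      (f := η k) (C := 1) fun t _ => hη1 k t
    rw [one_mul, sub_zero] at h1
    refine (norm_add_le _ _).trans (add_le_add ?_ ?_)
    · rw [norm_mul]
      exact mul_le_mul (hC x) h1 (norm_nonneg _) ((norm_nonneg _).trans (hC x))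
    · rw [norm_mul]
      exact mul_le_of_le_one_right (norm_nonneg _) (hη1 k _)
  · refine tendsto_const_nhds.congr' ?_
    filter_upwards [hηt |w x|] with k hk
    have h1 : ∫ t in (0 : ℝ)..w x, η k t = ∫ t in (0 : ℝ)..w x, (1 : ℝ) := by
      refine intervalIntegral.integral_congr fun t ht => hk t ?_
      rcases le_total 0 (w x) with h | h
      · rw [uIcc_of_le h] at ht
        rw [abs_of_nonneg ht.1, abs_of_nonneg h]
        exact ht.2
      · rw [uIcc_of_ge h] at ht
        rw [abs_of_nonpos ht.2, abs_of_nonpos h]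
        exact neg_le_neg ht.1
    rw [h1, hk _ le_rfl]
    simp [mul_comm]

/-- `ν Q` is the horizontal derivative of the subgraph of `w` in `Ω × ℝ`, where `|ν| = 1`. -/
structure IsSubgraphDerivative (X : Fin m → E → E) (Ω : Set E) (w : E → ℝ) (Q : Measure (E × ℝ))
    (ν : E × ℝ → EuclideanSpace ℝ (Fin (m + 1))) : Prop where
  measurable : Measurable ν
  norm_le_one : ∀ p, ‖ν p‖ ≤ 1
  norm_eq_one : ∀ᵐ p ∂Q, ‖ν p‖ = 1
  lt_top : ∀ K, IsCompact K → K ⊆ Ω ×ˢ univ → Q K < ⊤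
  integral_inner : ∀ φ : E × ℝ → EuclideanSpace ℝ (Fin (m + 1)), ContDiff ℝ 1 φ →
    IsCompactlySupportedIn (Ω ×ˢ univ) φ →
    ∫ p, inner ℝ (φ p) (ν p) ∂Q = -∫ p in {p : E × ℝ | p.2 < w p.1}, divX (extendedFields X) φ p

namespace IsSubgraphDerivative

variable {Q : Measure (E × ℝ)} {ν : E × ℝ → EuclideanSpace ℝ (Fin (m + 1))}

/-- The dominating measure bounds `Q` on the compact slabs K × [-j, j], hence on their increasing
union, and it projects below `M`. -/
theorem prod_le (hQ : IsSubgraphDerivative X Ω w Q ν) (h : IsGraphMeasure X Ω w M τ)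
    (hΩ : IsOpen Ω) (hX : ∀ i, ContDiff ℝ 1 (X i)) (hw : Integrable w) (hwm : Measurable w)
    {K : Set E} (hK : IsCompact K) (hKΩ : K ⊆ Ω) : Q (K ×ˢ univ) ≤ M K := by
  have := FiniteDimensional.proper_real E
  have : SecondCountableTopology E := inferInstance
  obtain ⟨μ, hμ, hμM, hμφ⟩ := h.exists_dominating_measure hΩ hX hw hwm
  have hunion : K ×ˢ (univ : Set ℝ) = ⋃ j : ℕ, K ×ˢ Icc (-(j : ℝ)) j := by
    rw [← prod_iUnion]
    congr 1
    refine (eq_univ_of_forall fun t => ?_).symm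
    obtain ⟨j, hj⟩ := exists_nat_ge |t|
    exact mem_iUnion.2 ⟨j, abs_le.1 hj⟩
  have hmono : Monotone fun j : ℕ => K ×ˢ Icc (-(j : ℝ)) j := by
    intro i j hij
    have : (i : ℝ) ≤ j := by exact_mod_cast hij
    exact prod_mono le_rfl (Icc_subset_Icc (by linarith) this)
  refine le_trans ?_ (hμM K hK hKΩ)
  rw [hunion, hmono.measure_iUnion, hmono.measure_iUnion]
  refine iSup_mono fun j => ?_
  refine measure_le_of_integral_inner_le (hΩ.prod isOpen_univ) hQ.lt_top hμ hQ.measurable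
    hQ.norm_le_one hQ.norm_eq_one (fun φ hφ hφc => ?_) (hK.prod isCompact_Icc)
    (prod_mono hKΩ (subset_univ _))
  rw [hQ.integral_inner φ hφ hφc]
  exact hμφ φ hφ hφc

/-- This says that νQ projects onto τM. As g ∘ π is not compactly supported, vertical cutoffs are
inserted and removed by dominated convergence, which needs the finite mass over the support of `g`
supplied by `prod_le`. -/
theorem integral_inner_fst (hQ : IsSubgraphDerivative X Ω w Q ν) (h : IsGraphMeasure X Ω w M τ)
    (hΩ : IsOpen Ω) (hX : ∀ i, ContDiff ℝ 1 (X i)) (hw : Integrable w) (hwm : Measurable w)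
    (hg : ContDiff ℝ 1 g) (hgc : IsCompactlySupportedIn Ω g) :
    ∫ p, inner ℝ (g p.1) (ν p) ∂Q = ∫ x, inner ℝ (g x) (τ x) ∂M := by
  have := FiniteDimensional.proper_real E
  have : SecondCountableTopology E := inferInstance
  have hc := hgc.hasCompactSupport
  obtain ⟨η, hη, hηc, hη1, hηt⟩ := exists_vertical_cutoff
  have hsupp : ∀ k, IsCompactlySupportedIn (Ω ×ˢ univ) fun p : E × ℝ => η k p.2 • g p.1 := by
    intro k
    have hsub : tsupport (fun p : E × ℝ => η k p.2 • g p.1) ⊆ tsupport g ×ˢ tsupport (η k) := by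
      refine closure_minimal (fun p hp => ?_) ((isClosed_tsupport _).prod (isClosed_tsupport _))
      exact ⟨subset_tsupport _ (right_ne_zero_of_smul hp),
        subset_tsupport _ (left_ne_zero_of_smul hp)⟩
    exact ⟨((hη k).continuous.comp continuous_snd).smul (hg.continuous.comp continuous_fst),
      (hc.isCompact.prod (hηc k).isCompact).of_isClosed_subset (isClosed_tsupport _) hsub,
      hsub.trans (prod_mono hgc.tsupport_subset (subset_univ _))⟩
  have h1 := (tendsto_integral_lt_graph_divX_smul hX hg hc hwm hw hη hηc hη1 hηt).neg
  have h2 : ∀ k, ∫ p, inner ℝ (η k p.2 • g p.1) (ν p) ∂Q =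
      -∫ p in {p : E × ℝ | p.2 < w p.1},
        divX (extendedFields X) (fun p => η k p.2 • g p.1) p := fun k =>
    hQ.integral_inner _ (((hη k).comp contDiff_snd).smul (hg.comp contDiff_fst)) (hsupp k)
  rw [h.integral_inner g hg hc hgc.tsupport_subset, ← neg_add']
  refine tendsto_nhds_unique ?_ (h1.congr fun k => (h2 k).symm)
  obtain ⟨C, hC⟩ := hgc.continuous.bounded_above_of_compact_support hc
  have hint : Integrable (fun p : E × ℝ => g p.1) Q := by
    have h3 : IntegrableOn (fun p : E × ℝ => g p.1) (tsupport g ×ˢ univ) Q := by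
      refine Measure.integrableOn_of_bounded (M := C) ?_ ?_ (Eventually.of_forall fun p => hC _)
      · exact ((hQ.prod_le h hΩ hX hw hwm hc hgc.tsupport_subset).trans_lt
          (h.lt_top _ hc hgc.tsupport_subset)).ne
      · exact (hg.continuous.measurable.comp measurable_fst).aestronglyMeasurable
    refine (integrableOn_iff_integrable_of_support_subset fun p hp => ?_).1 h3
    exact ⟨subset_tsupport g hp, trivial⟩
  refine tendsto_integral_of_dominated_convergence (fun p => ‖g p.1‖) (fun k => ?_) hint.norm
    (fun k => Eventually.of_forall fun p => ?_) (Eventually.of_forall fun p => ?_)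
  · exact ((hsupp k).continuous.measurable.inner hQ.measurable).aestronglyMeasurable
  · refine (norm_inner_le_norm _ _).trans ?_
    refine (mul_le_of_le_one_right (norm_nonneg _) (hQ.norm_le_one p)).trans ?_
    rw [norm_smul]
    exact mul_le_of_le_one_left (norm_nonneg _) (hη1 k _)
  · refine tendsto_const_nhds.congr' ?_
    filter_upwards [hηt |p.2|] with k hk
    rw [hk _ le_rfl, one_smul]

/-- The field in the projection identity is taken to be τ on `B` and zero elsewhere, approximated by
C¹ fields in L¹ of `M` and of the projection of `Q`; since |τ| = 1, the `M` side becomes the mass of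
`B`. -/
theorem setIntegral_inner_fst (hQ : IsSubgraphDerivative X Ω w Q ν) (h : IsGraphMeasure X Ω w M τ)
    (hΩ : IsOpen Ω) (hX : ∀ i, ContDiff ℝ 1 (X i)) (hw : Integrable w) (hwm : Measurable w)
    (hτ : ∀ᵐ x ∂M, ‖τ x‖ = 1) {B : Set E} (hB : IsRelCompactBorel Ω B) :
    ∫ p in B ×ˢ univ, inner ℝ (τ p.1) (ν p) ∂Q = M.real B := by
  have := FiniteDimensional.proper_real E
  have : SecondCountableTopology E := inferInstance
  obtain ⟨hBm, K, hK, hKΩ, hBK⟩ := hB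
  have hmap : ∀ K, IsCompact K → K ⊆ Ω → Q.map Prod.fst K < ⊤ := fun K hK hKΩ => by
    rw [Measure.map_apply measurable_fst hK.measurableSet]
    have : Prod.fst ⁻¹' K = K ×ˢ (univ : Set ℝ) := by ext; simp
    rw [this]
    exact (hQ.prod_le h hΩ hX hw hwm hK hKΩ).trans_lt (h.lt_top K hK hKΩ)
  have hm : Measurable (B.indicator τ) := h.measurable.indicator hBm
  obtain ⟨φ, hφ, hφc, hφt⟩ := exists_tendsto_contDiff (P := M + Q.map Prod.fst) hΩ
    (fun K hK hKU => ENNReal.add_lt_top.2 ⟨h.lt_top K hK hKU, hmap K hK hKU⟩) hK hKΩ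
    hm.stronglyMeasurable (C := 1)
    (fun z => (norm_indicator_le_norm_self _ _).trans (h.norm_le_one z))
    fun z hz => indicator_of_notMem (fun hzB => hz (hBK hzB)) τ
  have hint : ∀ {R : Measure E}, R K < ⊤ → Integrable (B.indicator τ) R := fun {R} hR =>
    (integrable_indicator_iff hBm).2 (Measure.integrableOn_of_bounded (M := 1)
      ((measure_mono hBK).trans_lt hR).ne
      h.measurable.aestronglyMeasurable (Eventually.of_forall h.norm_le_one))
  have h1 := tendsto_integral_inner (P := M + Q.map Prod.fst) (Measure.le_add_right le_rfl)
    h.measurable h.norm_le_one (hint (h.lt_top K hK hKΩ)) (fun k => (hφc k).integrable h.lt_top) hφt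
  have hφt' : Tendsto (fun k => ∫⁻ p : E × ℝ, ‖φ k p.1 - B.indicator τ p.1‖ₑ ∂Q) atTop (𝓝 0) := by
    refine tendsto_of_tendsto_of_tendsto_of_le_of_le tendsto_const_nhds hφt (fun _ => zero_le)
      fun k => ?_
    refine le_trans (le_of_eq ?_) (lintegral_mono' (Measure.le_add_left le_rfl) le_rfl)
    have hme : Measurable fun x => ‖φ k x - B.indicator τ x‖ₑ :=
      ((hφ k).continuous.measurable.sub hm).enorm
    rw [lintegral_map hme measurable_fst]
  have h2 := tendsto_integral_inner (P := Q) (h := fun p : E × ℝ => B.indicator τ p.1)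
    (φ := fun k p => φ k p.1) le_rfl hQ.measurable hQ.norm_le_one
    ((hint (hmap K hK hKΩ)).comp_measurable measurable_fst)
    (fun k => ((hφc k).integrable hmap).comp_measurable measurable_fst) hφt'
  have h3 := tendsto_nhds_unique (h1.congr fun k =>
    (hQ.integral_inner_fst h hΩ hX hw hwm (hφ k) (hφc k)).symm) h2
  have h4 : ∫ x, inner ℝ (B.indicator τ x) (τ x) ∂M = M.real B := by
    rw [← integral_indicator_one hBm]
    refine integral_congr_ae ?_
    filter_upwards [hτ] with z hz
    by_cases hzK : z ∈ B
    · simp [hzK, hz]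
    · simp [hzK]
  rw [← h4, h3, ← integral_indicator (hBm.prod MeasurableSet.univ)]
  refine integral_congr_ae (Eventually.of_forall fun p => ?_)
  by_cases hp : p.1 ∈ B
  · simp [hp, indicator]
  · simp [hp, indicator]

/-- The normal of the subgraph depends only on the base point. -/
theorem ae_eq (hQ : IsSubgraphDerivative X Ω w Q ν) (h : IsGraphMeasure X Ω w M τ)
    (hΩ : IsOpen Ω) (hX : ∀ i, ContDiff ℝ 1 (X i)) (hw : Integrable w) (hwm : Measurable w)
    (hτ : ∀ᵐ x ∂M, ‖τ x‖ = 1) {K : Set E} (hK : IsCompact K) (hKΩ : K ⊆ Ω) :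
    ∀ᵐ p ∂Q.restrict (K ×ˢ univ), ν p = τ p.1 := by
  have := FiniteDimensional.proper_real E
  have : SecondCountableTopology E := inferInstance
  have hle := hQ.prod_le h hΩ hX hw hwm hK hKΩ
  have hfin := h.lt_top K hK hKΩ
  have hset := hQ.setIntegral_inner_fst h hΩ hX hw hwm hτ (IsRelCompactBorel.of_isCompact hK hKΩ)
  have : IsFiniteMeasure (Q.restrict (K ×ˢ univ)) := ⟨by simpa using hle.trans_lt hfin⟩
  have hτν : ∀ p : E × ℝ, ‖inner ℝ (τ p.1) (ν p)‖ ≤ 1 := fun p =>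
    (norm_inner_le_norm _ _).trans
      (mul_le_one₀ (h.norm_le_one _) (norm_nonneg _) (hQ.norm_le_one p))
  have hi : Integrable (fun p : E × ℝ => inner ℝ (τ p.1) (ν p)) (Q.restrict (K ×ˢ univ)) :=
    Integrable.of_bound ((h.measurable.comp measurable_fst).inner
      hQ.measurable).aestronglyMeasurable 1 (Eventually.of_forall hτν)
  have h0 : ∀ p : E × ℝ, 0 ≤ 1 - inner ℝ (τ p.1) (ν p) := fun p =>
    sub_nonneg.2 ((le_abs_self _).trans (hτν p))
  -- The integrand is nonnegative and its integral is Q(K × ℝ) - M(K) ≤ 0. So τ·ν = 1 almost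
  -- everywhere, which for |τ| ≤ 1 and |ν| = 1 forces equality of the vectors.
  have hz : ∫ p in K ×ˢ univ, (1 - inner ℝ (τ p.1) (ν p)) ∂Q = 0 := by
    refine le_antisymm ?_ (integral_nonneg h0)
    rw [integral_sub (integrable_const _) hi, hset]
    have : Q.real (K ×ˢ univ) ≤ M.real K := ENNReal.toReal_mono hfin.ne hle
    simpa using this
  have hae := (integral_eq_zero_iff_of_nonneg h0 ((integrable_const (1 : ℝ)).sub hi)).1 hz
  filter_upwards [hae, ae_restrict_of_ae hQ.norm_eq_one] with p hp hp1
  have h5 : inner ℝ (τ p.1) (ν p) = 1 := by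
    have : 1 - inner ℝ (τ p.1) (ν p) = 0 := hp
    linarith
  have h6 := norm_sub_sq_real (τ p.1) (ν p)
  rw [h5, hp1] at h6
  have h7 : ‖τ p.1‖ ^ 2 ≤ 1 := pow_le_one₀ (norm_nonneg _) (h.norm_le_one _)
  have h8 : ‖τ p.1 - ν p‖ = 0 := by nlinarith [norm_nonneg (τ p.1 - ν p)]
  exact (sub_eq_zero.1 (norm_eq_zero.1 h8)).symm

/-- Once ν = τ∘π, the product τ·ν equals |ν|² = 1, and `setIntegral_inner_fst` becomes the equality
of masses. -/
theorem prod_eq (hQ : IsSubgraphDerivative X Ω w Q ν) (h : IsGraphMeasure X Ω w M τ)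
    (hΩ : IsOpen Ω) (hX : ∀ i, ContDiff ℝ 1 (X i)) (hw : Integrable w) (hwm : Measurable w)
    (hτ : ∀ᵐ x ∂M, ‖τ x‖ = 1) {B : Set E} (hB : IsRelCompactBorel Ω B) :
    Q (B ×ˢ univ) = M B := by
  have hset := hQ.setIntegral_inner_fst h hΩ hX hw hwm hτ hB
  obtain ⟨hBm, K, hK, hKΩ, hBK⟩ := hB
  have hle := hQ.prod_le h hΩ hX hw hwm hK hKΩ
  have hfin := h.lt_top K hK hKΩ
  have hsub : B ×ˢ (univ : Set ℝ) ⊆ K ×ˢ univ := prod_mono hBK le_rfl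
  have hae : ∀ᵐ p ∂Q.restrict (B ×ˢ univ), inner ℝ (τ p.1) (ν p) = 1 := by
    filter_upwards [ae_restrict_of_ae_restrict_of_subset hsub
      (hQ.ae_eq h hΩ hX hw hwm hτ hK hKΩ), ae_restrict_of_ae hQ.norm_eq_one] with p hp hp1
    rw [← hp, real_inner_self_eq_norm_sq, hp1, one_pow]
  rw [integral_congr_ae hae] at hset
  simp only [integral_const, smul_eq_mul, mul_one, measureReal_restrict_apply_univ] at hset
  exact (ENNReal.toReal_eq_toReal_iff' (((measure_mono hsub).trans hle).trans_lt hfin).ne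
    ((measure_mono hBK).trans_lt hfin).ne).1 hset

end IsSubgraphDerivative

end Projection

/-! ### Push-forward along the projection. -/

/-- The net of all compact subsets is handled by a sequence: the error at any compact set containing
`K j` is at most the integral of ‖f‖ over A \ K j, which tends to zero. -/
theorem tendsto_setIntegral_inter_isCompact {Z V : Type*} [TopologicalSpace Z] [T2Space Z]
    [MeasurableSpace Z] [BorelSpace Z] [NormedAddCommGroup V] [NormedSpace ℝ V] {U A : Set Z}
    {Q : Measure Z} {f : Z → V} (hf : IntegrableOn f A Q) (hA : MeasurableSet A)
    {K : ℕ → Set Z} (hK : ∀ j, IsCompact (K j)) (hKU : ∀ j, K j ⊆ U) (hmono : Monotone K)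
    (hAK : A ⊆ ⋃ j, K j) :
    Tendsto (fun C : {C : Set Z // IsCompact C ∧ C ⊆ U} => ∫ z in A ∩ C, f z ∂Q) atTop
      (𝓝 (∫ z in A, f z ∂Q)) := by
  have hn : IntegrableOn (fun z => ‖f z‖) A Q := hf.norm
  have h1 : Tendsto (fun j => ∫ z in A \ K j, ‖f z‖ ∂Q) atTop (𝓝 0) := by
    have h2 := tendsto_setIntegral_of_antitone (f := fun z => ‖f z‖) (s := fun j => A \ K j)
      (μ := Q) (fun j => hA.diff (hK j).measurableSet)
      (fun i j hij => sdiff_subset_sdiff_right (hmono hij))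
      ⟨0, hn.mono_set sdiff_subset⟩
    have h3 : ⋂ j, A \ K j = ∅ := by
      rw [← sdiff_iUnion, sdiff_eq_empty]
      exact hAK
    rwa [h3, Measure.restrict_empty, integral_zero_measure] at h2
  rw [Metric.tendsto_nhds]
  intro ε hε
  obtain ⟨j, hj⟩ := ((tendsto_order.1 h1).2 ε hε).exists
  filter_upwards [eventually_ge_atTop ⟨K j, hK j, hKU j⟩] with C hC
  have hCm : MeasurableSet (C : Set Z) := C.2.1.measurableSet
  have hsplit := integral_inter_add_sdiff hCm hf
  rw [dist_comm, dist_eq_norm, ← hsplit, add_sub_cancel_left]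
  refine (norm_integral_le_integral_norm _).trans_lt (lt_of_le_of_lt ?_ hj)
  exact setIntegral_mono_set (hn.mono_set sdiff_subset)
    (Eventually.of_forall fun z => norm_nonneg _)
    (Eventually.of_forall (sdiff_subset_sdiff_right hC))

theorem RadonVectorMeasure.restrict_apply {Z V : Type*} [TopologicalSpace Z] [MeasurableSpace Z]
    [NormedAddCommGroup V] {U S : Set Z} (μ : RadonVectorMeasure U V) (hS : MeasurableSet S)
    (B : Set Z) : μ.restrict S B = μ (B ∩ S) :=
  if_pos hS

section Projection

variable {E : Type*} [NormedAddCommGroup E] [NormedSpace ℝ E] [FiniteDimensional ℝ E]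
  [MeasurableSpace E] [BorelSpace E] {Ω : Set E} {M : Measure E} {Q : Measure (E × ℝ)}

theorem map_fst_restrict (hQM : ∀ B, IsRelCompactBorel Ω B → Q (B ×ˢ univ) = M B) {B : Set E}
    (hB : IsRelCompactBorel Ω B) : (Q.restrict (B ×ˢ univ)).map Prod.fst = M.restrict B := by
  ext A hA
  rw [Measure.map_apply measurable_fst hA, Measure.restrict_apply (measurable_fst hA),
    Measure.restrict_apply hA, ← hQM _ (hB.mono (hA.inter hB.1) inter_subset_right)]
  congr 1
  ext p
  simp

theorem exists_compact_cover (hΩ : IsOpen Ω) :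
    ∃ K : ℕ → Set E, (∀ j, IsCompact (K j)) ∧ (∀ j, K j ⊆ Ω) ∧ Ω ⊆ ⋃ j, K j := by
  have := FiniteDimensional.proper_real E
  have := hΩ.locallyCompactSpace
  refine ⟨fun j => Subtype.val '' compactCovering Ω j, fun j =>
    (isCompact_compactCovering Ω j).image continuous_subtype_val,
    fun j => Subtype.coe_image_subset _ _, fun x hx => ?_⟩
  obtain ⟨j, hj⟩ := exists_mem_compactCovering (⟨x, hx⟩ : Ω)
  exact mem_iUnion.2 ⟨j, ⟨x, hx⟩, hj, rfl⟩

theorem ae_of_ae_restrict_prod (hΩ : IsOpen Ω) (hQ0 : Q (Ω ×ˢ univ)ᶜ = 0) {p : E × ℝ → Prop}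
    (h : ∀ K, IsCompact K → K ⊆ Ω → ∀ᵐ z ∂Q.restrict (K ×ˢ univ), p z) : ∀ᵐ z ∂Q, p z := by
  obtain ⟨K, hK, hKΩ, hcov⟩ := exists_compact_cover hΩ
  have h1 : ∀ᵐ z ∂Q, ∀ j, z ∈ K j ×ˢ univ → p z := ae_all_iff.2 fun j =>
    (ae_restrict_iff' ((hK j).measurableSet.prod MeasurableSet.univ)).1 (h _ (hK j) (hKΩ j))
  have h2 : ∀ᵐ z ∂Q, z ∈ Ω ×ˢ (univ : Set ℝ) := hQ0
  filter_upwards [h1, h2] with z hz hzΩ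
  obtain ⟨j, hj⟩ := mem_iUnion.1 (hcov hzΩ.1)
  exact hz j ⟨hj, trivial⟩

/-- The identity of masses is available only on relatively compact sets, so null sets are
transferred over each compact subset of `Ω`, and σ-compactness of `Ω` covers the rest. -/
theorem ae_fst_of_ae (hΩ : IsOpen Ω) (hQ0 : Q (Ω ×ˢ univ)ᶜ = 0)
    (hQM : ∀ B, IsRelCompactBorel Ω B → Q (B ×ˢ univ) = M B) {p : E → Prop}
    (h : ∀ᵐ x ∂M, p x) : ∀ᵐ z ∂Q, p z.1 := by
  refine ae_of_ae_restrict_prod hΩ hQ0 fun K hK hKΩ => ?_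
  have h1 := map_fst_restrict hQM (IsRelCompactBorel.of_isCompact hK hKΩ)
  refine ae_of_ae_map measurable_fst.aemeasurable (p := p) ?_
  rw [h1]
  exact ae_restrict_of_ae h

/-- The push-forward of `ν Q`, restricted to a set which is a cylinder up to `Q`-null sets. -/
theorem RadonVectorMeasure.isPushforward_fst_restrict {m : ℕ}
    {D : RadonVectorMeasure (Ω ×ˢ (univ : Set ℝ)) (EuclideanSpace ℝ (Fin m))}
    {ν : E × ℝ → EuclideanSpace ℝ (Fin m)} (hν : D.IsPolar ν)
    (hQM : ∀ B, IsRelCompactBorel Ω B → D.variation (B ×ˢ univ) = M B)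
    (hM : ∀ K, IsCompact K → K ⊆ Ω → M K < ⊤) {τ : E → EuclideanSpace ℝ (Fin m)}
    (hτm : Measurable τ) (hντ : ∀ᵐ p ∂D.variation, ν p = τ p.1) {S : Set (E × ℝ)}
    (hS : MeasurableSet S) {N : Set E} (hN : MeasurableSet N)
    (hSN : ∀ᵐ p ∂D.variation, p ∈ S ↔ p.1 ∈ N)
    {lam : RadonVectorMeasure Ω (EuclideanSpace ℝ (Fin m))}
    (hlam : ∀ B, IsRelCompactBorel Ω B → lam B = ∫ x in B ∩ N, τ x ∂M) :
    IsPushforward Prod.fst (D.restrict S) lam := by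
  have := FiniteDimensional.proper_real E
  have : SecondCountableTopology E := inferInstance
  intro B hB
  have hpre : ∀ A : Set E, Prod.fst ⁻¹' A = A ×ˢ (univ : Set ℝ) := fun A => by ext; simp
  have hBm : MeasurableSet (Prod.fst ⁻¹' B : Set (E × ℝ)) := measurable_fst hB.1
  obtain ⟨-, K, hK, hKΩ, hBK⟩ := id hB
  have hfin : D.variation (Prod.fst ⁻¹' B) < ⊤ := by
    rw [hpre, hQM B hB]
    exact (measure_mono hBK).trans_lt (hM K hK hKΩ)
  refine ⟨(D.variation_restrict_le hS hBm).trans_lt hfin, ?_⟩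
  have hA : MeasurableSet (Prod.fst ⁻¹' B ∩ S) := hBm.inter hS
  have hνi : IntegrableOn ν (Prod.fst ⁻¹' B ∩ S) D.variation := by
    refine Measure.integrableOn_of_bounded (M := 1) ((measure_mono inter_subset_left).trans_lt
      hfin).ne hν.aestronglyMeasurable ?_
    filter_upwards [ae_restrict_of_ae hν.norm_eq_one] with p hp using hp.le
  have hmono : Monotone fun j : ℕ => K ×ˢ Icc (-(j : ℝ)) j := by
    intro i j hij
    have : (i : ℝ) ≤ j := by exact_mod_cast hij
    exact prod_mono le_rfl (Icc_subset_Icc (by linarith) this)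
  have hcov : Prod.fst ⁻¹' B ∩ S ⊆ ⋃ j : ℕ, K ×ˢ Icc (-(j : ℝ)) j := fun p hp => by
    obtain ⟨j, hj⟩ := exists_nat_ge |p.2|
    exact mem_iUnion.2 ⟨j, hBK hp.1, abs_le.1 hj⟩
  have hlim := tendsto_setIntegral_inter_isCompact (U := Ω ×ˢ (univ : Set ℝ)) hνi hA
    (fun j => hK.prod isCompact_Icc) (fun j => prod_mono hKΩ (subset_univ _)) hmono hcov
  have hBN : IsRelCompactBorel Ω (B ∩ N) := hB.mono (hB.1.inter hN) inter_subset_left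
  have hval : lam B = ∫ p in Prod.fst ⁻¹' B ∩ S, ν p ∂D.variation := by
    -- Up to a null set the domain is the cylinder over B ∩ N, on which ν depends only on the base
    -- point, so the integral can be computed on `E`.
    have h1 : (Prod.fst ⁻¹' B ∩ S : Set (E × ℝ)) =ᵐ[D.variation] (B ∩ N) ×ˢ univ := by
      filter_upwards [hSN] with p hp
      refine propext ?_
      change (p.1 ∈ B ∧ p ∈ S) ↔ ((p.1 ∈ B ∧ p.1 ∈ N) ∧ True)
      rw [hp, and_true]
    rw [hlam B hB, setIntegral_congr_set h1, integral_congr_ae (ae_restrict_of_ae hντ),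
      ← map_fst_restrict hQM hBN, integral_map measurable_fst.aemeasurable
        hτm.aestronglyMeasurable]
  rw [hval]
  refine hlim.congr fun C => ?_
  have hC : IsRelCompactBorel (Ω ×ˢ univ) (Prod.fst ⁻¹' B ∩ S ∩ C) :=
    ⟨hA.inter C.2.1.measurableSet, C, C.2.1, C.2.2, inter_subset_right⟩
  rw [← hν.eq_integral _ hC]
  rw [D.restrict_apply hS, inter_right_comm]

end Projection

/-! ### Direction and mass of (D_H u, -ℒⁿ). -/

theorem norm_sq_euclideanSnoc {m : ℕ} (v : EuclideanSpace ℝ (Fin m)) (t : ℝ) :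
    ‖euclideanSnoc v t‖ ^ 2 = ‖v‖ ^ 2 + t ^ 2 := by
  rw [EuclideanSpace.norm_sq_eq, EuclideanSpace.norm_sq_eq, Fin.sum_univ_castSucc]
  simp

theorem norm_euclideanSnoc_zero {m : ℕ} (v : EuclideanSpace ℝ (Fin m)) :
    ‖euclideanSnoc v 0‖ = ‖v‖ := by
  have := norm_sq_euclideanSnoc v 0
  rwa [zero_pow two_ne_zero, add_zero, sq_eq_sq₀ (norm_nonneg _) (norm_nonneg _)] at this

theorem norm_euclideanSnoc_neg_one {m : ℕ} (v : EuclideanSpace ℝ (Fin m)) :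
    ‖euclideanSnoc v (-1)‖ = √(1 + ‖v‖ ^ 2) := by
  rw [← Real.sqrt_sq (norm_nonneg (euclideanSnoc v (-1))), norm_sq_euclideanSnoc]
  congr 1
  ring

theorem Measurable.euclideanSnoc {Y : Type*} [MeasurableSpace Y] {m : ℕ}
    {f : Y → EuclideanSpace ℝ (Fin m)} {c : Y → ℝ} (hf : Measurable f) (hc : Measurable c) :
    Measurable fun y => euclideanSnoc (f y) (c y) := by
  refine (WithLp.measurable_toLp 2 _).comp (measurable_pi_lambda _ fun j => ?_)
  refine Fin.lastCases ?_ (fun i => ?_) j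
  · simpa using hc
  · simp only [Fin.snoc_castSucc]
    fun_prop

theorem integral_euclideanSnoc {Y : Type*} [MeasurableSpace Y] {m : ℕ} {μ : Measure Y}
    {f : Y → EuclideanSpace ℝ (Fin m)} {c : Y → ℝ} (hf : Integrable f μ) (hc : Integrable c μ) :
    ∫ y, euclideanSnoc (f y) (c y) ∂μ = euclideanSnoc (∫ y, f y ∂μ) (∫ y, c y ∂μ) := by
  ext j
  rw [eval_integral_piLp]
  · refine Fin.lastCases ?_ (fun i => ?_) j
    · simp
    · simp only [euclideanSnoc_castSucc]
      rw [eval_integral_piLp fun i => hf.eval_piLp i]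
  · refine Fin.lastCases ?_ fun i => ?_
    · simpa using hc
    · simpa using hf.eval_piLp i

/-- The direction of the measure `(D_H u, -ℒⁿ)`: `N` carries the singular part. -/
noncomputable def graphDirection {E : Type*} {m : ℕ} (N : Set E)
    (σ f : E → EuclideanSpace ℝ (Fin m)) (x : E) : EuclideanSpace ℝ (Fin (m + 1)) := by
  classical exact
  if x ∈ N then euclideanSnoc (σ x) 0
  else (√(1 + ‖f x‖ ^ 2))⁻¹ • euclideanSnoc (f x) (-1)

/-- The total variation of the measure `(D_H u, -ℒⁿ)`: `N` carries the singular part. -/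
noncomputable def graphMass {E : Type*} [MeasureSpace E] {m : ℕ} (Ω N : Set E)
    (f : E → EuclideanSpace ℝ (Fin m)) (μ : Measure E) : Measure E :=
  ((volume.restrict Ω).withDensity fun x => ENNReal.ofReal √(1 + ‖f x‖ ^ 2)) + μ.restrict N

section GraphMass

variable {E : Type*} {m : ℕ} {N : Set E} {σ f : E → EuclideanSpace ℝ (Fin m)}

theorem graphDirection_of_mem {x : E} (hx : x ∈ N) :
    graphDirection N σ f x = euclideanSnoc (σ x) 0 :=
  if_pos hx

theorem graphDirection_of_notMem {x : E} (hx : x ∉ N) :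
    graphDirection N σ f x = (√(1 + ‖f x‖ ^ 2))⁻¹ • euclideanSnoc (f x) (-1) :=
  if_neg hx

theorem one_le_sqrt_one_add_sq (r : ℝ) : 1 ≤ √(1 + r ^ 2) :=
  Real.one_le_sqrt.2 (by nlinarith [sq_nonneg r])

theorem norm_graphDirection_of_mem {x : E} (hx : x ∈ N) : ‖graphDirection N σ f x‖ = ‖σ x‖ := by
  rw [graphDirection_of_mem hx, norm_euclideanSnoc_zero]

theorem norm_graphDirection_of_notMem {x : E} (hx : x ∉ N) : ‖graphDirection N σ f x‖ = 1 := by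
  have h := one_le_sqrt_one_add_sq ‖f x‖
  rw [graphDirection_of_notMem hx, norm_smul, norm_euclideanSnoc_neg_one, norm_inv,
    Real.norm_of_nonneg (by linarith), inv_mul_cancel₀ (by linarith)]

variable [MeasureSpace E] {Ω : Set E} {μ : Measure E}

theorem measurable_sqrt_one_add_sq (hf : Measurable f) :
    Measurable fun x => ENNReal.ofReal √(1 + ‖f x‖ ^ 2) := by
  fun_prop

theorem measurable_graphDirection (hN : MeasurableSet N) (hσ : Measurable σ) (hf : Measurable f) :
    Measurable (graphDirection N σ f) := by
  classical
  refine Measurable.ite hN (hσ.euclideanSnoc measurable_const) ?_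
  have h1 : Measurable fun x => (√(1 + ‖f x‖ ^ 2))⁻¹ := by fun_prop
  exact h1.smul (hf.euclideanSnoc measurable_const)

/-- The absolutely continuous part of the mass ignores the null set `N`, so on `N` only `μ` counts.
-/
theorem ae_graphMass_of_mem (hN0 : volume N = 0) {p : E → Prop} (h : ∀ᵐ x ∂μ, p x) : ∀ᵐ x ∂graphMass Ω N f μ, x ∈ N → p x := by
  refine (ae_add_measure_iff).2 ⟨?_, ?_⟩
  · refine (withDensity_absolutelyContinuous _ _).ae_le ?_
    have : ∀ᵐ x ∂(volume : Measure E), x ∉ N := measure_eq_zero_iff_ae_notMem.1 hN0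
    filter_upwards [ae_restrict_of_ae this] with x hx hxN using absurd hxN hx
  · filter_upwards [ae_restrict_of_ae h] with x hx _ using hx

theorem ae_graphMass_of_notMem (hN : MeasurableSet N)
    {p : E → Prop} (h : ∀ᵐ x ∂volume.restrict Ω, p x) :
    ∀ᵐ x ∂graphMass Ω N f μ, x ∉ N → p x := by
  refine (ae_add_measure_iff).2 ⟨?_, ?_⟩
  · refine (withDensity_absolutelyContinuous _ _).ae_le ?_
    filter_upwards [h] with x hx _ using hx
  · filter_upwards [ae_restrict_mem hN] with x hx hxN using absurd hx hxN

theorem restrict_graphMass_inter (hN0 : volume N = 0) (hN : MeasurableSet N) {B : Set E}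
    (hB : MeasurableSet B) : (graphMass Ω N f μ).restrict (B ∩ N) = μ.restrict (B ∩ N) := by
  rw [graphMass, Measure.restrict_add, restrict_withDensity (hB.inter hN),
    Measure.restrict_restrict (hB.inter hN), Measure.restrict_restrict (hB.inter hN),
    Measure.restrict_eq_zero.2 (measure_mono_null
      (inter_subset_left.trans inter_subset_right) hN0), withDensity_zero_left, zero_add]
  congr 1
  exact inter_eq_left.2 inter_subset_right

theorem restrict_graphMass_diff (hN0 : volume N = 0) (hN : MeasurableSet N) {B : Set E}
    (hB : MeasurableSet B) (hBΩ : B ⊆ Ω) : (graphMass Ω N f μ).restrict (B \ N) =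
      (volume.restrict B).withDensity fun x => ENNReal.ofReal √(1 + ‖f x‖ ^ 2) := by
  have h1 : (B \ N) ∩ N = ∅ := by
    ext
    simp
  have h2 : (B \ N ∩ Ω : Set E) =ᵐ[volume] B := by
    rw [inter_eq_left.2 (sdiff_subset.trans hBΩ)]
    exact sdiff_null_ae_eq_self hN0
  rw [graphMass, Measure.restrict_add, restrict_withDensity (hB.diff hN),
    Measure.restrict_restrict (hB.diff hN), Measure.restrict_restrict (hB.diff hN), h1,
    Measure.restrict_empty, add_zero, Measure.restrict_congr_set h2]

theorem setIntegral_graphDirection_inter (hN0 : volume N = 0) (hN : MeasurableSet N) {B : Set E}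
    (hB : MeasurableSet B) (hσ : IntegrableOn σ (B ∩ N) μ) :
    ∫ x in B ∩ N, graphDirection N σ f x ∂graphMass Ω N f μ =
      euclideanSnoc (∫ x in B ∩ N, σ x ∂μ) 0 := by
  rw [restrict_graphMass_inter hN0 hN hB, setIntegral_congr_fun (hB.inter hN) fun x hx =>
    graphDirection_of_mem hx.2, integral_euclideanSnoc (c := fun _ => 0) hσ (integrable_zero _ _ _), integral_zero]

/-- Off `N` the density √(1+|f|²) of the mass cancels the normalisation of the direction, leaving
(f, -1)ℒⁿ; removing `N` from `B` costs nothing since it is null. -/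
theorem setIntegral_graphDirection_diff (hN0 : volume N = 0) (hN : MeasurableSet N) {B : Set E}
    (hB : MeasurableSet B) (hBΩ : B ⊆ Ω) (hBfin : volume B < ⊤) (hfm : Measurable f)
    (hf : IntegrableOn f B) :
    ∫ x in B \ N, graphDirection N σ f x ∂graphMass Ω N f μ =
      euclideanSnoc (∫ x in B, f x) (-(volume : Measure E).real B) := by
  have : IsFiniteMeasure (volume.restrict B) := ⟨by simpa using hBfin⟩
  rw [restrict_graphMass_diff hN0 hN hB hBΩ,
    integral_withDensity_eq_integral_toReal_smul (measurable_sqrt_one_add_sq hfm)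
      (Eventually.of_forall fun _ => ENNReal.ofReal_lt_top)]
  have h1 : ∀ᵐ x ∂volume.restrict B, (ENNReal.ofReal √(1 + ‖f x‖ ^ 2)).toReal •
      graphDirection N σ f x = euclideanSnoc (f x) (-1) := by
    have : ∀ᵐ x ∂(volume : Measure E), x ∉ N := measure_eq_zero_iff_ae_notMem.1 hN0
    filter_upwards [ae_restrict_of_ae this] with x hx
    have h := one_le_sqrt_one_add_sq ‖f x‖
    rw [graphDirection_of_notMem hx, ENNReal.toReal_ofReal (Real.sqrt_nonneg _), smul_smul,
      mul_inv_cancel₀ (by linarith), one_smul]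
  rw [integral_congr_ae h1, integral_euclideanSnoc hf (integrable_const _)]
  simp

theorem graphMass_lt_top {K : Set E} (hK : MeasurableSet K) (hKΩ : K ⊆ Ω)
    (hKfin : volume K < ⊤) (hf : IntegrableOn f K) (hμ : μ K < ⊤) :
    graphMass Ω N f μ K < ⊤ := by
  rw [graphMass, Measure.add_apply]
  refine ENNReal.add_lt_top.2 ⟨?_, (Measure.restrict_apply_le _ _).trans_lt hμ⟩
  have : IsFiniteMeasure (volume.restrict K) := ⟨by simpa using hKfin⟩
  rw [withDensity_apply _ hK, Measure.restrict_restrict hK, inter_eq_left.2 hKΩ]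
  refine lt_of_le_of_lt (lintegral_mono fun x => ENNReal.ofReal_le_ofReal ?_)
    ((integrable_const (1 : ℝ)).add hf.norm).lintegral_lt_top
  simp only [Pi.add_apply]
  -- This is √(1 + r²) ≤ 1 + r for r ≥ 0.
  exact Real.sqrt_le_iff.2 ⟨by positivity, by nlinarith [norm_nonneg (f x)]⟩

end GraphMass

/-! ### From set values to the integral identity for (D_H u, -ℒⁿ). -/

section GraphMeasure

variable {E : Type*} [NormedAddCommGroup E] [NormedSpace ℝ E] [FiniteDimensional ℝ E]
  [MeasureSpace E] [BorelSpace E] [(volume : Measure E).IsAddHaarMeasure]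
  {m : ℕ} {X : Fin m → E → E} {Ω : Set E} {u w : E → ℝ} {M : Measure E}
  {τ : E → EuclideanSpace ℝ (Fin (m + 1))}

/-- The field is split into its horizontal part and last component. The horizontal part of τ is a
density of `D` with respect to `M`, so the distributional identity applies; the last component is a
density of -ℒⁿ. -/
theorem IsHDerivative.isGraphMeasure
    {D : RadonVectorMeasure Ω (EuclideanSpace ℝ (Fin m))} (hD : IsHDerivative X Ω u D)
    (huw : u =ᵐ[volume.restrict Ω] w) (hτ : Measurable τ) (hτ1 : ∀ x, ‖τ x‖ ≤ 1)
    (hM : ∀ K, IsCompact K → K ⊆ Ω → M K < ⊤)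
    (hτM : ∀ B, IsRelCompactBorel Ω B →
      ∫ x in B, τ x ∂M = euclideanSnoc (D B) (-(volume : Measure E).real B)) :
    IsGraphMeasure X Ω w M τ := by
  have := FiniteDimensional.proper_real E
  have : SecondCountableTopology E := inferInstance
  refine ⟨hτ, hτ1, hM, fun g hg hc hs => ?_⟩
  have hτi : ∀ B, IsRelCompactBorel Ω B → IntegrableOn τ B M := fun B hB => by
    obtain ⟨hBm, K, hK, hKΩ, hBK⟩ := hB
    exact Measure.integrableOn_of_bounded (M := 1)
      ((measure_mono hBK).trans_lt (hM K hK hKΩ)).ne hτ.aestronglyMeasurable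
      (Eventually.of_forall hτ1)
  set gH : E → EuclideanSpace ℝ (Fin m) := fun y => WithLp.toLp 2 fun i => g y i.castSucc
  set τH : E → EuclideanSpace ℝ (Fin m) := fun y => WithLp.toLp 2 fun i => τ y i.castSucc
  have hsub : tsupport gH ⊆ tsupport g := by
    refine closure_mono fun x hx h0 => hx ?_
    ext i
    simp [gH, h0]
  have hgH : ContDiff ℝ 1 gH := by fun_prop
  have hcH : HasCompactSupport gH := hc.of_isClosed_subset (isClosed_tsupport _) hsub
  have hsL : tsupport (fun x => g x (Fin.last m)) ⊆ tsupport g :=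
    closure_mono fun x hx h0 => hx (by simp [h0])
  have hgL : Continuous fun x => g x (Fin.last m) := by
    have := hg.continuous
    fun_prop
  have hcL : HasCompactSupport fun x => g x (Fin.last m) :=
    hc.of_isClosed_subset (isClosed_tsupport _) hsL
  obtain ⟨C, hC⟩ := hcH.exists_bound_of_continuous hgH.continuous
  obtain ⟨C', hC'⟩ := hcL.exists_bound_of_continuous hgL
  have hK := IsRelCompactBorel.of_isCompact (U := Ω) hc hs
  have hKi := hτi _ hK
  have hKiH : IntegrableOn τH (tsupport g) M := Integrable.of_eval_piLp fun i => hKi.eval_piLp _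
  have h1 := hD gH hgH hcH (hsub.trans hs)
  rw [D.onCompact_integral_eq hcH (hsub.trans hs) (hKiH.mono_set hsub) (fun B hB hBK => ?_)
    hgH.continuous.stronglyMeasurable hC] at h1
  swap
  · have h2 := hτM B (hK.mono hB (hBK.trans hsub))
    have hBi := hτi B (hK.mono hB (hBK.trans hsub))
    ext i
    rw [eval_integral_piLp fun i => (hKiH.mono_set (hBK.trans hsub)).eval_piLp i]
    have h3 := congrArg (fun v : EuclideanSpace ℝ (Fin (m + 1)) => v i.castSucc) h2
    simp only [euclideanSnoc_castSucc] at h3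
    rw [← h3, eval_integral_piLp fun i => hBi.eval_piLp i]
  rw [setIntegral_eq_integral_of_forall_compl_eq_zero fun x hx => by
    rw [image_eq_zero_of_notMem_tsupport hx, inner_zero_left]] at h1
  have hKL := hK.mono (isClosed_tsupport _).measurableSet hsL
  -- The scalar measure -ℒⁿ has two representations, with density τ_{m+1} relative to `M` and
  -- density -1 relative to `volume`; computing one integral both ways equates them.
  have h4 := (-RadonVectorMeasure.ofMeasure Ω (volume : Measure E)).onCompact_integral_eq
    hcL (hsL.trans hs) (h := fun x => τ x (Fin.last m)) (P := M)
    ((hKi.mono_set hsL).eval_piLp _) (fun B hB hBK => by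
      have hBc := hK.mono hB (hBK.trans hsL)
      have h3 := congrArg (fun v : EuclideanSpace ℝ (Fin (m + 1)) => v (Fin.last m)) (hτM B hBc)
      simp only [euclideanSnoc_last] at h3
      rw [eval_integral_piLp fun i => (hτi B hBc).eval_piLp i] at h3
      exact h3.symm)
    hgL.stronglyMeasurable hC'
  rw [(-RadonVectorMeasure.ofMeasure Ω (volume : Measure E)).onCompact_integral_eq
    hcL (hsL.trans hs) (h := fun x => (-1 : ℝ)) (P := volume)
    (integrableOn_const hcL.isCompact.measure_lt_top.ne) (fun B hB hBK => by
      rw [setIntegral_const, smul_eq_mul, mul_neg_one]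
      rfl)
    hgL.stronglyMeasurable hC',
    setIntegral_eq_integral_of_forall_compl_eq_zero fun x hx => by
      rw [image_eq_zero_of_notMem_tsupport hx, inner_zero_left],
    setIntegral_eq_integral_of_forall_compl_eq_zero fun x hx => by
      rw [image_eq_zero_of_notMem_tsupport hx, inner_zero_left]] at h4
  have h5 : ∀ x, inner ℝ (g x) (τ x) =
      inner ℝ (gH x) (τH x) + inner ℝ (g x (Fin.last m)) (τ x (Fin.last m)) := fun x => by
    simp only [PiLp.inner_apply, Fin.sum_univ_castSucc, gH, τH]
  have hiH : Integrable (fun x => inner ℝ (gH x) (τH x)) M := by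
    refine (integrableOn_iff_integrable_of_support_subset (s := tsupport g) fun x hx =>
      hsub (subset_tsupport _ fun h0 => hx (by simp only [h0, inner_zero_left]))).1 ?_
    refine hKiH.norm.const_mul C |>.mono (hgH.continuous.aestronglyMeasurable.inner
      hKiH.aestronglyMeasurable) (Eventually.of_forall fun x => ?_)
    rw [norm_mul, norm_norm]
    exact (norm_inner_le_norm _ _).trans
      (mul_le_mul_of_nonneg_right ((hC x).trans (le_abs_self C)) (norm_nonneg _))
  have hiL : Integrable (fun x => inner ℝ (g x (Fin.last m)) (τ x (Fin.last m))) M := by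
    have hKL := hKi.eval_piLp (Fin.last m)
    refine (integrableOn_iff_integrable_of_support_subset (s := tsupport g) fun x hx =>
      hsL (subset_tsupport _ fun h0 => hx (by
        simp only at h0
        simp only [h0, inner_zero_left]))).1 ?_
    refine hKL.norm.const_mul C' |>.mono (hgL.aestronglyMeasurable.inner
      hKL.aestronglyMeasurable) (Eventually.of_forall fun x => ?_)
    rw [norm_mul, norm_norm]
    exact (norm_inner_le_norm _ _).trans
      (mul_le_mul_of_nonneg_right ((hC' x).trans (le_abs_self C')) (norm_nonneg _))
  simp_rw [h5]
  rw [integral_add hiH hiL, h1, ← h4, sub_eq_add_neg]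
  congr 1
  · congr 1
    rw [← setIntegral_eq_integral_of_forall_compl_eq_zero (s := Ω) (f := fun x => w x * _)
      fun x hx => by rw [horizontalDiv_eq_zero fun h => hx (hs h), mul_zero]]
    refine integral_congr_ae ?_
    filter_upwards [huw] with x hx
    rw [hx]
    rfl
  · simp [integral_neg]

end GraphMeasure

/-! ### Polar form of (D_H u, -ℒⁿ) from the Lebesgue decomposition. -/

section Decomposition

variable {E : Type*} [NormedAddCommGroup E] [NormedSpace ℝ E] [FiniteDimensional ℝ E]
  [MeasureSpace E] [BorelSpace E] [(volume : Measure E).IsAddHaarMeasure]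
  {m : ℕ} {X : Fin m → E → E} {Ω : Set E} {u : E → ℝ}

/-- The singular part is the restriction to a null set. -/
theorem RadonVectorMeasure.IsLebesgueDecomposition.exists_null_set
    {D Da Ds : RadonVectorMeasure Ω (EuclideanSpace ℝ (Fin m))}
    (h : D.IsLebesgueDecomposition Da Ds volume) :
    ∃ N : Set E, MeasurableSet N ∧ volume N = 0 ∧
      ∀ B, IsRelCompactBorel Ω B → Ds B = D (B ∩ N) := by
  obtain ⟨S, hS, hS0, hSc⟩ := h.mutuallySingular
  refine ⟨Sᶜ, hS.compl, hSc, fun B hB => ?_⟩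
  have h1 := hB.mono (hB.1.inter hS) inter_subset_left
  have h2 := hB.mono (hB.1.inter hS.compl) inter_subset_left
  have h3 := Ds.apply_union h1 h2
    (disjoint_compl_right.mono inter_subset_right inter_subset_right)
  rw [inter_union_compl, Ds.apply_eq_zero h1 (measure_mono_null inter_subset_right hS0),
    zero_add] at h3
  rw [h3, h.eq_add _ h2, Da.apply_eq_zero h2 (h.absolutelyContinuous
    (measure_mono_null inter_subset_right hSc)), zero_add]

/-- The measure `(D_H u, -ℒⁿ)` in polar form. -/
theorem IsHDerivative.exists_isGraphMeasure
    (hΩ : IsOpen Ω) (hu : IntegrableOn u Ω)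
    {Du : RadonVectorMeasure Ω (EuclideanSpace ℝ (Fin m))} (hDu : IsHDerivative X Ω u Du)
    {σ : E → EuclideanSpace ℝ (Fin m)} (hσ : Du.IsPolar σ)
    {Dau Dsu : RadonVectorMeasure Ω (EuclideanSpace ℝ (Fin m))}
    (hdec : Du.IsLebesgueDecomposition Dau Dsu volume)
    {Xu : E → EuclideanSpace ℝ (Fin m)} (hXu : Dau.HasDensity Xu volume) :
    ∃ (w : E → ℝ) (M : Measure E) (τ : E → EuclideanSpace ℝ (Fin (m + 1))) (N : Set E),
      Measurable w ∧ Integrable w ∧ u =ᵐ[volume.restrict Ω] w ∧ MeasurableSet N ∧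
      IsGraphMeasure X Ω w M τ ∧ (∀ᵐ x ∂M, ‖τ x‖ = 1) ∧
      (∀ᵐ x ∂M, x ∈ N → τ x = euclideanSnoc (σ x) 0) ∧
      (∀ᵐ x ∂M, x ∉ N → τ x = (√(1 + ‖Xu x‖ ^ 2))⁻¹ • euclideanSnoc (Xu x) (-1)) ∧
      (∀ B, IsRelCompactBorel Ω B → ∫ x in B ∩ N, τ x ∂M = euclideanSnoc (Dsu B) 0) ∧
      ∀ B, IsRelCompactBorel Ω B →
        ∫ x in B ∩ Nᶜ, τ x ∂M = euclideanSnoc (Dau B) (-(volume : Measure E).real B) := by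
  have := FiniteDimensional.proper_real E
  have : SecondCountableTopology E := inferInstance
  obtain ⟨N, hN, hN0, hDs⟩ := hdec.exists_null_set
  -- A measurable representative of `u` extended by zero: mollification requires a function
  -- integrable on the whole space.
  set w : E → ℝ := Ω.indicator (hu.1.mk u)
  have hwm : Measurable w := hu.1.stronglyMeasurable_mk.measurable.indicator hΩ.measurableSet
  have huw : u =ᵐ[volume.restrict Ω] w := by
    filter_upwards [hu.1.ae_eq_mk, ae_restrict_mem hΩ.measurableSet] with x hx hxΩ
    rw [hx]
    exact (indicator_of_mem hxΩ _).symm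
  have hw : Integrable w := (integrable_indicator_iff hΩ.measurableSet).2
    (hu.congr hu.1.ae_eq_mk)
  have hfae : AEStronglyMeasurable Xu (volume.restrict Ω) := hXu.1.aestronglyMeasurable
  set f := hfae.mk Xu
  have hfm : Measurable f := hfae.stronglyMeasurable_mk.measurable
  have hff : Xu =ᵐ[volume.restrict Ω] f := hfae.ae_eq_mk
  have hσae := hσ.aestronglyMeasurable
  have hσm : Measurable (hσae.mk σ) := hσae.stronglyMeasurable_mk.measurable
  -- `IsGraphMeasure` requires norm at most 1 at every point, whereas the polar vector has norm 1
  -- only almost everywhere; the exceptional values are replaced by 0.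
  set σ' : E → EuclideanSpace ℝ (Fin m) := {x | ‖hσae.mk σ x‖ ≤ 1}.indicator (hσae.mk σ)
  have hσ'm : Measurable σ' := hσm.indicator (measurableSet_le hσm.norm measurable_const)
  have hσ'1 : ∀ x, ‖σ' x‖ ≤ 1 := fun x => by
    by_cases hx : ‖hσae.mk σ x‖ ≤ 1
    · simpa [σ', indicator_of_mem (show x ∈ {x | ‖hσae.mk σ x‖ ≤ 1} from hx)] using hx
    · simp [σ', indicator_of_notMem (show x ∉ {x | ‖hσae.mk σ x‖ ≤ 1} from hx)]
  have hσσ : σ =ᵐ[Du.variation] σ' := by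
    filter_upwards [hσae.ae_eq_mk, hσ.norm_eq_one] with x hx hx1
    have hle : x ∈ {x | ‖hσae.mk σ x‖ ≤ 1} := by
      rw [mem_ofPred_eq, ← hx, hx1]
    rw [hx]
    exact (indicator_of_mem hle _).symm
  set M := graphMass Ω N f Du.variation
  set τ := graphDirection N σ' f
  have hτm : Measurable τ := measurable_graphDirection hN hσ'm hfm
  have hτ1 : ∀ x, ‖τ x‖ ≤ 1 := fun x => by
    by_cases hx : x ∈ N
    · exact (norm_graphDirection_of_mem hx).trans_le (hσ'1 x)
    · exact (norm_graphDirection_of_notMem hx).le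
  have hfi : ∀ B, IsRelCompactBorel Ω B → IntegrableOn f B := fun B hB => by
    obtain ⟨-, K, hK, hKΩ, hBK⟩ := hB
    have hfK : IntegrableOn f K := (hXu.1.integrableOn_compact_subset hKΩ hK).congr
      (ae_restrict_of_ae_restrict_of_subset hKΩ hff)
    exact hfK.mono_set hBK
  have hMfin : ∀ K, IsCompact K → K ⊆ Ω → M K < ⊤ := fun K hK hKΩ =>
    graphMass_lt_top hK.measurableSet hKΩ hK.measure_lt_top
      (hfi K (IsRelCompactBorel.of_isCompact hK hKΩ)) (Du.variation_lt_top hK hKΩ)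
  have hsing : ∀ B, IsRelCompactBorel Ω B → ∫ x in B ∩ N, τ x ∂M = euclideanSnoc (Dsu B) 0 := by
    intro B hB
    obtain ⟨-, K, hK, hKΩ, hBK⟩ := id hB
    rw [setIntegral_graphDirection_inter hN0 hN hB.1, hDs B hB,
      hσ.eq_integral _ (hB.mono (hB.1.inter hN) inter_subset_left),
      integral_congr_ae (ae_restrict_of_ae hσσ)]
    exact Measure.integrableOn_of_bounded (M := 1)
      ((measure_mono (inter_subset_left.trans hBK)).trans_lt (Du.variation_lt_top hK hKΩ)).ne
      hσ'm.aestronglyMeasurable (Eventually.of_forall hσ'1)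
  have hac : ∀ B, IsRelCompactBorel Ω B →
      ∫ x in B ∩ Nᶜ, τ x ∂M = euclideanSnoc (Dau B) (-(volume : Measure E).real B) := by
    intro B hB
    obtain ⟨-, K, hK, hKΩ, hBK⟩ := id hB
    rw [← Set.sdiff_eq, setIntegral_graphDirection_diff hN0 hN hB.1 (hBK.trans hKΩ)
      ((measure_mono hBK).trans_lt hK.measure_lt_top) hfm (hfi B hB), hXu.2 B hB,
      integral_congr_ae (ae_restrict_of_ae_restrict_of_subset (hBK.trans hKΩ) hff)]
  have hτM : ∀ B, IsRelCompactBorel Ω B →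
      ∫ x in B, τ x ∂M = euclideanSnoc (Du B) (-(volume : Measure E).real B) := by
    intro B hB
    obtain ⟨-, K, hK, hKΩ, hBK⟩ := id hB
    have hi : IntegrableOn τ B M := Measure.integrableOn_of_bounded (M := 1)
      ((measure_mono hBK).trans_lt (hMfin K hK hKΩ)).ne hτm.aestronglyMeasurable
      (Eventually.of_forall hτ1)
    rw [← integral_inter_add_sdiff hN hi, Set.sdiff_eq, hsing B hB, hac B hB, hdec.eq_add B hB]
    ext j
    refine Fin.lastCases ?_ (fun i => ?_) j
    · simp
    · simp [add_comm]
  refine ⟨w, M, τ, N, hwm, hw, huw, hN, hDu.isGraphMeasure huw hτm hτ1 hMfin hτM, ?_, ?_, ?_,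
    hsing, hac⟩
  · have h1 : ∀ᵐ x ∂Du.variation, ‖σ' x‖ = 1 := by
      filter_upwards [hσσ, hσ.norm_eq_one] with x hx hx1
      rw [← hx, hx1]
    filter_upwards [ae_graphMass_of_mem hN0 h1] with x hx
    by_cases hxN : x ∈ N
    · exact (norm_graphDirection_of_mem hxN).trans (hx hxN)
    · exact norm_graphDirection_of_notMem hxN
  · filter_upwards [ae_graphMass_of_mem hN0 hσσ] with x hx hxN
    rw [hx hxN]
    exact graphDirection_of_mem hxN
  · filter_upwards [ae_graphMass_of_notMem hN hff] with x hx hxN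
    rw [hx hxN]
    exact graphDirection_of_notMem hxN

end Decomposition

/-! ### Assembly of the theorem. -/

theorem RadonVectorMeasure.IsPolar.isSubgraphDerivative {E : Type*} [NormedAddCommGroup E]
    [NormedSpace ℝ E] [FiniteDimensional ℝ E] [MeasureSpace E] [BorelSpace E]
    [(volume : Measure E).IsAddHaarMeasure] {m : ℕ} {X : Fin m → E → E} {Ω : Set E} {u w : E → ℝ}
    {D : RadonVectorMeasure (Ω ×ˢ (univ : Set ℝ)) (EuclideanSpace ℝ (Fin (m + 1)))}
    {ν : E × ℝ → EuclideanSpace ℝ (Fin (m + 1))} (hν : D.IsPolar ν) (hνm : Measurable ν)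
    (hD : IsHDerivative (extendedFields X) (Ω ×ˢ univ)
      ((subgraph Ω u).indicator (fun _ => (1 : ℝ))) D)
    (hΩ : MeasurableSet Ω) (huw : u =ᵐ[volume.restrict Ω] w) (hw : Measurable w) :
    ∃ ν', ν =ᵐ[D.variation] ν' ∧ IsSubgraphDerivative X Ω w D.variation ν' := by
  have := FiniteDimensional.proper_real E
  have : SecondCountableTopology E := inferInstance
  -- As for σ, the norm bound is made to hold everywhere by changing ν on a null set.
  set ν' := {p | ‖ν p‖ ≤ 1}.indicator ν
  have hνν : ν =ᵐ[D.variation] ν' := by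
    filter_upwards [hν.norm_eq_one] with p hp
    exact (indicator_of_mem (show p ∈ {p | ‖ν p‖ ≤ 1} from hp.le) _).symm
  have hν'm : Measurable ν' := hνm.indicator (measurableSet_le hνm.norm measurable_const)
  refine ⟨ν', hνν, hν'm, fun p => ?_, ?_, fun K hK hKU => D.variation_lt_top hK hKU,
    fun φ hφ hφc => ?_⟩
  · by_cases hp : ‖ν p‖ ≤ 1
    · simpa [ν', indicator_of_mem (show p ∈ {p | ‖ν p‖ ≤ 1} from hp)] using hp
    · simp [ν', indicator_of_notMem (show p ∉ {p | ‖ν p‖ ≤ 1} from hp)]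
  · filter_upwards [hνν, hν.norm_eq_one] with p hp hp1
    rw [← hp, hp1]
  · have hc := hφc.hasCompactSupport
    obtain ⟨C, hC⟩ := hc.exists_bound_of_continuous hφ.continuous
    have hi : IntegrableOn ν (tsupport φ) D.variation :=
      Measure.integrableOn_of_bounded (M := 1) (D.variation_lt_top hc hφc.tsupport_subset).ne
        hνm.aestronglyMeasurable (ae_restrict_of_ae (hν.norm_eq_one.mono fun p hp => hp.le))
    have h1 := (isHDerivative_subgraph_iff hΩ huw hw D).1 hD φ hφ hc hφc.tsupport_subset
    rw [D.onCompact_integral_eq hc hφc.tsupport_subset hi (fun B hB hBK => hν.eq_integral B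
      ((IsRelCompactBorel.of_isCompact hc hφc.tsupport_subset).mono hB hBK))
      hφ.continuous.stronglyMeasurable hC,
      setIntegral_eq_integral_of_forall_compl_eq_zero fun x hx => by
        rw [image_eq_zero_of_notMem_tsupport hx, inner_zero_left]] at h1
    rw [← h1]
    refine integral_congr_ae ?_
    filter_upwards [hνν] with p hp
    rw [hp]

theorem theorem4 {n m : ℕ}
    (X : Fin m → EuclideanSpace ℝ (Fin n) → EuclideanSpace ℝ (Fin n))
    (hX : ∀ i, ContDiff ℝ ∞ (X i))
    (hXli : ∀ x, LinearIndependent ℝ (fun i => X i x))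
    (Ω : Set (EuclideanSpace ℝ (Fin n))) (hΩ : IsOpen Ω)
    (u : EuclideanSpace ℝ (Fin n) → ℝ) (hu : MemBVH X Ω u)
    -- the horizontal derivative `D_H u`, its polar vector `σ_u`
    (Du : RadonVectorMeasure Ω (EuclideanSpace ℝ (Fin m))) (hDu : IsHDerivative X Ω u Du)
    (σ : EuclideanSpace ℝ (Fin n) → EuclideanSpace ℝ (Fin m)) (hσ : Du.IsPolar σ)
    -- the parts `D_H^a u = Xu L^n` and `D_H^s u`
    (Dau Dsu : RadonVectorMeasure Ω (EuclideanSpace ℝ (Fin m)))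
    (hdec : Du.IsLebesgueDecomposition Dau Dsu volume)
    (Xu : EuclideanSpace ℝ (Fin n) → EuclideanSpace ℝ (Fin m)) (hXu : Dau.HasDensity Xu volume) :
    -- the subgraph has locally finite perimeter in `Ω × ℝ`
    MemBVHLoc (extendedFields X) (Ω ×ˢ univ) ((subgraph Ω u).indicator (fun _ => (1 : ℝ))) ∧
    -- `Dχ` is the horizontal derivative of the characteristic function of the subgraph,
    -- `ν` is the horizontal inner normal
    ∀ (Dχ : RadonVectorMeasure (Ω ×ˢ (univ : Set ℝ)) (EuclideanSpace ℝ (Fin (m + 1))))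
      (_ : IsHDerivative (extendedFields X) (Ω ×ˢ univ)
        ((subgraph Ω u).indicator (fun _ => (1 : ℝ))) Dχ)
      (ν : EuclideanSpace ℝ (Fin n) × ℝ → EuclideanSpace ℝ (Fin (m + 1)))
      (_ : Measurable ν) (_ : Dχ.IsPolar ν)
      (S T : Set (EuclideanSpace ℝ (Fin n) × ℝ))
      (_ : S = {p | p.1 ∈ Ω ∧ ν p (Fin.last m) = 0})
      (_ : T = {p | p.1 ∈ Ω ∧ ν p (Fin.last m) ≠ 0}),
      (∀ᵐ p ∂Dχ.variation, p ∈ S → ν p = euclideanSnoc (σ p.1) 0) ∧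
      (∀ᵐ p ∂Dχ.variation, p ∈ T →
        ν p = (√(1 + ‖Xu p.1‖ ^ 2))⁻¹ • euclideanSnoc (Xu p.1) (-1)) ∧
      RadonVectorMeasure.IsPushforward Prod.fst (Dχ.restrict S) (Dsu.snoc 0) ∧
      RadonVectorMeasure.IsPushforward Prod.fst (Dχ.restrict T)
        (Dau.snoc (-RadonVectorMeasure.ofMeasure Ω volume)) := by
  have hX1 : ∀ i, ContDiff ℝ 1 (X i) := fun i => (hX i).of_le (mod_cast le_top)
  obtain ⟨w, M, τ, N, hwm, hw, huw, hN, hM, hτ1, hτN, hτNc, hsing, hac⟩ :=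
    hDu.exists_isGraphMeasure hΩ hu.1 hσ hdec hXu
  have hΩm := hΩ.measurableSet
  refine ⟨⟨(locallyIntegrable_indicator_subgraph hΩm huw hwm).locallyIntegrableOn _, ?_⟩, ?_⟩
  · obtain ⟨D, hD⟩ := hM.exists_isHDerivative hΩ hX1 hw hwm
    exact ⟨D, (isHDerivative_subgraph_iff hΩm huw hwm D).2 hD⟩
  rintro Dχ hDχ ν hνm hν S T rfl rfl
  obtain ⟨ν', hνν, hQ⟩ := hν.isSubgraphDerivative hνm hDχ hΩm huw hwm
  have hQ0 : Dχ.variation (Ω ×ˢ univ)ᶜ = 0 :=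
    Dχ.variation_compl (hΩm.prod MeasurableSet.univ)
  have hQM : ∀ B, IsRelCompactBorel Ω B → Dχ.variation (B ×ˢ univ) = M B := fun B hB =>
    hQ.prod_eq hM hΩ hX1 hw hwm hτ1 hB
  have hντ : ∀ᵐ p ∂Dχ.variation, ν p = τ p.1 := by
    filter_upwards [hνν, ae_of_ae_restrict_prod hΩ hQ0 fun K hK hKΩ =>
      hQ.ae_eq hM hΩ hX1 hw hwm hτ1 hK hKΩ] with p hp hp1
    rw [hp, hp1]
  have hN1 := ae_fst_of_ae hΩ hQ0 hQM hτN
  have hN2 := ae_fst_of_ae hΩ hQ0 hQM hτNc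
  have hlast : Measurable fun p => ν p (Fin.last m) := by fun_prop
  -- The last component of τ is 0 over `N` and -1/√(1+|Xu|²) ≠ 0 elsewhere, so the sign condition on
  -- ν detects `N`: up to null sets, S and T are the cylinders over `N` and its complement.
  have hmem : ∀ᵐ p ∂Dχ.variation, p.1 ∈ Ω ∧ (ν p (Fin.last m) = 0 ↔ p.1 ∈ N) := by
    have h2 : ∀ᵐ p ∂Dχ.variation, p ∈ Ω ×ˢ (univ : Set ℝ) := hQ0
    filter_upwards [hντ, hN1, hN2, h2] with p hp h1 h2 h3
    refine ⟨h3.1, fun h0 => ?_, fun hpN => ?_⟩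
    · by_contra hpN
      rw [hp, h2 hpN] at h0
      have := one_le_sqrt_one_add_sq ‖Xu p.1‖
      simp only [PiLp.smul_apply, euclideanSnoc_last, smul_eq_mul, mul_neg, mul_one, neg_eq_zero,
        inv_eq_zero] at h0
      linarith
    · rw [hp, h1 hpN, euclideanSnoc_last]
  refine ⟨?_, ?_, ?_, ?_⟩
  · filter_upwards [hντ, hN1, hmem] with p hp h1 h2 hpS
    rw [hp, h1 (h2.2.1 hpS.2)]
  · filter_upwards [hντ, hN2, hmem] with p hp h1 h2 hpT
    rw [hp, h1 fun h => hpT.2 (h2.2.2 h)]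
  · refine RadonVectorMeasure.isPushforward_fst_restrict hν hQM hM.lt_top hM.measurable hντ
      ((measurable_fst hΩm).inter (hlast (measurableSet_singleton 0))) hN ?_ fun B hB =>
        (hsing B hB).symm
    filter_upwards [hmem] with p hp
    exact ⟨fun h => hp.2.1 h.2, fun h => ⟨hp.1, hp.2.2 h⟩⟩
  · refine RadonVectorMeasure.isPushforward_fst_restrict hν hQM hM.lt_top hM.measurable hντ
      ((measurable_fst hΩm).inter (hlast (measurableSet_singleton 0).compl)) hN.compl ?_
      fun B hB => (hac B hB).symm
    filter_upwards [hmem] with p hp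
    exact ⟨fun h hpN => h.2 (hp.2.2 hpN), fun h => ⟨hp.1, fun h0 => h (hp.2.1 h0)⟩⟩
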